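/- **The algebra.** Let $q_1,q_2,q_3\in\mathbb C$ with $q_1q_2q_3=1$ and $g(z,w)=(z-q_1w)(z-q_2w)(z-q_3w)$. Let $\mathcal E$ be the associative $\mathbb C$-algebra with generators $e_k,f_k$ ($k\in\mathbb Z$), $\psi^+_k,\psi^-_{-k}$ ($k\ge 0$), $(\psi_0^\pm)^{-1}$ and, with $e(z)=\sum_{k\in\mathbb Z} e_kz^{-k}$, $f(z)=\sum_{k\in\mathbb Z} f_kz^{-k}$, $\psi^\pm(z)=\sum_{\pm k\ge0}\psi^\pm_kz^{-k}$, $\delta(z)=\sum_{k\in\mathbb Z}z^k$, the defining relations $$g(z,w)e(z)e(w)=-g(w,z)e(w)e(z),\quad g(w,z)f(z)f(w)=-g(z,w)f(w)f(z),$$ $$g(z,w)\psi^\pm(z)e(w)=-g(w,z)e(w)\psi^\pm(z),\quad g(w,z)\psi^\pm(z)f(w)=-g(z,w)f(w)\psi^\pm(z),$$ $$[e(z),f(w)]=\frac{\delta(z/w)}{g(1,1)}(\psi^+(z)-\psi^-(z)),\quad [\psi^\pm_i,\psi^\pm_j]=[\psi^\pm_i,\psi^\mp_j]=0,\quad \psi_0^\pm(\psi_0^\pm)^{-1}=(\psi_0^\pm)^{-1}\psi_0^\pm=1,$$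 $$[e_0,[e_1,e_{-1}]]=[f_0,[f_1,f_{-1}]]=0,$$ graded by $\deg e_k=1$, $\deg f_k=-1$, $\deg\psi^\pm_k=0$. **Matrix coefficients.** For a partition $\lambda=(\lambda_1\ge\lambda_2\ge\cdots)$ with finitely many non-zero parts, put $$\Psi_{\lambda,j}(x)=\frac{(1-q_1^{\lambda_j}q_3^{j}x)(1-q_1^{\lambda_j}q_2q_3^{j-1}x)}{(1-q_1^{\lambda_j}q_3^{j-1}x)(1-q_1^{\lambda_j-1}q_3^{j-1}x)},\qquad \psi_\emptyset(x)=\frac{1-q_2x}{1-x},\qquad \psi_\lambda(x)=\psi_\emptyset(x)\prod_{j\ge1}\frac{\Psi_{\lambda,j}(x)}{\Psi_{\emptyset,j}(x)} .$$ Denote by $\psi^+_\lambda(u/z)$ and $\psi^-_\lambda(u/z)$ the expansions of $\psi_\lambda(u/z)$ in powers of $z^{-1}$ and of $z$ respectively. Let $n\ge2$ and let $q_1,q_2,u_1,\dots,u_n$ be generic (non-zero, and no non-trivial monomial in them equals $1$). In the basis $|\boldsymbol\lambda\rangle=|\lambda^{(1)},\dots,\lambda^{(n)}\rangle$ of the tensor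 product of $n$ Fock modules $\mathcal F(u_1)\otimes\cdots\otimes\mathcal F(u_n)$, the coproduct rule $\Delta e=e\otimes1+\psi^-\otimes e$, $\Delta f=f\otimes\psi^++1\otimes f$, $\Delta\psi^\pm=\psi^\pm\otimes\psi^\pm$ gives the following matrix coefficients, all others being zero. With $v=q_1^{\lambda^{(i)}_s}q_3^{s-1}u_i$, and $\boldsymbol\lambda+\mathbf 1^{(i)}_s$ denoting $\boldsymbol\lambda$ with $\lambda^{(i)}_s$ increased by $1$, $$\langle\boldsymbol\lambda|\psi^\pm(z)|\boldsymbol\lambda\rangle=\prod_{i=1}^n\psi^\pm_{\lambda^{(i)}}(u_i/z),$$ $$\langle\boldsymbol\lambda+\mathbf 1^{(i)}_s|e(z)|\boldsymbol\lambda\rangle=\frac{\delta(v/z)}{1-q_1}\prod_{j<i}\psi_{\lambda^{(j)}}(u_j/v)\prod_{j<s}\Psi_{\lambda^{(i)},j}(u_i/v),$$ $$\langle\boldsymbol\lambda|f(z)|\boldsymbol\lambda+\mathbf 1^{(i)}_s\rangle=\frac{q_1\,\delta(v/z)}{1-q_1}\,\psi_\emptyset(q_3^{s}u_i/v)\prod_{j>s}\frac{\Psi_{\lambda^{(i)},j}(u_i/v)}{\Psi_{\emptyset,j}(u_i/v)}\prod_{j>i}\psi_{\lambda^{(j)}}(u_j/v).$$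 **Theorem.** Let $n\ge 2$, let $a_1,\dots,a_n,b_1,\dots,b_n$ be non-negative integers, $p'=\sum_{i=1}^n(a_i+1)$, $p=\sum_{i=1}^n(b_i+1)$, $p\ne p'$. Let $q_1q_2q_3=1$ and assume that $q_1^{p'}q_3^p=1$ in the precise sense that, for $x,y\in\mathbb Z$, $q_1^xq_3^y=1$ if and only if $(x,y)=(p'\kappa,p\kappa)$ for some $\kappa\in\mathbb Z$. Let $u_1\neq0$ and $u_i=u_{i+1}q_1^{a_i+1}q_3^{b_i+1}$ for $i=1,\dots,n-1$. Let $\mathcal M=\mathcal M^{p',p}_{\mathbf a,\mathbf b}(u)$ be the complex vector space with basis the $|\lambda^{(1)},\dots,\lambda^{(n)}\rangle$, where the $\lambda^{(i)}$ are partitions with $$\lambda^{(i)}_s\ \ge\ \lambda^{(i+1)}_{s+b_i}-a_i\qquad(s\ge1,\ i=1,\dots,n,\ \lambda^{(n+1)}=\lambda^{(1)}).$$ 1. For any two basis vectors of $\mathcal M$, the matrix coefficients of $e(z),f(z),\psi^\pm(z)$ between them have limits when generic parameters tend to the given parameters $q_1,q_2,q_3,u_1,\dots,u_n$. The operators on $\mathcal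 M$ with these limits as matrix coefficients define a unique $\mathcal E$-module structure on $\mathcal M$. It is graded, with $\deg|\lambda^{(1)},\dots,\lambda^{(n)}\rangle=\sum_{i,s}\lambda^{(i)}_s$. 2. If moreover $p>n$, then $\mathcal M$ is irreducible; it is tame, that is, the operators $\psi^+_k,\psi^-_{-k}$ ($k\ge0$) are simultaneously diagonalizable with simple joint spectrum; and it is a highest weight module with highest vector $|\emptyset,\dots,\emptyset\rangle$ and highest weight $\prod_{i=1}^n\psi^\pm_\emptyset(u_i/z)$, that is, this vector generates $\mathcal M$, is annihilated by $f(z)$, and is an eigenvector of $\psi^\pm(z)$ with eigenvalue $\prod_{i=1}^n\psi^\pm_\emptyset(u_i/z)$. -/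

import Mathlib

open Filter Topology

namespace QuantumGl

noncomputable section

/-! ### The algebra `ℰ` -/

/-- The generators of `ℰ`; `psiMinus k` is `ψ⁻_{-k}`, and the last two are `(ψ⁺₀)⁻¹`, `(ψ⁻₀)⁻¹`. -/
inductive Gen : Type
  | e (k : ℤ)
  | f (k : ℤ)
  | psiPlus (k : ℕ)
  | psiMinus (k : ℕ)
  | psiPlusInv
  | psiMinusInv

/-- The degrees of the generators for the `ℤ`-grading of `ℰ`. -/
def Gen.deg : Gen → ℤ
  | .e _ => 1
  | .f _ => -1
  | _ => 0

/-- The free algebra on the generators. -/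
abbrev FreeE : Type := FreeAlgebra ℂ Gen

def eMode (k : ℤ) : FreeE := FreeAlgebra.ι ℂ (Gen.e k)
def fMode (k : ℤ) : FreeE := FreeAlgebra.ι ℂ (Gen.f k)
/-- The coefficient of `z^{-k}` in `ψ⁺(z)`, which is a series in `z⁻¹`. -/
def psiPlusMode (k : ℤ) : FreeE :=
  if 0 ≤ k then FreeAlgebra.ι ℂ (Gen.psiPlus k.toNat) else 0
/-- The coefficient of `z^{-k}` in `ψ⁻(z)`, which is a series in `z`. -/
def psiMinusMode (k : ℤ) : FreeE :=
  if k ≤ 0 then FreeAlgebra.ι ℂ (Gen.psiMinus (-k).toNat) else 0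

/-- A family `F` stands for the formal series `∑ F i j z^{-i} w^{-j}`; this is the series
multiplied by `z - q w`. -/
def mulZW (q : ℂ) (F : ℤ → ℤ → FreeE) : ℤ → ℤ → FreeE :=
  fun i j => F (i + 1) j - q • F i (j + 1)

/-- The series `F` multiplied by `w - q z`. -/
def mulWZ (q : ℂ) (F : ℤ → ℤ → FreeE) : ℤ → ℤ → FreeE :=
  fun i j => F i (j + 1) - q • F (i + 1) j

/-- Multiplication by `g(z,w) = (z - q₁w)(z - q₂w)(z - q₃w)`. -/
def gZW (q₁ q₂ q₃ : ℂ) (F : ℤ → ℤ → FreeE) : ℤ → ℤ → FreeE :=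
  mulZW q₁ (mulZW q₂ (mulZW q₃ F))

/-- Multiplication by `g(w,z)`. -/
def gWZ (q₁ q₂ q₃ : ℂ) (F : ℤ → ℤ → FreeE) : ℤ → ℤ → FreeE :=
  mulWZ q₁ (mulWZ q₂ (mulWZ q₃ F))

/-- The defining relations of `ℰ`, coefficient by coefficient in `z^{-i} w^{-j}`. -/
inductive Rel (q₁ q₂ q₃ : ℂ) : FreeE → FreeE → Prop
  | ee (i j : ℤ) : Rel q₁ q₂ q₃
      (gZW q₁ q₂ q₃ (fun i j => eMode i * eMode j) i j)
      (-gWZ q₁ q₂ q₃ (fun i j => eMode j * eMode i) i j)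
  | ff (i j : ℤ) : Rel q₁ q₂ q₃
      (gWZ q₁ q₂ q₃ (fun i j => fMode i * fMode j) i j)
      (-gZW q₁ q₂ q₃ (fun i j => fMode j * fMode i) i j)
  | psiPlus_e (i j : ℤ) : Rel q₁ q₂ q₃
      (gZW q₁ q₂ q₃ (fun i j => psiPlusMode i * eMode j) i j)
      (-gWZ q₁ q₂ q₃ (fun i j => eMode j * psiPlusMode i) i j)
  | psiMinus_e (i j : ℤ) : Rel q₁ q₂ q₃
      (gZW q₁ q₂ q₃ (fun i j => psiMinusMode i * eMode j) i j)
      (-gWZ q₁ q₂ q₃ (fun i j => eMode j * psiMinusMode i) i j)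
  | psiPlus_f (i j : ℤ) : Rel q₁ q₂ q₃
      (gWZ q₁ q₂ q₃ (fun i j => psiPlusMode i * fMode j) i j)
      (-gZW q₁ q₂ q₃ (fun i j => fMode j * psiPlusMode i) i j)
  | psiMinus_f (i j : ℤ) : Rel q₁ q₂ q₃
      (gWZ q₁ q₂ q₃ (fun i j => psiMinusMode i * fMode j) i j)
      (-gZW q₁ q₂ q₃ (fun i j => fMode j * psiMinusMode i) i j)
  | ef (i j : ℤ) : Rel q₁ q₂ q₃
      (eMode i * fMode j - fMode j * eMode i)
      (((1 - q₁) * (1 - q₂) * (1 - q₃))⁻¹ • (psiPlusMode (i + j) - psiMinusMode (i + j)))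
  | psiPlus_psiPlus (i j : ℤ) : Rel q₁ q₂ q₃
      (psiPlusMode i * psiPlusMode j) (psiPlusMode j * psiPlusMode i)
  | psiMinus_psiMinus (i j : ℤ) : Rel q₁ q₂ q₃
      (psiMinusMode i * psiMinusMode j) (psiMinusMode j * psiMinusMode i)
  | psiPlus_psiMinus (i j : ℤ) : Rel q₁ q₂ q₃
      (psiPlusMode i * psiMinusMode j) (psiMinusMode j * psiPlusMode i)
  | psiPlus_inv_right : Rel q₁ q₂ q₃ (psiPlusMode 0 * FreeAlgebra.ι ℂ Gen.psiPlusInv) 1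
  | psiPlus_inv_left : Rel q₁ q₂ q₃ (FreeAlgebra.ι ℂ Gen.psiPlusInv * psiPlusMode 0) 1
  | psiMinus_inv_right : Rel q₁ q₂ q₃ (psiMinusMode 0 * FreeAlgebra.ι ℂ Gen.psiMinusInv) 1
  | psiMinus_inv_left : Rel q₁ q₂ q₃ (FreeAlgebra.ι ℂ Gen.psiMinusInv * psiMinusMode 0) 1
  | serre_e : Rel q₁ q₂ q₃ ⁅eMode 0, ⁅eMode 1, eMode (-1)⁆⁆ 0
  | serre_f : Rel q₁ q₂ q₃ ⁅fMode 0, ⁅fMode 1, fMode (-1)⁆⁆ 0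

/-- The quantum continuous `𝔤𝔩_∞`. -/
abbrev QAlg (q₁ q₂ q₃ : ℂ) : Type := RingQuot (Rel q₁ q₂ q₃)

/-- The image of a generator in `ℰ`. -/
def gen (q₁ q₂ q₃ : ℂ) (x : Gen) : QAlg q₁ q₂ q₃ :=
  RingQuot.mkAlgHom ℂ (Rel q₁ q₂ q₃) (FreeAlgebra.ι ℂ x)

/-! ### Notions for `ℰ`-modules, given as algebra maps `ρ : ℰ → End V` -/

section Modules

variable {q₁ q₂ q₃ : ℂ} {V : Type*} [AddCommGroup V] [Module ℂ V]

/-- `V = ⨁ 𝒱 d` is a graded `ℰ`-module. -/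
def IsGradedModule (ρ : QAlg q₁ q₂ q₃ →ₐ[ℂ] Module.End ℂ V) (𝒱 : ℤ → Submodule ℂ V) : Prop :=
  DirectSum.IsInternal 𝒱 ∧
    ∀ (x : Gen) (d : ℤ), (𝒱 d).map (ρ (gen q₁ q₂ q₃ x)) ≤ 𝒱 (d + x.deg)

def IsIrreducible (ρ : QAlg q₁ q₂ q₃ →ₐ[ℂ] Module.End ℂ V) : Prop :=
  Nontrivial V ∧
    ∀ W : Submodule ℂ V, (∀ (x : QAlg q₁ q₂ q₃), ∀ w ∈ W, ρ x w ∈ W) → W = ⊥ ∨ W = ⊤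

/-- The joint eigenspace of all `ψ⁺_k`, `ψ⁻_{-k}` with eigenvalues `χp k`, `χm k`. -/
def jointEigenspace (ρ : QAlg q₁ q₂ q₃ →ₐ[ℂ] Module.End ℂ V) (χp χm : ℕ → ℂ) : Submodule ℂ V :=
  ⨅ k : ℕ, Module.End.eigenspace (ρ (gen q₁ q₂ q₃ (.psiPlus k))) (χp k) ⊓
    Module.End.eigenspace (ρ (gen q₁ q₂ q₃ (.psiMinus k))) (χm k)

/-- Tame: the `ψ⁺_k`, `ψ⁻_{-k}` are jointly diagonalizable, with simple joint spectrum. -/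
def IsTame (ρ : QAlg q₁ q₂ q₃ →ₐ[ℂ] Module.End ℂ V) : Prop :=
  (⨆ χ : (ℕ → ℂ) × (ℕ → ℂ), jointEigenspace ρ χ.1 χ.2) = ⊤ ∧
    ∀ χp χm : ℕ → ℂ, Module.rank ℂ (jointEigenspace ρ χp χm) ≤ 1

/-- Highest weight module with highest vector `v` and highest weight `φ⁺`, `φ⁻`. Here `φp` is
the series `φ⁺` in the variable `z⁻¹`, and `φm` is the series `φ⁻` in the variable `z`. -/
def IsHighestWeight (ρ : QAlg q₁ q₂ q₃ →ₐ[ℂ] Module.End ℂ V) (v : V)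
    (φp φm : LaurentSeries ℂ) : Prop :=
  (∀ w : V, ∃ x : QAlg q₁ q₂ q₃, ρ x v = w) ∧
    (∀ k : ℤ, ρ (gen q₁ q₂ q₃ (.f k)) v = 0) ∧
    (∀ k : ℕ, ρ (gen q₁ q₂ q₃ (.psiPlus k)) v = φp.coeff (k : ℤ) • v) ∧
    (∀ k : ℕ, ρ (gen q₁ q₂ q₃ (.psiMinus k)) v = φm.coeff (k : ℤ) • v)

end Modules

/-! ### Matrix coefficients of Fock modules

Partitions are sequences `l : ℕ →₀ ℕ`, with rows indexed from `0`: the row `s` is `λ_{s+1}`.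

The eigenvalues of `ψ^±(z)` are the expansions of one and the same rational function of `x = u/z`,
in powers of `z⁻¹` for `ψ⁺` and in powers of `z` for `ψ⁻`. So these functions are written over a
field `K`. The case `K = ℂ` gives their values at a point, `K = LaurentSeries ℂ` with `x = u t`
gives the expansion in `t = z⁻¹`, and with `x = u t⁻¹` the expansion in `t = z`. -/

section Fock

variable {K : Type*} [Field K] [Algebra ℂ K]

/-- The eigenvalue of `ψ^±(z)` on the vector `|k⟩` of the vector representation `V(u)`. -/
def psiVec (q₁ q₂ q₃ : ℂ) (k : ℤ) (x : K) : K :=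
  ((1 - (q₁ ^ k * q₃) • x) * (1 - (q₁ ^ k * q₂) • x)) /
    ((1 - q₁ ^ k • x) * (1 - q₁ ^ (k - 1) • x))

/-- The eigenvalue of `ψ^±(z)` on `|m - j⟩` in `V(u q₂^{-j})`: the contribution of the row `j`
of a partition, if this row has length `m`. -/
def psiRow (q₁ q₂ q₃ : ℂ) (m j : ℕ) (x : K) : K :=
  psiVec q₁ q₂ q₃ ((m : ℤ) - j) (q₂ ^ (-(j : ℤ)) • x)

/-- `ψ^±_∅` as a rational function. -/
def psiEmpty (q₂ : ℂ) (x : K) : K := (1 - q₂ • x) / (1 - x)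

/-- The eigenvalue of `ψ^±(z)` on `|l⟩` in the Fock module `F(u)`. The rows outside of the
support contribute the factor `1`. -/
def fockPsi (q₁ q₂ q₃ : ℂ) (l : ℕ →₀ ℕ) (x : K) : K :=
  psiEmpty q₂ x * ∏ j ∈ l.support, psiRow q₁ q₂ q₃ (l j) j x / psiRow q₁ q₂ q₃ 0 j x

/-- The factor in front of the delta function in `⟨l + 1_s| e(z) |l⟩` for the Fock module. -/
def fockE (q₁ q₂ q₃ : ℂ) (l : ℕ →₀ ℕ) (s : ℕ) (x : ℂ) : ℂ :=
  1 / (1 - q₁) * ∏ j ∈ Finset.range s, psiRow q₁ q₂ q₃ (l j) j x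

/-- The factor in front of the delta function in `⟨l| f(z) |l + 1_s⟩` for the Fock module. -/
def fockF (q₁ q₂ q₃ : ℂ) (l : ℕ →₀ ℕ) (s : ℕ) (x : ℂ) : ℂ :=
  q₁ / (1 - q₁) * psiEmpty q₂ (q₃ ^ (s + 1) * x) *
    ∏ j ∈ l.support with s < j, psiRow q₁ q₂ q₃ (l j) j x / psiRow q₁ q₂ q₃ 0 j x

end Fock

/-! ### Matrix coefficients of tensor products of Fock modules -/

/-- Parameters `(q₁, q₂, q₃, (u_i))`. -/
abbrev Params (n : ℕ) : Type := ℂ × ℂ × ℂ × (Fin n → ℂ)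

/-- `q₁ q₂ q₃ = 1`, and `q₁, q₂, u_1, …, u_n` are generic: nonzero, and no nontrivial monomial in
them is equal to `1`. -/
def IsGeneric {n : ℕ} : Params n → Prop
  | (q₁, q₂, q₃, u) => q₁ * q₂ * q₃ = 1 ∧ (∀ i, u i ≠ 0) ∧
      ∀ (x y : ℤ) (j : Fin n → ℤ), q₁ ^ x * q₂ ^ y * ∏ i, u i ^ j i = 1 → x = 0 ∧ y = 0 ∧ j = 0

/-- `n`-tuples of sequences. -/
abbrev Tuple (n : ℕ) : Type := Fin n → ℕ →₀ ℕ

/-- Adding one box to the row `s` of the `i`-th member. -/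
def addBox {n : ℕ} (l : Tuple n) (i : Fin n) (s : ℕ) : Tuple n :=
  l + Pi.single i (Finsupp.single s 1)

/-- The point `v` such that `⟨l + 1_s^{(i)}| e(z) |l⟩` and `⟨l| f(z) |l + 1_s^{(i)}⟩` are multiples
of the delta function `δ(v/z) = ∑ v^k z^{-k}`. -/
def boxPoint {n : ℕ} : Params n → Tuple n → Fin n → ℕ → ℂ
  | (q₁, _, q₃, u), l, i, s => q₁ ^ l i s * q₃ ^ s * u i

/-- The factor in front of `δ(v/z)` in `⟨l + 1_s^{(i)}| e(z) |l⟩` for the tensor product, by the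
rule `Δ e(z) = e(z) ⊗ 1 + ψ⁻(z) ⊗ e(z)`. -/
def tensorE {n : ℕ} : Params n → Tuple n → Fin n → ℕ → ℂ
  | (q₁, q₂, q₃, u), l, i, s =>
    let v := boxPoint (q₁, q₂, q₃, u) l i s
    (∏ j ∈ Finset.univ.filter (· < i), fockPsi q₁ q₂ q₃ (l j) (u j / v)) *
      fockE q₁ q₂ q₃ (l i) s (u i / v)

/-- The factor in front of `δ(v/z)` in `⟨l| f(z) |l + 1_s^{(i)}⟩` for the tensor product, by the
rule `Δ f(z) = f(z) ⊗ ψ⁺(z) + 1 ⊗ f(z)`. -/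
def tensorF {n : ℕ} : Params n → Tuple n → Fin n → ℕ → ℂ
  | (q₁, q₂, q₃, u), l, i, s =>
    let v := boxPoint (q₁, q₂, q₃, u) l i s
    fockF q₁ q₂ q₃ (l i) s (u i / v) *
      ∏ j ∈ Finset.univ.filter (i < ·), fockPsi q₁ q₂ q₃ (l j) (u j / v)

/-- The eigenvalue of `ψ⁺(z)` on `|l⟩` as a series in `z⁻¹`. -/
def tensorPsiPlus {n : ℕ} : Params n → Tuple n → LaurentSeries ℂ
  | (q₁, q₂, q₃, u), l => ∏ i, fockPsi q₁ q₂ q₃ (l i) (HahnSeries.single (1 : ℤ) (u i))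

/-- The eigenvalue of `ψ⁻(z)` on `|l⟩` as a series in `z`. -/
def tensorPsiMinus {n : ℕ} : Params n → Tuple n → LaurentSeries ℂ
  | (q₁, q₂, q₃, u), l => ∏ i, fockPsi q₁ q₂ q₃ (l i) (HahnSeries.single (-1 : ℤ) (u i))

/-- The matrix coefficient `⟨m| e_k |l⟩`; at most one pair `(i, s)` contributes. -/
def matE {n : ℕ} (P : Params n) (k : ℤ) (m l : Tuple n) : ℂ :=
  ∑ᶠ p : Fin n × ℕ,
    if m = addBox l p.1 p.2 then tensorE P l p.1 p.2 * boxPoint P l p.1 p.2 ^ k else 0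

/-- The matrix coefficient `⟨m| f_k |l⟩`; at most one pair `(i, s)` contributes. -/
def matF {n : ℕ} (P : Params n) (k : ℤ) (m l : Tuple n) : ℂ :=
  ∑ᶠ p : Fin n × ℕ,
    if l = addBox m p.1 p.2 then tensorF P m p.1 p.2 * boxPoint P m p.1 p.2 ^ k else 0

/-- The matrix coefficient `⟨m| ψ⁺_k |l⟩`. -/
def matPsiPlus {n : ℕ} (P : Params n) (k : ℕ) (m l : Tuple n) : ℂ :=
  if m = l then (tensorPsiPlus P l).coeff (k : ℤ) else 0

/-- The matrix coefficient `⟨m| ψ⁻_{-k} |l⟩`. -/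
def matPsiMinus {n : ℕ} (P : Params n) (k : ℕ) (m l : Tuple n) : ℂ :=
  if m = l then (tensorPsiMinus P l).coeff (k : ℤ) else 0

/-! ### The space `M^{p',p}_{a,b}(u)` and the action on it -/

section Space

variable {n : ℕ} [NeZero n]

/-- `n`-tuples of partitions with `λ^{(i)}_s ≥ λ^{(i+1)}_{s+b_i} - a_i` for all `s` and for all
`i` modulo `n`. -/
def IsAdmissible (a b : Fin n → ℕ) (l : Tuple n) : Prop :=
  (∀ i, Antitone (l i)) ∧
    ∀ (i : Fin n) (s : ℕ), (l (i + 1) (s + b i) : ℤ) - (a i : ℤ) ≤ (l i s : ℤ)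

abbrev AdmTuple (a b : Fin n → ℕ) : Type := {l : Tuple n // IsAdmissible a b l}

/-- The complex vector space with basis the admissible tuples. -/
abbrev MSpace (a b : Fin n → ℕ) : Type := AdmTuple a b →₀ ℂ

/-- The tuple of empty partitions. -/
def emptyTuple (a b : Fin n → ℕ) : AdmTuple a b :=
  ⟨0, fun _ _ _ _ => le_rfl, fun _ _ => by simp⟩

/-- The span of the `|l⟩` with `∑_i |λ^{(i)}| = d`. -/
def gradedPiece (a b : Fin n → ℕ) (d : ℤ) : Submodule ℂ (MSpace a b) :=
  Submodule.span ℂ {v | ∃ l : AdmTuple a b,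
    (∑ i, (l.1 i).sum fun _ m => (m : ℤ)) = d ∧ v = Finsupp.single l 1}

/-- The matrix coefficients of `e(z)`, `f(z)`, `ψ^±(z)` on `MSpace a b` are the limits of those
of the tensor product of Fock modules, when generic parameters tend to `P`. In particular, all
these limits exist. -/
def IsInducedAction {q₁ q₂ q₃ : ℂ} (u : Fin n → ℂ) (a b : Fin n → ℕ)
    (ρ : QAlg q₁ q₂ q₃ →ₐ[ℂ] Module.End ℂ (MSpace a b)) : Prop :=
  let 𝓕 : Filter (Params n) := 𝓝[{Q | IsGeneric Q}] (q₁, q₂, q₃, u)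
  let coef (x : Gen) (m l : AdmTuple a b) : ℂ := ρ (gen q₁ q₂ q₃ x) (Finsupp.single l 1) m
  ∀ m l : AdmTuple a b,
    (∀ k : ℤ, Tendsto (fun Q => matE Q k m.1 l.1) 𝓕 (𝓝 (coef (.e k) m l))) ∧
    (∀ k : ℤ, Tendsto (fun Q => matF Q k m.1 l.1) 𝓕 (𝓝 (coef (.f k) m l))) ∧
    (∀ k : ℕ, Tendsto (fun Q => matPsiPlus Q k m.1 l.1) 𝓕 (𝓝 (coef (.psiPlus k) m l))) ∧
    (∀ k : ℕ, Tendsto (fun Q => matPsiMinus Q k m.1 l.1) 𝓕 (𝓝 (coef (.psiMinus k) m l)))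

end Space

end

end QuantumGl

/-!
By definition a row `s` of a member `i` of a tuple enters the matrix coefficients only through the
point `v = q₁^{l i s} q₃^s u_i` at which its next box would be added. Up to finitely many empty
rows summed up in `psiEmpty`, every coefficient is a product of one rational function `phi` over
rows, evaluated at ratios of such points (`coefN`, `fockPsi_eq_truncated`, `tensorE_eq_coefN`). The
coefficients of `e` and `f` differ only in the order on the rows over which the product is taken.
Hence everything at the resonant parameters depends on which points of rows coincide, or differ by
a factor `q₁`, `q₂` or `q₃`.

This is answered by a three-dimensional picture. Continue the index of the members of a tuple
periodically to `ℤ`, and place the box `k` of the row `y` of the member `i` at `(k, y, i)`, shifted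
by partial sums of the `a_j` and `b_j`. The inequalities defining `ℳ` together with the partition
inequalities say that the resulting height function is weakly decreasing in both of its arguments
(`isAdmissible_iff`), that is, the boxes form a periodic plane partition. A box at `(z, y, i)` has
the weight `q₁^z q₃^y q₂^i u_0`, and by the resonance condition two boxes have the same weight
exactly if, up to the period, they lie on a common line of direction `(1, 1, 1)`
(`Resonant.exists_lift`). A comparison of heights along these lines shows that between admissible
tuples no coefficient has a pole or a zero (`Resonant.pt_ne`, `Resonant.pt_ne_q₁_mul_pt`,
`Resonant.coefN_ne_zero`). As generic parameters are dense near the given ones (`neBot_generic`),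
the limits exist, are unique, and are the values of `coefN` at the resonant parameters.

The relations between two or three raising operators are then verified directly at the resonant
parameters, on boxes in different and in equal rows. For different rows, both orders of adding the
boxes give the same product of coefficients up to a ratio of values of `phi`, which is the ratio of
values of `g` (`IsStepCoef.exchange`). If only one order stays inside `ℳ`, then the added boxes
touch in the direction of `y` or `i` (`Resonant.exists_blocked`), so that `g` vanishes and the
relation persists. The cubic relation reduces in the same way to a rational identity in three
variables (`serreWeight_identity`, `IsStepCoef.serre`). The operators `f_k` are the transposes of
operators of the same kind, for the reverse order of rows. In the commutator of `e(z)` and `f(w)`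
the terms for two different rows cancel by the symmetry `phi (q₁ / x) = phi x` (`phi_unitary`). The
diagonal part is, for generic parameters, the partial fraction expansion of the eigenvalue of `ψ^±`,
whose poles are simple (`IsGeneric.psiDiff_eq`); both sides have limits
(`Resonant.psiDiff_eq`).

For the joint spectrum, the eigenvalue of `ψ⁺` on a tuple is determined by, and determines, the
multiset of weights of its boxes: the divisor of the eigenvalue is obtained from the counting
function of the boxes by the three difference operators for `q₁`, `q₂`, `q₃`. None of these numbers
is a root of unity, so that the operators are injective on functions of finite support
(`Resonant.boxCount_eq`). Boxes of equal weight lie on a line of direction `(1, 1, 1)`, and an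
admissible tuple contains an initial part of this line (`Resonant.lt_of_boxPt_eq`), so the
number of its boxes there determines them (`Resonant.eq_of_tensorPsiPlus_eq`).

Consequently a nonzero submodule contains a basis vector. Every nonempty admissible tuple has a
removable box (`Resonant.exists_removable`) and the coefficients of `e` and `f` between admissible
tuples do not vanish, so the submodule contains the vector of the empty tuple and with it all other
basis vectors.
-/

namespace QuantumGl

noncomputable section

/-! ### Row factors and truncated formulas for the matrix coefficients -/

section RowFactor

variable {K : Type*} [Field K] [Algebra ℂ K]

/-- The contribution of a single row to the eigenvalue of `ψ^±(z)`, as a function of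
`y = v / z`, where `v` is the point at which the next box of that row would be added. -/
def phi (q₁ q₂ q₃ : ℂ) (y : K) : K :=
  ((1 - q₃ • y) * (1 - q₂ • y)) / ((1 - y) * (1 - q₁⁻¹ • y))

/-- A row enters only through the point of its end. -/
lemma psiRow_eq_phi {q₁ q₂ q₃ : ℂ} (h : q₁ * q₂ * q₃ = 1) (m j : ℕ) (x : K) :
    psiRow q₁ q₂ q₃ m j x = phi q₁ q₂ q₃ ((q₁ ^ m * q₃ ^ j) • x) := by
  have h1 : q₁ ≠ 0 := by rintro rfl; simp at h
  have h2 : q₂ ≠ 0 := by rintro rfl; simp at h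
  have h3 : q₃ ≠ 0 := by rintro rfl; simp at h
  have key : q₁ ^ ((m : ℤ) - j) * q₂ ^ (-(j : ℤ)) = q₁ ^ m * q₃ ^ j := by
    have : q₃ = (q₁ * q₂)⁻¹ := by field_simp; linear_combination h
    rw [this, zpow_sub₀ h1, zpow_neg]
    simp only [zpow_natCast, mul_inv, mul_pow, inv_pow]
    field_simp
  have key' : q₁ ^ ((m : ℤ) - j - 1) * q₂ ^ (-(j : ℤ)) = q₁⁻¹ * (q₁ ^ m * q₃ ^ j) := by
    rw [← key, zpow_sub_one₀ h1]; ring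
  unfold psiRow psiVec phi
  simp only [smul_smul]
  rw [key', key]
  congr 4
  · rw [← key]; ring_nf
  · rw [← key]; ring_nf

/-- An empty row moves the argument of `psiEmpty` by `q₃`. -/
lemma psiEmpty_step {q₁ q₂ q₃ : ℂ} (h : q₁ * q₂ * q₃ = 1) (y : K)
    (hy : 1 - q₃ • y ≠ 0) (hy' : 1 - (q₂ * q₃) • y ≠ 0) :
    psiEmpty q₂ y = psiEmpty q₂ (q₃ • y) * phi q₁ q₂ q₃ y := by
  have h1 : q₁ ≠ 0 := by rintro rfl; simp at h
  have e : q₁⁻¹ = q₂ * q₃ := by field_simp; linear_combination -h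
  unfold psiEmpty phi
  rw [e, smul_smul]
  by_cases h0 : 1 - y = 0
  · simp [h0]
  · field_simp

/-- A product over the rows `j ≥ s` in the support, normalized by empty rows, is a product over
the rows `s ≤ j < N`, up to one factor for the empty tail. -/
lemma psiEmpty_mul_prod_support {q₁ q₂ q₃ : ℂ} (h : q₁ * q₂ * q₃ = 1) (x : K) (l : ℕ →₀ ℕ)
    {s N : ℕ} (hs : s ≤ N) (hN : ∀ j, N ≤ j → l j = 0)
    (h1 : ∀ j, s ≤ j → 1 - q₃ ^ j • x ≠ 0) (h2 : ∀ j, s ≤ j → 1 - (q₂ * q₃ ^ j) • x ≠ 0) :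
    psiEmpty q₂ (q₃ ^ s • x) *
        ∏ j ∈ l.support with s ≤ j, psiRow q₁ q₂ q₃ (l j) j x / psiRow q₁ q₂ q₃ 0 j x =
      psiEmpty q₂ (q₃ ^ N • x) *
        ∏ j ∈ Finset.Ico s N, phi q₁ q₂ q₃ ((q₁ ^ l j * q₃ ^ j) • x) := by
  have hq1 : q₁ ≠ 0 := by rintro rfl; simp at h
  have e : q₁⁻¹ = q₂ * q₃ := by field_simp; linear_combination -h
  have hrow0 : ∀ j, s ≤ j → psiRow q₁ q₂ q₃ 0 j x ≠ 0 := by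
    intro j hj
    rw [psiRow_eq_phi h]
    unfold phi
    rw [e]
    simp only [smul_smul, pow_zero, one_mul]
    have a1 := h1 j hj
    have a2 := h1 (j + 1) (by omega)
    have a3 := h2 j hj
    have a4 := h2 (j + 1) (by omega)
    rw [pow_succ'] at a2 a4
    rw [← mul_assoc] at a4
    exact div_ne_zero (mul_ne_zero a2 a3) (mul_ne_zero a1 a4)
  have hsub : (l.support.filter fun j => s ≤ j) ⊆ Finset.Ico s N := by
    intro j hj
    simp only [Finset.mem_filter, Finsupp.mem_support_iff, Finset.mem_Ico] at hj ⊢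
    exact ⟨hj.2, by by_contra hc; exact hj.1 (hN j (by omega))⟩
  rw [Finset.prod_subset hsub]
  · have tele : psiEmpty q₂ (q₃ ^ s • x) =
        psiEmpty q₂ (q₃ ^ N • x) * ∏ j ∈ Finset.Ico s N, psiRow q₁ q₂ q₃ 0 j x := by
      clear hsub hN
      induction N, hs using Nat.le_induction with
      | base => simp
      | succ N hN ih =>
        rw [Finset.prod_Ico_succ_top hN, ih, psiRow_eq_phi h,
          psiEmpty_step h (q₃ ^ N • x)]
        · rw [smul_smul, ← pow_succ', pow_zero, one_mul]; ring
        · have := h1 (N + 1) (by omega)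
          rwa [pow_succ', ← smul_smul] at this
        · have := h2 (N + 1) (by omega)
          rwa [pow_succ', ← mul_assoc, ← smul_smul] at this
    rw [tele, mul_assoc, ← Finset.prod_mul_distrib]
    congr 1
    refine Finset.prod_congr rfl fun j hj => ?_
    rw [← psiRow_eq_phi h, mul_div_cancel₀]
    exact hrow0 j (Finset.mem_Ico.1 hj).1
  · intro j hj hj'
    simp only [Finset.mem_filter, Finsupp.mem_support_iff, not_and, Finset.mem_Ico] at hj hj'
    have : l j = 0 := by
      by_contra hc
      exact hj' hc hj.1
    rw [this, div_self (hrow0 j hj.1)]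

/-- The truncated formula: the infinitely many empty rows from `N` on contribute `psiEmpty`. -/
lemma fockPsi_eq_truncated {q₁ q₂ q₃ : ℂ} (h : q₁ * q₂ * q₃ = 1) (x : K) (l : ℕ →₀ ℕ)
    {N : ℕ} (hN : ∀ j, N ≤ j → l j = 0)
    (h1 : ∀ j : ℕ, 1 - q₃ ^ j • x ≠ 0) (h2 : ∀ j : ℕ, 1 - (q₂ * q₃ ^ j) • x ≠ 0) :
    fockPsi q₁ q₂ q₃ l x = psiEmpty q₂ (q₃ ^ N • x) *
        ∏ j ∈ Finset.range N, phi q₁ q₂ q₃ ((q₁ ^ l j * q₃ ^ j) • x) := by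
  have := psiEmpty_mul_prod_support h x l (Nat.zero_le N) hN (fun j _ => h1 j) (fun j _ => h2 j)
  simpa [fockPsi] using this

end RowFactor

/-- A row of a tuple: the row `r.2` of the member `r.1`. -/
abbrev Row (n : ℕ) : Type := Fin n × ℕ

/-- The lexicographic order on rows. -/
def rowLt {n : ℕ} (r' r : Row n) : Prop := r'.1 < r.1 ∨ r'.1 = r.1 ∧ r'.2 < r.2

/-- The rows of index less than `N` of all members. -/
def rows (n N : ℕ) : Finset (Row n) := Finset.univ ×ˢ Finset.range N

@[simp] lemma mem_rows {n N : ℕ} {r : Row n} : r ∈ rows n N ↔ r.2 < N := by simp [rows]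

/-- All rows of `l` from the row `N` on are empty. -/
def SuppLE {n : ℕ} (l : Tuple n) (N : ℕ) : Prop := ∀ i j, N ≤ j → l i j = 0

/-- `boxPoint` as a function of rows. -/
abbrev pt {n : ℕ} (Q : Params n) (l : Tuple n) (r : Row n) : ℂ := boxPoint Q l r.1 r.2

lemma pt_eq {n : ℕ} (Q : Params n) (l : Tuple n) (r : Row n) :
    pt Q l r = Q.1 ^ l r.1 r.2 * Q.2.2.1 ^ r.2 * Q.2.2.2 r.1 := rfl

open scoped Classical in
/-- The part of the matrix coefficient `⟨l + 1_r| e(z) |l⟩` (for `R = rowLt`) or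
`⟨l| f(z) |l + 1_r⟩` (for the reverse order) which depends on the tuple: the product of the
contributions of all rows `r'` with `R r' r`. Only the rows of index less than `N` are written as
separate factors, the remaining empty ones make up the factors `psiEmpty`. -/
def coefN {n : ℕ} (R : Row n → Row n → Prop) (N : ℕ) (Q : Params n) (l : Tuple n) (r : Row n) : ℂ :=
  (∏ j with R (j, N) r, psiEmpty Q.2.1 (pt Q l (j, N) / pt Q l r)) *
    ∏ r' ∈ rows n N with R r' r, phi Q.1 Q.2.1 Q.2.2.1 (pt Q l r' / pt Q l r)

section Generic

variable {n : ℕ} {Q : Params n}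

lemma IsGeneric.mul_eq (h : IsGeneric Q) : Q.1 * Q.2.1 * Q.2.2.1 = 1 := h.1
lemma IsGeneric.u_ne (h : IsGeneric Q) (i : Fin n) : Q.2.2.2 i ≠ 0 := h.2.1 i

lemma ne_zero_of_mul₁ {q₁ q₂ q₃ : ℂ} (h : q₁ * q₂ * q₃ = 1) : q₁ ≠ 0 := by
  rintro rfl; simp at h
lemma ne_zero_of_mul₂ {q₁ q₂ q₃ : ℂ} (h : q₁ * q₂ * q₃ = 1) : q₂ ≠ 0 := by
  rintro rfl; simp at h
lemma ne_zero_of_mul₃ {q₁ q₂ q₃ : ℂ} (h : q₁ * q₂ * q₃ = 1) : q₃ ≠ 0 := by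
  rintro rfl; simp at h

lemma pt_ne_zero (h : Q.1 * Q.2.1 * Q.2.2.1 = 1) (hu : ∀ i, Q.2.2.2 i ≠ 0) (l : Tuple n)
    (r : Row n) : pt Q l r ≠ 0 := by
  rw [pt_eq]
  exact mul_ne_zero (mul_ne_zero (pow_ne_zero _ (ne_zero_of_mul₁ h))
    (pow_ne_zero _ (ne_zero_of_mul₃ h))) (hu _)

/-- For generic parameters, monomials in `q₁`, `q₃` and ratios of the `u_i` are distinct. -/
lemma IsGeneric.eq_of_mul_eq (h : IsGeneric Q) {x y x' y' : ℤ} {i j : Fin n}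
    (e : Q.1 ^ x * Q.2.2.1 ^ y * Q.2.2.2 i = Q.1 ^ x' * Q.2.2.1 ^ y' * Q.2.2.2 j) :
    x = x' ∧ y = y' ∧ i = j := by
  obtain ⟨q₁, q₂, q₃, u⟩ := Q
  obtain ⟨hm, hu, hg⟩ := h
  have h1 := ne_zero_of_mul₁ hm
  have h2 := ne_zero_of_mul₂ hm
  have h3 := ne_zero_of_mul₃ hm
  dsimp only at *
  have e3 : q₃ = q₁⁻¹ * q₂⁻¹ := by field_simp; linear_combination hm
  have hprod : ∀ k : Fin n, ∏ t, u t ^ (Pi.single k (1 : ℤ) : Fin n → ℤ) t = u k := by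
    intro k
    rw [Finset.prod_eq_single k]
    · simp
    · intro b _ hb; simp [Pi.single_eq_of_ne hb]
    · simp
  have := hg (x - y - (x' - y')) (-y - -y') (Pi.single i 1 - Pi.single j 1) (by
    have : ∏ t, u t ^ ((Pi.single i 1 - Pi.single j 1 : Fin n → ℤ) t) = u i / u j := by
      rw [← hprod i, ← hprod j, ← Finset.prod_div_distrib]
      refine Finset.prod_congr rfl fun t _ => ?_
      rw [Pi.sub_apply, zpow_sub₀ (hu t)]
    rw [this]
    rw [e3] at e
    simp only [mul_zpow, inv_zpow', ] at e
    have hj := hu j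
    rw [zpow_sub₀ h1 (x - y), zpow_sub₀ h2 (-y), zpow_sub₀ h1, zpow_sub₀ h1]
    rw [zpow_neg, zpow_neg, zpow_neg, zpow_neg] at e
    rw [zpow_neg, zpow_neg]
    have := hu i
    have a1 := zpow_ne_zero x h1
    have a2 := zpow_ne_zero y h1
    have a3 := zpow_ne_zero x' h1
    have a4 := zpow_ne_zero y' h1
    have a5 := zpow_ne_zero y h2
    have a6 := zpow_ne_zero y' h2
    field_simp at e ⊢
    linear_combination e)
  obtain ⟨hx, hy, hij⟩ := this
  refine ⟨by omega, by omega, ?_⟩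
  by_contra hne
  have := congrFun hij i
  rw [Pi.sub_apply, Pi.single_eq_same, Pi.single_eq_of_ne hne] at this
  simp at this

end Generic

lemma addBox_apply {n : ℕ} (l : Tuple n) (r : Row n) (r' : Row n) :
    addBox l r.1 r.2 r'.1 r'.2 = l r'.1 r'.2 + if r' = r then 1 else 0 := by
  obtain ⟨i, s⟩ := r
  obtain ⟨i', s'⟩ := r'
  simp only [addBox, Pi.add_apply, Finsupp.add_apply]
  congr 1
  by_cases h : i' = i
  · subst h
    rw [Pi.single_eq_same, Finsupp.single_apply]
    by_cases h' : s = s' <;> simp [h', eq_comm]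
  · rw [Pi.single_eq_of_ne h]
    simp [h]

/-- The point of the box of height `k` in the row `r`. -/
def boxPt {n : ℕ} (P : Params n) (r : Row n) (k : ℤ) : ℂ :=
  P.1 ^ k * P.2.2.1 ^ (r.2 : ℤ) * P.2.2.2 r.1

lemma pt_eq_boxPt {n : ℕ} {P : Params n} (l : Tuple n) (r : Row n) :
    pt P l r = boxPt P r (l r.1 r.2) := by
  simp [pt_eq, boxPt]

section TensorFormulas

variable {n : ℕ} {Q : Params n}

open scoped Classical in
lemma prod_rows_lt {M : Type*} [CommMonoid M] {N s : ℕ} (i : Fin n) (hs : s ≤ N) (g : Row n → M) :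
    ∏ r' ∈ rows n N with rowLt r' (i, s), g r' =
      (∏ j ∈ Finset.univ.filter (· < i), ∏ t ∈ Finset.range N, g (j, t)) *
        ∏ t ∈ Finset.range s, g (i, t) := by
  have : (rows n N).filter (fun r' => rowLt r' (i, s)) =
      ((Finset.univ.filter (· < i)) ×ˢ Finset.range N) ∪ ({i} ×ˢ Finset.range s) := by
    ext ⟨j, t⟩
    simp only [Finset.mem_filter, mem_rows, Finset.mem_union, Finset.mem_product,
      Finset.mem_univ, true_and, Finset.mem_range, Finset.mem_singleton]
    unfold rowLt
    constructor
    · rintro ⟨h, h' | h'⟩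
      · exact .inl ⟨h', h⟩
      · exact .inr h'
    · rintro (h | h)
      · exact ⟨h.2, .inl h.1⟩
      · exact ⟨by omega, .inr h⟩
  rw [this, Finset.prod_union, Finset.prod_product, Finset.prod_product, Finset.prod_singleton]
  rw [Finset.disjoint_left]
  rintro ⟨j, t⟩ h h'
  simp only [Finset.mem_product, Finset.mem_filter, Finset.mem_univ, true_and,
    Finset.mem_singleton] at h h'
  exact absurd h'.1 h.1.ne

open scoped Classical in
lemma prod_rows_gt {M : Type*} [CommMonoid M] {N s : ℕ} (i : Fin n) (g : Row n → M) :
    ∏ r' ∈ rows n N with rowLt (i, s) r', g r' =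
      (∏ j ∈ Finset.univ.filter (i < ·), ∏ t ∈ Finset.range N, g (j, t)) *
        ∏ t ∈ Finset.Ico (s + 1) N, g (i, t) := by
  have : (rows n N).filter (fun r' => rowLt (i, s) r') =
      ((Finset.univ.filter (i < ·)) ×ˢ Finset.range N) ∪ ({i} ×ˢ Finset.Ico (s + 1) N) := by
    ext ⟨j, t⟩
    simp only [Finset.mem_filter, mem_rows, Finset.mem_union, Finset.mem_product,
      Finset.mem_univ, true_and, Finset.mem_range, Finset.mem_singleton, Finset.mem_Ico]
    unfold rowLt
    constructor
    · rintro ⟨h, h' | h'⟩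
      · exact .inl ⟨h', h⟩
      · exact .inr ⟨h'.1.symm, by omega⟩
    · rintro (h | h)
      · exact ⟨h.2, .inl h.1⟩
      · exact ⟨by omega, .inr ⟨h.1.symm, by omega⟩⟩
  rw [this, Finset.prod_union, Finset.prod_product, Finset.prod_product, Finset.prod_singleton]
  rw [Finset.disjoint_left]
  rintro ⟨j, t⟩ h h'
  simp only [Finset.mem_product, Finset.mem_filter, Finset.mem_univ, true_and,
    Finset.mem_singleton] at h h'
  exact absurd h'.1 h.1.ne'

lemma fockPsi_div_pt (h : IsGeneric Q) {l : Tuple n} {N : ℕ} (hl : SuppLE l N) (r : Row n)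
    {j : Fin n} (hj : j ≠ r.1) :
    fockPsi Q.1 Q.2.1 Q.2.2.1 (l j) (Q.2.2.2 j / pt Q l r) =
      psiEmpty Q.2.1 (pt Q l (j, N) / pt Q l r) *
        ∏ t ∈ Finset.range N, phi Q.1 Q.2.1 Q.2.2.1 (pt Q l (j, t) / pt Q l r) := by
  have hv := pt_ne_zero h.mul_eq h.u_ne l r
  have h1 := ne_zero_of_mul₁ h.mul_eq
  have h3 := ne_zero_of_mul₃ h.mul_eq
  rw [fockPsi_eq_truncated h.mul_eq _ _ (hl j)]
  · congr 1
    · simp only [pt_eq Q l (j, N), hl j N le_rfl, smul_eq_mul]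
      congr 1; ring
    · refine Finset.prod_congr rfl fun t _ => ?_
      congr 1
      simp only [pt_eq Q l (j, t), smul_eq_mul]; ring
  · intro t e
    rw [sub_eq_zero, smul_eq_mul, mul_div_assoc', eq_comm, div_eq_one_iff_eq hv, pt_eq] at e
    refine hj (h.eq_of_mul_eq (x := 0) (y := t) (x' := l r.1 r.2) (y' := r.2) ?_).2.2
    simpa using e
  · intro t e
    rw [sub_eq_zero, smul_eq_mul, mul_div_assoc', eq_comm, div_eq_one_iff_eq hv, pt_eq] at e
    refine hj (h.eq_of_mul_eq (x := -1) (y := t - 1) (x' := l r.1 r.2) (y' := r.2) ?_).2.2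
    rw [zpow_natCast, zpow_natCast, ← e, zpow_sub_one₀ h3, zpow_neg_one, zpow_natCast]
    have := h.mul_eq
    field_simp
    linear_combination (-Q.2.2.2 j) * this

lemma tensorE_eq_coefN (h : IsGeneric Q) {l : Tuple n} {N : ℕ} (hl : SuppLE l N) {r : Row n}
    (hr : r.2 ≤ N) :
    tensorE Q l r.1 r.2 = 1 / (1 - Q.1) * coefN rowLt N Q l r := by
  classical
  obtain ⟨i, s⟩ := r
  have e1 : tensorE Q l i s = (∏ j ∈ Finset.univ.filter (· < i),
      fockPsi Q.1 Q.2.1 Q.2.2.1 (l j) (Q.2.2.2 j / pt Q l (i, s))) *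
      fockE Q.1 Q.2.1 Q.2.2.1 (l i) s (Q.2.2.2 i / pt Q l (i, s)) := rfl
  have e2 : fockE Q.1 Q.2.1 Q.2.2.1 (l i) s (Q.2.2.2 i / pt Q l (i, s)) = 1 / (1 - Q.1) *
      ∏ t ∈ Finset.range s, phi Q.1 Q.2.1 Q.2.2.1 (pt Q l (i, t) / pt Q l (i, s)) := by
    unfold fockE
    congr 1
    refine Finset.prod_congr rfl fun t _ => ?_
    rw [psiRow_eq_phi h.mul_eq]
    congr 1
    simp only [pt_eq Q l (i, t), smul_eq_mul]; ring
  have e3 : (Finset.univ.filter fun j => rowLt (j, N) (i, s)) = Finset.univ.filter (· < i) := by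
    ext j
    simp only [Finset.mem_filter, Finset.mem_univ, true_and]
    unfold rowLt
    constructor
    · rintro (h | h)
      · exact h
      · simp only at hr; omega
    · exact .inl
  rw [e1, e2, coefN, prod_rows_lt i hr, e3,
    Finset.prod_congr rfl fun j hj => fockPsi_div_pt h hl (i, s) (Finset.mem_filter.1 hj).2.ne,
    Finset.prod_mul_distrib]
  ring

lemma tensorF_eq_coefN (h : IsGeneric Q) {l : Tuple n} {N : ℕ} (hl : SuppLE l N) {r : Row n}
    (hr : r.2 < N) :
    tensorF Q l r.1 r.2 = Q.1 / (1 - Q.1) * coefN (fun a b => rowLt b a) N Q l r := by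
  classical
  obtain ⟨i, s⟩ := r
  have h1 := ne_zero_of_mul₁ h.mul_eq
  have h3 := ne_zero_of_mul₃ h.mul_eq
  have hv := pt_ne_zero h.mul_eq h.u_ne l (i, s)
  have e1 : tensorF Q l i s =
      fockF Q.1 Q.2.1 Q.2.2.1 (l i) s (Q.2.2.2 i / pt Q l (i, s)) *
      (∏ j ∈ Finset.univ.filter (i < ·),
      fockPsi Q.1 Q.2.1 Q.2.2.1 (l j) (Q.2.2.2 j / pt Q l (i, s))) := rfl
  have e2 : fockF Q.1 Q.2.1 Q.2.2.1 (l i) s (Q.2.2.2 i / pt Q l (i, s)) = Q.1 / (1 - Q.1) *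
      psiEmpty Q.2.1 (pt Q l (i, N) / pt Q l (i, s)) *
      ∏ t ∈ Finset.Ico (s + 1) N, phi Q.1 Q.2.1 Q.2.2.1 (pt Q l (i, t) / pt Q l (i, s)) := by
    unfold fockF
    have := psiEmpty_mul_prod_support h.mul_eq (Q.2.2.2 i / pt Q l (i, s)) (l i)
      (s := s + 1) (N := N) hr (hl i) ?_ ?_
    · rw [mul_assoc, mul_assoc]
      congr 1
      have hf : (l i).support.filter (fun j => s < j) =
        (l i).support.filter (fun j => s + 1 ≤ j) := rfl
      rw [hf, ← smul_eq_mul (Q.2.2.1 ^ (s + 1)), this]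
      congr 1
      · simp only [pt_eq Q l (i, N), hl i N le_rfl, smul_eq_mul]
        congr 1; ring
      · refine Finset.prod_congr rfl fun t _ => ?_
        congr 1
        simp only [pt_eq Q l (i, t), smul_eq_mul]; ring
    · intro t ht e
      rw [sub_eq_zero, smul_eq_mul, mul_div_assoc', eq_comm, div_eq_one_iff_eq hv, pt_eq] at e
      have := (h.eq_of_mul_eq (x := 0) (y := t) (x' := l i s) (y' := s) (i := i) (j := i)
        (by simpa using e)).2.1
      omega
    · intro t ht e
      rw [sub_eq_zero, smul_eq_mul, mul_div_assoc', eq_comm, div_eq_one_iff_eq hv, pt_eq] at e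
      have := (h.eq_of_mul_eq (x := -1) (y := t - 1) (x' := l i s) (y' := s) (i := i) (j := i)
        (by
          rw [zpow_natCast, zpow_natCast, ← e, zpow_sub_one₀ h3, zpow_neg_one, zpow_natCast]
          have := h.mul_eq
          field_simp
          linear_combination (-Q.2.2.2 i) * this)).1
      omega
  have e3 : (Finset.univ.filter fun j => rowLt (i, s) (j, N)) =
      insert i (Finset.univ.filter (i < ·)) := by
    ext j
    simp only [Finset.mem_filter, Finset.mem_univ, true_and, Finset.mem_insert]
    unfold rowLt
    constructor
    · rintro (h | h)
      · exact .inr h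
      · exact .inl h.1.symm
    · rintro (h | h)
      · exact .inr ⟨h.symm, hr⟩
      · exact .inl h
  rw [e1, e2, coefN, prod_rows_gt i, e3, Finset.prod_insert (by simp),
    Finset.prod_congr rfl fun j hj => fockPsi_div_pt h hl (i, s) (Finset.mem_filter.1 hj).2.ne',
    Finset.prod_mul_distrib]
  ring

end TensorFormulas

/-! ### The cylindric three-dimensional picture -/

section Heights

/-- The sum of `c (idx j)` over `0 ≤ j < i`, continued to all integers `i` by periodicity. -/
def shift {n : ℕ} (c : Fin n → ℕ) (i : ℤ) : ℤ :=
  (i / n) * ∑ j, (c j : ℤ) + ∑ j : Fin n, if ((j : ℕ) : ℤ) < i % n then (c j : ℤ) else 0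

lemma shift_zero {n : ℕ} (c : Fin n → ℕ) : shift c 0 = 0 := by
  simp only [shift, Int.zero_ediv, zero_mul, Int.zero_emod, zero_add]
  exact Finset.sum_eq_zero fun j _ => if_neg (by omega)

variable {n : ℕ} [NeZero n]

/-- The conditions on the parameters of `ℳ`. -/
structure Resonant (P : Params n) (a b : Fin n → ℕ) : Prop where
  two_le : 2 ≤ n
  mul_eq : P.1 * P.2.1 * P.2.2.1 = 1
  res : ∀ x y : ℤ, P.1 ^ x * P.2.2.1 ^ y = 1 ↔
    ∃ κ : ℤ, x = (∑ i, (a i + 1) : ℕ) * κ ∧ y = (∑ i, (b i + 1) : ℕ) * κ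
  ne : ∑ i, (b i + 1) ≠ ∑ i, (a i + 1)
  u_zero_ne : P.2.2.2 0 ≠ 0
  u_step : ∀ i : Fin n, (i : ℕ) + 1 < n →
    P.2.2.2 i = P.2.2.2 (i + 1) * P.1 ^ (a i + 1) * P.2.2.1 ^ (b i + 1)

lemma n_pos : (0 : ℤ) < n := by exact_mod_cast Nat.pos_of_ne_zero (NeZero.ne n)

/-- The residue of an integer modulo `n`. -/
def idx (n : ℕ) [NeZero n] (i : ℤ) : Fin n :=
  ⟨(i % n).toNat, by
    have := Int.emod_lt_of_pos i (n_pos (n := n))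
    have := Int.emod_nonneg i (n_pos (n := n)).ne'
    omega⟩

lemma idx_val (i : ℤ) : ((idx n i : ℕ) : ℤ) = i % n := by
  simp only [idx]
  exact Int.toNat_of_nonneg (Int.emod_nonneg i (n_pos (n := n)).ne')

lemma idx_coe (i : Fin n) : idx n (i : ℕ) = i := by
  apply Fin.ext
  have := idx_val (n := n) (i : ℕ)
  rw [Int.emod_eq_of_lt (by omega) (by exact_mod_cast i.2)] at this
  exact_mod_cast this

lemma idx_eq_iff {i j : ℤ} : idx n i = idx n j ↔ ∃ κ : ℤ, j = i + n * κ := by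
  rw [Fin.ext_iff, ← Nat.cast_inj (R := ℤ), idx_val, idx_val]
  constructor
  · intro h
    obtain ⟨κ, hκ⟩ := Int.ModEq.dvd (a := i) (b := j) (n := n) h
    exact ⟨κ, by omega⟩
  · rintro ⟨κ, rfl⟩
    simp

lemma idx_succ (i : ℤ) : idx n (i + 1) = idx n i + 1 := by
  apply Fin.ext
  rw [← Nat.cast_inj (R := ℤ), idx_val, Fin.val_add]
  push_cast
  rw [idx_val, Fin.val_one']
  push_cast
  simp

lemma shift_add_mul (c : Fin n → ℕ) (i κ : ℤ) :
    shift c (i + n * κ) = shift c i + κ * ∑ j, (c j : ℤ) := by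
  unfold shift
  rw [Int.add_mul_ediv_left _ _ n_pos.ne']
  simp only [Int.add_mul_emod_self_left]
  ring

lemma shift_succ (c : Fin n → ℕ) (i : ℤ) : shift c (i + 1) = shift c i + c (idx n i) := by
  have hn := n_pos (n := n)
  have h0 := Int.emod_nonneg i hn.ne'
  have h1 := Int.emod_lt_of_pos i hn
  have key : ∑ j : Fin n, (if ((j : ℕ) : ℤ) < i % n + 1 then (c j : ℤ) else 0) =
      (∑ j : Fin n, if ((j : ℕ) : ℤ) < i % n then (c j : ℤ) else 0) + c (idx n i) := by
    have : (c (idx n i) : ℤ) = ∑ j : Fin n, if j = idx n i then (c j : ℤ) else 0 := by simp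
    rw [this, ← Finset.sum_add_distrib]
    refine Finset.sum_congr rfl fun j _ => ?_
    have e : j = idx n i ↔ ((j : ℕ) : ℤ) = i % n := by
      rw [Fin.ext_iff, ← Nat.cast_inj (R := ℤ), idx_val]
    simp only [e]
    split_ifs <;> omega
  have hdm := Int.mul_ediv_add_emod i n
  by_cases hlt : i % n + 1 < n
  · have e1 : (i + 1) % n = i % n + 1 := by
      rw [← hdm, add_assoc, Int.mul_add_emod_self_left, Int.mul_add_emod_self_left,
        Int.emod_emod, Int.emod_eq_of_lt (by omega) hlt]
    have e2 : (i + 1) / n = i / n := by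
      have := Int.mul_ediv_add_emod (i + 1) n
      rw [e1] at this
      exact mul_left_cancel₀ hn.ne' (by omega)
    unfold shift
    rw [e1, e2, key]; ring
  · have e0 : i + 1 = 0 + n * (i / n + 1) := by
      rw [mul_add, mul_one]; omega
    have e1 : ∑ j : Fin n, (if ((j : ℕ) : ℤ) < i % n + 1 then (c j : ℤ) else 0) =
        ∑ j, (c j : ℤ) :=
      Finset.sum_congr rfl fun j _ => if_pos (by have := j.2; omega)
    rw [e1] at key
    rw [e0, shift_add_mul, shift_zero, add_mul]
    unfold shift
    linear_combination key

/-- The smallest `y`-coordinate of the rows of the lifted member `i`. -/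
def base (b : Fin n → ℕ) (i : ℤ) : ℤ := -shift b i

lemma base_succ_le (b : Fin n → ℕ) (i : ℤ) : base b (i + 1) ≤ base b i := by
  unfold base; rw [shift_succ]; omega

lemma base_anti (b : Fin n → ℕ) {i i' : ℤ} (h : i ≤ i') : base b i' ≤ base b i := by
  induction i', h using Int.leInduction with
  | base => rfl
  | succ k _ ih => exact (base_succ_le b k).trans ih

/-- The row over the point `(i, y)`, for `base b i ≤ y`. -/
def toRow (b : Fin n → ℕ) (i y : ℤ) : Row n := (idx n i, (y - base b i).toNat)

/-- The height function of `l`: over all `(i, y)` with `base b i ≤ y`, the boxes of `l`, together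
with all those below, fill the column under `height a b l i y`. For admissible `l` the height is
weakly decreasing in `i` and `y`. -/
def height (a b : Fin n → ℕ) (l : Tuple n) (i y : ℤ) : ℤ :=
  l (toRow b i y).1 (toRow b i y).2 - shift a i

variable {a b : Fin n → ℕ}

lemma toRow_lift (b : Fin n → ℕ) (r : Row n) :
    toRow b ((r.1 : ℕ) : ℤ) (base b ((r.1 : ℕ) : ℤ) + r.2) = r := by
  unfold toRow
  rw [idx_coe]
  simp

lemma toRow_succ_i {i y : ℤ} (h : base b i ≤ y) :
    toRow b (i + 1) y = (idx n i + 1, (toRow b i y).2 + b (idx n i)) := by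
  unfold toRow
  rw [idx_succ]
  simp only [base, shift_succ] at *
  ext
  · rfl
  · simp only; omega

lemma toRow_succ_y {i y : ℤ} (h : base b i ≤ y) :
    toRow b i (y + 1) = (idx n i, (toRow b i y).2 + 1) := by
  unfold toRow
  ext
  · rfl
  · simp only; omega

/-- Both kinds of inequalities defining admissibility say that the height is weakly decreasing: in
`y` for a partition, in `i` for two consecutive members. -/
lemma isAdmissible_iff (l : Tuple n) : IsAdmissible a b l ↔
    ∀ i y, base b i ≤ y → height a b l i (y + 1) ≤ height a b l i y ∧
      height a b l (i + 1) y ≤ height a b l i y := by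
  constructor
  · rintro ⟨h1, h2⟩ i y hy
    unfold height
    rw [toRow_succ_i hy, toRow_succ_y hy, shift_succ]
    constructor
    · have := h1 (idx n i) (Nat.le_add_right (toRow b i y).2 1)
      simp only [toRow] at this ⊢
      omega
    · have := h2 (idx n i) (toRow b i y).2
      simp only [toRow] at this ⊢
      omega
  · intro h
    have key : ∀ r : Row n, (l r.1 (r.2 + 1) ≤ l r.1 r.2) ∧
        ((l (r.1 + 1) (r.2 + b r.1) : ℤ) - a r.1 ≤ l r.1 r.2) := by
      intro r
      have := h ((r.1 : ℕ) : ℤ) (base b ((r.1 : ℕ) : ℤ) + r.2) (by omega)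
      unfold height at this
      rw [toRow_succ_i (by omega), toRow_succ_y (by omega), shift_succ, toRow_lift, idx_coe] at this
      constructor
      · have := this.1; simp only at this; omega
      · have := this.2; simp only at this; omega
    exact ⟨fun i => antitone_nat_of_succ_le fun s => (key (i, s)).1, fun i s => (key (i, s)).2⟩

lemma height_anti {l : Tuple n} (hl : IsAdmissible a b l) {i y i' y' : ℤ} (hd : base b i ≤ y)
    (hi : i ≤ i') (hy : y ≤ y') : height a b l i' y' ≤ height a b l i y := by
  have h := (isAdmissible_iff l).1 hl
  have e1 : height a b l i y' ≤ height a b l i y := by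
    induction y', hy using Int.leInduction with
    | base => rfl
    | succ k hk ih => exact (h i k (by omega)).1.trans ih
  refine le_trans ?_ e1
  induction i', hi using Int.leInduction with
  | base => rfl
  | succ k hk ih => exact (h k y' ((base_anti b hk).trans (by omega))).2.trans ih

lemma height_addBox (l : Tuple n) (r : Row n) (i y : ℤ) :
    height a b (addBox l r.1 r.2) i y = height a b l i y + if toRow b i y = r then 1 else 0 := by
  unfold height
  rw [addBox_apply]
  split_ifs <;> push_cast <;> ring

end Heights

section Weights

variable {n : ℕ} [NeZero n] {P : Params n} {a b : Fin n → ℕ}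

/-- The weight of the box `(z, y, i)` in three-dimensional space. -/
def weight (P : Params n) (z y i : ℤ) : ℂ := P.1 ^ z * P.2.2.1 ^ y * P.2.1 ^ i * P.2.2.2 0

lemma Resonant.q₁_ne (h : Resonant P a b) : P.1 ≠ 0 := ne_zero_of_mul₁ h.mul_eq
lemma Resonant.q₂_ne (h : Resonant P a b) : P.2.1 ≠ 0 := ne_zero_of_mul₂ h.mul_eq
lemma Resonant.q₃_ne (h : Resonant P a b) : P.2.2.1 ≠ 0 := ne_zero_of_mul₃ h.mul_eq

/-- The weight is constant in the direction `(1, 1, 1)`, as `q₁ q₂ q₃ = 1`. -/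
lemma weight_diag (h : P.1 * P.2.1 * P.2.2.1 = 1) (z y i t : ℤ) :
    weight P (z + t) (y + t) (i + t) = weight P z y i := by
  have h1 := ne_zero_of_mul₁ h
  have h2 := ne_zero_of_mul₂ h
  have h3 := ne_zero_of_mul₃ h
  unfold weight
  rw [zpow_add₀ h1, zpow_add₀ h2, zpow_add₀ h3]
  have : P.1 ^ t * P.2.1 ^ t * P.2.2.1 ^ t = 1 := by rw [← mul_zpow, ← mul_zpow, h, one_zpow]
  linear_combination (P.1 ^ z * P.2.2.1 ^ y * P.2.1 ^ i * P.2.2.2 0) * this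

lemma weight_add (h : P.1 * P.2.1 * P.2.2.1 = 1) (z y i z' y' i' : ℤ) :
    weight P (z + z') (y + y') (i + i') =
      P.1 ^ z' * P.2.1 ^ i' * P.2.2.1 ^ y' * weight P z y i := by
  unfold weight
  rw [zpow_add₀ (ne_zero_of_mul₁ h), zpow_add₀ (ne_zero_of_mul₂ h), zpow_add₀ (ne_zero_of_mul₃ h)]
  ring

lemma Resonant.cast_sum_a (_ : Resonant P a b) :
    ((∑ i, (a i + 1) : ℕ) : ℤ) = ∑ i, (a i : ℤ) + n := by
  push_cast
  rw [Finset.sum_add_distrib]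
  simp

lemma Resonant.cast_sum_b (_ : Resonant P a b) :
    ((∑ i, (b i + 1) : ℕ) : ℤ) = ∑ i, (b i : ℤ) + n := by
  push_cast
  rw [Finset.sum_add_distrib]
  simp

/-- The parameter `u` of the lifted member `i` is the weight of the corner of this member in
three-dimensional space. For `0 ≤ i < n` this is the recursion for the `u_i`, and the period
`(n, -∑ a, -∑ b)` in the coordinates `(i, z, y)` has weight `1` by the resonance condition. -/
lemma Resonant.u_idx (h : Resonant P a b) (i : ℤ) :
    P.2.2.2 (idx n i) = weight P (-shift a i) (base b i) i := by
  have h1 := h.q₁_ne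
  have h2 := h.q₂_ne
  have h3 := h.q₃_ne
  have base_case : ∀ k : ℕ, k < n →
      P.2.2.2 (idx n k) = weight P (-shift a k) (base b k) k := by
    intro k
    induction k with
    | zero =>
      intro _
      have : idx n ((0 : ℕ) : ℤ) = 0 := idx_coe (n := n) 0
      rw [this]
      simp [weight, shift_zero, base]
    | succ k ih =>
      intro hk
      have ih := ih (by omega)
      have hv : (idx n (k : ℤ) : ℕ) = k := by
        have := idx_val (n := n) (k : ℤ)
        rw [Int.emod_eq_of_lt (by omega) (by omega)] at this
        exact_mod_cast this
      have hs := h.u_step (idx n k) (by omega)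
      rw [ih, ← idx_succ] at hs
      push_cast
      have e := weight_add h.mul_eq (-shift a k - a (idx n k) - 1)
        (base b k - b (idx n k) - 1) k (a (idx n k) + 1) (b (idx n k) + 1) 0
      have e2 := weight_diag h.mul_eq (-shift a k - a (idx n k) - 1)
        (base b k - b (idx n k) - 1) k 1
      unfold base at *
      rw [shift_succ, shift_succ]
      ring_nf at e e2 hs ⊢
      rw [e2]
      rw [e] at hs
      have c1 : P.1 ^ a (idx n ↑k) ≠ 0 := pow_ne_zero _ h1
      have c2 : P.2.2.1 ^ b (idx n ↑k) ≠ 0 := pow_ne_zero _ h3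
      rw [zpow_add₀ h1, zpow_add₀ h3, zpow_natCast, zpow_natCast] at hs
      simp only [zpow_one, zpow_zero] at hs
      have : P.1 * P.1 ^ a (idx n ↑k) * (P.2.2.1 * P.2.2.1 ^ b (idx n ↑k)) ≠ 0 := by
        simp [h1, h3]
      apply mul_left_cancel₀ this
      rw [← sub_eq_zero] at hs ⊢
      rw [← neg_eq_zero, ← hs]
      ring
  have hn := n_pos (n := n)
  have e0 : i = ((i % n).toNat : ℤ) + n * (i / n) := by
    rw [Int.toNat_of_nonneg (Int.emod_nonneg i hn.ne')]
    have := Int.mul_ediv_add_emod i n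
    omega
  have lt : (i % n).toNat < n := by
    have := Int.emod_lt_of_pos i hn
    have := Int.emod_nonneg i hn.ne'
    omega
  generalize (i % n).toNat = k at e0 lt
  generalize i / n = κ at e0
  subst e0
  have e1 : idx n ((k : ℤ) + n * κ) = idx n k := (idx_eq_iff.2 ⟨κ, rfl⟩).symm
  rw [e1, base_case k lt]
  unfold base
  rw [shift_add_mul, shift_add_mul]
  have hr := (h.res (-(∑ j, (a j : ℤ) + n) * κ) (-(∑ j, (b j : ℤ) + n) * κ)).2
    ⟨-κ, by rw [h.cast_sum_a]; ring, by rw [h.cast_sum_b]; ring⟩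
  have e2 := weight_diag h.mul_eq (-(shift a k + κ * ∑ j, (a j : ℤ)))
    (-(shift b k + κ * ∑ j, (b j : ℤ))) (k + n * κ) (- n * κ)
  rw [← e2]
  have e3 := weight_add h.mul_eq (-shift a k) (-shift b k) k
    (-(∑ j, (a j : ℤ) + n) * κ) (-(∑ j, (b j : ℤ) + n) * κ) 0
  rw [zpow_zero, mul_one, hr, one_mul] at e3
  rw [← e3]
  congr 1 <;> ring

lemma Resonant.u_ne (h : Resonant P a b) (i : Fin n) : P.2.2.2 i ≠ 0 := by
  rw [← idx_coe i, h.u_idx]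
  unfold weight
  have h1 := zpow_ne_zero (-shift a ((i : ℕ) : ℤ)) h.q₁_ne
  have h2 := zpow_ne_zero ((i : ℕ) : ℤ) h.q₂_ne
  have h3 := zpow_ne_zero (base b ((i : ℕ) : ℤ)) h.q₃_ne
  exact mul_ne_zero (mul_ne_zero (mul_ne_zero h1 h3) h2) h.u_zero_ne

lemma Resonant.boxPt_toRow (h : Resonant P a b) {i y : ℤ} (hd : base b i ≤ y) (k : ℤ) :
    boxPt P (toRow b i y) k = weight P (k - shift a i) y i := by
  unfold boxPt toRow
  simp only
  rw [h.u_idx, Int.toNat_of_nonneg (by omega)]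
  have := weight_add h.mul_eq (-shift a i) (base b i) i k (y - base b i) 0
  rw [zpow_zero, mul_one] at this
  rw [← this]
  congr 1 <;> ring

lemma Resonant.pt_toRow (h : Resonant P a b) {i y : ℤ} (hd : base b i ≤ y) (l : Tuple n) :
    pt P l (toRow b i y) = weight P (height a b l i y) y i := by
  rw [pt_eq_boxPt, h.boxPt_toRow hd]; rfl

/-- Boxes with proportional weights lie, after a suitable choice of lifts, on the corresponding
lines of direction `(1, 1, 1)`. -/
lemma Resonant.exists_lift (h : Resonant P a b) {r r' : Row n} {k k' x₁ x₂ x₃ : ℤ}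
    (e : boxPt P r' k' = P.1 ^ x₁ * P.2.1 ^ x₂ * P.2.2.1 ^ x₃ * boxPt P r k) :
    ∃ i y i' y' t : ℤ, base b i ≤ y ∧ base b i' ≤ y' ∧ toRow b i y = r ∧ toRow b i' y' = r' ∧
      i' = i + x₂ + t ∧ y' = y + x₃ + t ∧ k' - shift a i' = k - shift a i + x₁ + t := by
  -- after removing a multiple of `(1, 1, 1)`, equal weights differ by a multiple `κ` of the period,
  -- which is absorbed into the lift of `r'`
  have h1 := h.q₁_ne
  have h2 := h.q₂_ne
  have h3 := h.q₃_ne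
  set i : ℤ := ((r.1 : ℕ) : ℤ) with hi
  set y : ℤ := base b i + r.2 with hy
  set j : ℤ := ((r'.1 : ℕ) : ℤ) with hj
  set w : ℤ := base b j + r'.2 with hw
  have er : toRow b i y = r := toRow_lift b r
  have er' : toRow b j w = r' := toRow_lift b r'
  have hd : base b i ≤ y := by omega
  have hd' : base b j ≤ w := by omega
  rw [← er, ← er', h.boxPt_toRow hd, h.boxPt_toRow hd', ← weight_add h.mul_eq] at e
  have e1 : P.1 ^ ((k' - shift a j - j) - (k - shift a i + x₁ - (i + x₂))) *
      P.2.2.1 ^ ((w - j) - (y + x₃ - (i + x₂))) = 1 := by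
    rw [← weight_diag h.mul_eq _ _ _ (-j), ← weight_diag h.mul_eq (k - shift a i + x₁) _ _
      (-(i + x₂))] at e
    unfold weight at e
    simp only [add_neg_cancel, zpow_zero, mul_one] at e
    have e := mul_right_cancel₀ h.u_zero_ne e
    rw [zpow_sub₀ h1, zpow_sub₀ h3, div_mul_div_comm, div_eq_one_iff_eq]
    · exact e
    · exact mul_ne_zero (zpow_ne_zero _ h1) (zpow_ne_zero _ h3)
  obtain ⟨κ, hκ1, hκ2⟩ := (h.res _ _).1 e1
  rw [h.cast_sum_a] at hκ1
  rw [h.cast_sum_b] at hκ2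
  have eb : base b (j + n * κ) = base b j - κ * ∑ t, (b t : ℤ) := by
    unfold base; rw [shift_add_mul]; ring
  refine ⟨i, y, j + n * κ, w - κ * ∑ t, (b t : ℤ), j + n * κ - i - x₂, hd, ?_, er, ?_, ?_, ?_, ?_⟩
  · rw [eb]; omega
  · rw [← er']
    unfold toRow
    rw [eb]
    congr 1
    · exact (idx_eq_iff.2 ⟨κ, rfl⟩).symm
    · congr 1; ring
  · ring
  · linear_combination hκ2
  · rw [shift_add_mul]; linear_combination hκ1

/-- The version of `Resonant.exists_lift` for the boxes at the ends of the rows. -/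
lemma Resonant.exists_lift_pt (h : Resonant P a b) {r r' : Row n} {l l' : Tuple n} {x₁ x₂ x₃ : ℤ}
    (e : pt P l' r' = P.1 ^ x₁ * P.2.1 ^ x₂ * P.2.2.1 ^ x₃ * pt P l r) :
    ∃ i y i' y' t : ℤ, base b i ≤ y ∧ base b i' ≤ y' ∧ toRow b i y = r ∧ toRow b i' y' = r' ∧
      i' = i + x₂ + t ∧ y' = y + x₃ + t ∧
      height a b l' i' y' = height a b l i y + x₁ + t := by
  rw [pt_eq_boxPt, pt_eq_boxPt] at e
  obtain ⟨i, y, i', y', t, hd, hd', er, er', h1, h2, h3⟩ := h.exists_lift e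
  refine ⟨i, y, i', y', t, hd, hd', er, er', h1, h2, ?_⟩
  unfold height
  rw [er, er']
  exact h3

end Weights

/-! ### Non-degeneracy at resonant parameters -/

section Nondegeneracy

variable {n : ℕ} [NeZero n] {P : Params n} {a b : Fin n → ℕ} {l m : Tuple n} {r r' : Row n}

lemma Resonant.sum_a_ge (h : Resonant P a b) : 2 ≤ ((∑ i, (a i + 1) : ℕ) : ℤ) := by
  rw [h.cast_sum_a]
  have : (0 : ℤ) ≤ ∑ i, (a i : ℤ) := Finset.sum_nonneg fun i _ => by positivity
  have := h.two_le
  omega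

lemma Resonant.sum_b_ge (h : Resonant P a b) : 2 ≤ ((∑ i, (b i + 1) : ℕ) : ℤ) := by
  rw [h.cast_sum_b]
  have : (0 : ℤ) ≤ ∑ i, (b i : ℤ) := Finset.sum_nonneg fun i _ => by positivity
  have := h.two_le
  omega

/-- A monomial in `q₁`, `q₂`, `q₃` with small exponents is different from `1`. -/
lemma Resonant.monomial_ne_one (h : Resonant P a b) {x y z : ℤ}
    (hx : (x - z = 0 ∧ y - z ≠ 0) ∨ (y - z = 0 ∧ x - z ≠ 0) ∨ (x - z = y - z ∧ x - z ≠ 0) ∨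
      ((x - z) * (y - z) < 0) ∨ (x - z = 1) ∨ (y - z = 1) ∨ (x - z = -1) ∨ (y - z = -1)) :
    P.1 ^ x * P.2.1 ^ z * P.2.2.1 ^ y ≠ 1 := by
  intro e
  have h1 := h.q₁_ne
  have h2 := h.q₂_ne
  have h3 := h.q₃_ne
  have e1 : P.1 ^ (x - z) * P.2.2.1 ^ (y - z) = 1 := by
    have hz : P.1 ^ z * P.2.1 ^ z * P.2.2.1 ^ z = 1 := by
      rw [← mul_zpow, ← mul_zpow, h.mul_eq, one_zpow]
    rw [zpow_sub₀ h1, zpow_sub₀ h3, div_mul_div_comm, div_eq_one_iff_eq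
      (mul_ne_zero (zpow_ne_zero _ h1) (zpow_ne_zero _ h3))]
    have h2' := zpow_ne_zero z h2
    apply mul_right_cancel₀ h2'
    linear_combination e - hz
  obtain ⟨κ, hκ1, hκ2⟩ := (h.res _ _).1 e1
  have ha := h.sum_a_ge
  have hb := h.sum_b_ge
  have hne : ((∑ i, (b i + 1) : ℕ) : ℤ) ≠ ((∑ i, (a i + 1) : ℕ) : ℤ) := by exact_mod_cast h.ne
  generalize ((∑ i, (a i + 1) : ℕ) : ℤ) = A at *
  generalize ((∑ i, (b i + 1) : ℕ) : ℤ) = B at *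
  rw [hκ1, hκ2] at hx
  have no_unit : ∀ C : ℤ, 2 ≤ C → C * κ ≠ 1 ∧ C * κ ≠ -1 := by
    intro C hC
    constructor <;> intro hC'
    · have := Int.eq_one_or_neg_one_of_mul_eq_one hC'; omega
    · have := Int.eq_one_or_neg_one_of_mul_eq_one (u := C) (v := -κ) (by linarith); omega
  have zero : ∀ C : ℤ, 2 ≤ C → C * κ = 0 → κ = 0 := fun C hC h0 => by
    rcases mul_eq_zero.1 h0 with h0 | h0
    · omega
    · exact h0
  rcases hx with ⟨h0, h'⟩ | ⟨h0, h'⟩ | ⟨h0, h'⟩ | h' | h' | h' | h' | h'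
  · exact h' (by rw [zero A ha h0]; simp)
  · exact h' (by rw [zero B hb h0]; simp)
  · have : (A - B) * κ = 0 := by linarith
    rcases mul_eq_zero.1 this with h0 | h0
    · exact hne (by omega)
    · exact h' (by rw [h0]; simp)
  · nlinarith [mul_nonneg (mul_nonneg (by omega : (0 : ℤ) ≤ A) (by omega : (0 : ℤ) ≤ B))
      (sq_nonneg κ)]
  · exact (no_unit A ha).1 h'
  · exact (no_unit B hb).1 h'
  · exact (no_unit A ha).2 h'
  · exact (no_unit B hb).2 h'

lemma Resonant.q₁_ne_one (h : Resonant P a b) : P.1 ≠ 1 := by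
  have := h.monomial_ne_one (x := 1) (y := 0) (z := 0) (by omega)
  simpa using this
lemma Resonant.q₂_ne_one (h : Resonant P a b) : P.2.1 ≠ 1 := by
  have := h.monomial_ne_one (x := 0) (y := 0) (z := 1) (by omega)
  simpa using this
lemma Resonant.q₃_ne_one (h : Resonant P a b) : P.2.2.1 ≠ 1 := by
  have := h.monomial_ne_one (x := 0) (y := 1) (z := 0) (by omega)
  simpa using this

/-- The points of different rows are different. -/
lemma Resonant.pt_ne (h : Resonant P a b) (hl : IsAdmissible a b l) (hr : r' ≠ r) :
    pt P l r' ≠ pt P l r := by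
  intro e
  -- the ends of the two rows lie on a diagonal, which contradicts the monotonicity of the height
  obtain ⟨i, y, i', y', t, hd, hd', er, er', hi, hy, hh⟩ :=
    h.exists_lift_pt (l := l) (l' := l) (r := r) (r' := r') (x₁ := 0) (x₂ := 0) (x₃ := 0)
      (by simpa using e)
  rcases lt_trichotomy t 0 with ht | ht | ht
  · have := height_anti hl hd' (show i' ≤ i by omega) (show y' ≤ y by omega)
    omega
  · subst ht
    simp only [add_zero] at hi hy
    exact hr (by rw [← er, ← er', hi, hy])
  · have := height_anti hl hd (show i ≤ i' by omega) (show y ≤ y' by omega)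
    omega

/-- The row `r` of a tuple can be increased without violating the monotonicity. -/
def Growable (l : Tuple n) (r : Row n) : Prop := r.2 = 0 ∨ l r.1 r.2 < l r.1 (r.2 - 1)

lemma Growable.height_lt (hg : Growable l r) {i y : ℤ} (er : toRow b i y = r)
    (hd : base b i ≤ y - 1) : height a b l i y < height a b l i (y - 1) := by
  have e : toRow b i (y - 1) = (r.1, r.2 - 1) := by
    rw [← er]; unfold toRow; ext
    · rfl
    · simp only; omega
  have h0 : r.2 ≠ 0 := by rw [← er]; simp only [toRow]; omega
  unfold height
  rw [e, er]
  have := hg.resolve_left h0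
  simp only
  omega

lemma growable_of_isAdmissible (hl : IsAdmissible a b (addBox l r.1 r.2)) :
    Growable l r := by
  by_cases h0 : r.2 = 0
  · exact .inl h0
  · right
    have := hl.1 r.1 (show r.2 - 1 ≤ r.2 by omega)
    have e1 := addBox_apply l r r
    have e2 := addBox_apply l r (r.1, r.2 - 1)
    rw [if_pos rfl] at e1
    rw [if_neg (by intro hc; have := congrArg Prod.snd hc; simp only at this; omega)] at e2
    simp only at e2
    omega

/-- No row ends at the box added next to a growable row. -/
lemma Resonant.pt_ne_q₁_mul_pt (h : Resonant P a b) (hl : IsAdmissible a b l)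
    (hg : Growable l r) (r' : Row n) : pt P l r' ≠ P.1 * pt P l r := by
  intro e
  obtain ⟨i, y, i', y', t, hd, hd', er, er', hi, hy, hh⟩ :=
    h.exists_lift_pt (l := l) (l' := l) (r := r) (r' := r') (x₁ := 1) (x₂ := 0) (x₃ := 0)
      (by simpa using e)
  rcases le_or_gt 0 t with ht | ht
  · have := height_anti hl hd (show i ≤ i' by omega) (show y ≤ y' by omega)
    omega
  · have hb := base_anti b (show i' ≤ i by omega)
    have h1 := height_anti hl hd' (show i' ≤ i by omega) (show y' ≤ y - 1 by omega)
    have h2 := hg.height_lt (a := a) er (by omega)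
    omega

/-- The row `r` of the tuple obtained from `m` by adding a box to this row can be decreased without
violating the monotonicity. -/
def Shrinkable (m : Tuple n) (r : Row n) : Prop := m r.1 (r.2 + 1) ≤ m r.1 r.2

lemma Shrinkable.height_lt (hs : Shrinkable m r) {i y : ℤ} (er : toRow b i y = r)
    (hd : base b i ≤ y) :
    height a b (addBox m r.1 r.2) i (y + 1) < height a b (addBox m r.1 r.2) i y := by
  have e : toRow b i (y + 1) = (r.1, r.2 + 1) := by
    rw [toRow_succ_y hd, er, ← er]; rfl
  rw [height_addBox, height_addBox, if_pos er, if_neg (by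
    rw [e]; intro hc; have := congrArg Prod.snd hc; simp only at this; omega)]
  unfold height
  rw [e, er]
  unfold Shrinkable at hs
  simp only
  omega

lemma shrinkable_of_isAdmissible (hm : IsAdmissible a b m) : Shrinkable m r :=
  hm.1 r.1 (by omega)

/-- The version of `Resonant.pt_ne` for a tuple, not necessarily admissible, which becomes
admissible after adding a box to the row `r`. -/
lemma Resonant.pt_ne_of_addBox (h : Resonant P a b) (hl : IsAdmissible a b (addBox m r.1 r.2))
    (hs : Shrinkable m r) (hr : r' ≠ r) : pt P m r' ≠ pt P m r := by
  intro e
  obtain ⟨i, y, i', y', t, hd, hd', er, er', hi, hy, hh⟩ :=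
    h.exists_lift_pt (l := m) (l' := m) (r := r) (r' := r') (x₁ := 0) (x₂ := 0) (x₃ := 0)
      (by simpa using e)
  have g := height_addBox (a := a) (b := b) m r i y
  have g' := height_addBox (a := a) (b := b) m r i' y'
  rw [if_pos er] at g
  rw [if_neg (by rw [er']; exact hr)] at g'
  rcases lt_trichotomy t 0 with ht | ht | ht
  · have := height_anti hl hd' (show i' ≤ i by omega) (show y' ≤ y by omega)
    omega
  · subst ht
    simp only [add_zero] at hi hy
    exact hr (by rw [← er, ← er', hi, hy])
  · have h1 := hs.height_lt (a := a) er hd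
    have h2 := height_anti hl (show base b i ≤ y + 1 by omega) (show i ≤ i' by omega)
      (show y + 1 ≤ y' by omega)
    omega

/-- The version of `Resonant.pt_ne_q₁_mul_pt` for a tuple which becomes admissible after adding a
box to the row `r`. -/
lemma Resonant.pt_ne_q₁_mul_pt_of_addBox (h : Resonant P a b)
    (hl : IsAdmissible a b (addBox m r.1 r.2)) (r' : Row n) : pt P m r' ≠ P.1 * pt P m r := by
  intro e
  by_cases hr : r' = r
  · subst hr
    have := pt_ne_zero h.mul_eq h.u_ne m r'
    exact h.q₁_ne_one (mul_right_cancel₀ this (by rw [one_mul]; exact e.symm))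
  obtain ⟨i, y, i', y', t, hd, hd', er, er', hi, hy, hh⟩ :=
    h.exists_lift_pt (l := m) (l' := m) (r := r) (r' := r') (x₁ := 1) (x₂ := 0) (x₃ := 0)
      (by simpa using e)
  have g := height_addBox (a := a) (b := b) m r i y
  have g' := height_addBox (a := a) (b := b) m r i' y'
  rw [if_pos er] at g
  rw [if_neg (by rw [er']; exact hr)] at g'
  rcases lt_trichotomy t 0 with ht | ht | ht
  · have := height_anti hl hd' (show i' ≤ i by omega) (show y' ≤ y by omega)
    omega
  · subst ht
    simp only [add_zero] at hi hy
    exact hr (by rw [← er, ← er', hi, hy])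
  · have := height_anti hl hd (show i ≤ i' by omega) (show y ≤ y' by omega)
    omega

/-- The numerators of the coefficients for adding an admissible box do not vanish. -/
lemma Resonant.pt_ne_q₂_mul_pt (h : Resonant P a b) (hl : IsAdmissible a b l)
    (hl' : IsAdmissible a b (addBox l r.1 r.2)) (r' : Row n) : pt P l r ≠ P.2.1 * pt P l r' := by
  intro e
  by_cases hr : r' = r
  · subst hr
    have := pt_ne_zero h.mul_eq h.u_ne l r'
    exact h.q₂_ne_one (mul_right_cancel₀ this (by rw [one_mul]; exact e.symm))
  obtain ⟨i', y', i, y, t, hd', hd, er', er, hi, hy, hh⟩ :=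
    h.exists_lift_pt (l := l) (l' := l) (r := r') (r' := r) (x₁ := 0) (x₂ := 1) (x₃ := 0)
      (by simpa using e)
  have g := height_addBox (a := a) (b := b) l r i y
  have g' := height_addBox (a := a) (b := b) l r i' y'
  rw [if_pos er] at g
  rw [if_neg (by rw [er']; exact hr)] at g'
  rcases le_or_gt 0 t with ht | ht
  · have := height_anti hl' hd' (show i' ≤ i by omega) (show y' ≤ y by omega)
    omega
  · have := height_anti hl hd (show i ≤ i' by omega) (show y ≤ y' by omega)
    omega

/-- The numerators of the coefficients for adding an admissible box do not vanish. -/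
lemma Resonant.pt_ne_q₃_mul_pt (h : Resonant P a b) (hl : IsAdmissible a b l)
    (hl' : IsAdmissible a b (addBox l r.1 r.2)) (r' : Row n) : pt P l r ≠ P.2.2.1 * pt P l r' := by
  intro e
  by_cases hr : r' = r
  · subst hr
    have := pt_ne_zero h.mul_eq h.u_ne l r'
    exact h.q₃_ne_one (mul_right_cancel₀ this (by rw [one_mul]; exact e.symm))
  obtain ⟨i', y', i, y, t, hd', hd, er', er, hi, hy, hh⟩ :=
    h.exists_lift_pt (l := l) (l' := l) (r := r') (r' := r) (x₁ := 0) (x₂ := 0) (x₃ := 1)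
      (by simpa using e)
  have g := height_addBox (a := a) (b := b) l r i y
  have g' := height_addBox (a := a) (b := b) l r i' y'
  rw [if_pos er] at g
  rw [if_neg (by rw [er']; exact hr)] at g'
  rcases le_or_gt 0 t with ht | ht
  · have := height_anti hl' hd' (show i' ≤ i by omega) (show y' ≤ y by omega)
    omega
  · have := height_anti hl hd (show i ≤ i' by omega) (show y ≤ y' by omega)
    omega

/-- If `k` is obtained from the admissible tuple `l` by adding boxes to different rows, and is
contained in the admissible tuple `m`, then it is admissible unless one of the boxes added to `l`
rests against a box of `m` which is missing in `k`. -/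
lemma Resonant.exists_blocked (h : Resonant P a b) {k : Tuple n} (hl : IsAdmissible a b l)
    (hm : IsAdmissible a b m) (hk : ¬ IsAdmissible a b k)
    (hlk : ∀ r : Row n, l r.1 r.2 ≤ k r.1 r.2) (hkm : ∀ r : Row n, k r.1 r.2 ≤ m r.1 r.2)
    (hkl : ∀ r : Row n, k r.1 r.2 ≤ l r.1 r.2 + 1) :
    ∃ c d : Row n, k d.1 d.2 = l d.1 d.2 + 1 ∧ k c.1 c.2 = l c.1 c.2 ∧
      m d.1 d.2 + k c.1 c.2 < m c.1 c.2 + k d.1 d.2 ∧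
      (pt P l d = P.2.1 * pt P l c ∨ pt P l d = P.2.2.1 * pt P l c) := by
  rw [isAdmissible_iff] at hk
  push Not at hk
  obtain ⟨i, y, hd, hk⟩ := hk
  have key : ∀ i' y', height a b l i' y' ≤ height a b l i y →
      height a b m i' y' ≤ height a b m i y →
      height a b k i y < height a b k i' y' →
      k (toRow b i' y').1 (toRow b i' y').2 = l (toRow b i' y').1 (toRow b i' y').2 + 1 ∧
      k (toRow b i y).1 (toRow b i y).2 = l (toRow b i y).1 (toRow b i y).2 ∧
      m (toRow b i' y').1 (toRow b i' y').2 + k (toRow b i y).1 (toRow b i y).2 <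
        m (toRow b i y).1 (toRow b i y).2 + k (toRow b i' y').1 (toRow b i' y').2 ∧
      height a b l i' y' = height a b l i y := by
    intro i' y'
    have a1 := hlk (toRow b i y)
    have a2 := hlk (toRow b i' y')
    have a3 := hkm (toRow b i y)
    have a4 := hkm (toRow b i' y')
    have a5 := hkl (toRow b i y)
    have a6 := hkl (toRow b i' y')
    unfold height
    intro h1 h2 h3
    refine ⟨?_, ?_, ?_, ?_⟩ <;> omega
  have hl' := (isAdmissible_iff l).1 hl i y hd
  have hm' := (isAdmissible_iff m).1 hm i y hd
  have hdi := (base_succ_le b i).trans hd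
  by_cases hc : height a b k i (y + 1) ≤ height a b k i y
  · obtain ⟨k1, k2, k3, k4⟩ := key (i + 1) y hl'.2 hm'.2 (hk hc)
    refine ⟨toRow b i y, toRow b (i + 1) y, k1, k2, k3, .inl ?_⟩
    rw [h.pt_toRow hd, h.pt_toRow hdi, k4]
    have := weight_add h.mul_eq (height a b l i y) y i 0 0 1
    simpa using this
  · obtain ⟨k1, k2, k3, k4⟩ := key i (y + 1) hl'.1 hm'.1 (by omega)
    refine ⟨toRow b i y, toRow b i (y + 1), k1, k2, k3, .inr ?_⟩
    rw [h.pt_toRow hd, h.pt_toRow (show base b i ≤ y + 1 by omega), k4]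
    have := weight_add h.mul_eq (height a b l i y) y i 0 1 0
    simpa using this

/-- If two boxes of `m` not in `l` have diagonally neighbouring columns, then `m` and `l` differ
in at least four rows. -/
lemma Resonant.no_square (h : Resonant P a b) (hl : IsAdmissible a b l) (hm : IsAdmissible a b m)
    {S : Finset (Row n)} (hS : S.card ≤ 3) (hlm : ∀ r : Row n, r ∉ S → m r.1 r.2 = l r.1 r.2)
    {i y z : ℤ} (hd : base b i ≤ y) (h1 : height a b l i y ≤ z)
    (h2 : z < height a b m (i + 1) (y + 1)) : False := by
  have hn := h.two_le
  have hdi := (base_succ_le b i).trans hd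
  -- the height of `l` is at most `z`, and the height of `m` is greater than `z`, on the square with
  -- corners `(i, y)` and `(i + 1, y + 1)`; its four rows are different since `2 ≤ n`
  have mem : ∀ i' y', i ≤ i' → y ≤ y' → i' ≤ i + 1 → y' ≤ y + 1 → base b i' ≤ y' →
      toRow b i' y' ∈ S := by
    intro i' y' a1 a2 a3 a4 hd'
    by_contra hc
    have e := hlm _ hc
    have b1 := height_anti hl hd a1 a2
    have b2 := height_anti hm hd' a3 a4
    unfold height at *
    rw [e] at b2
    omega
  have m1 := mem i y le_rfl le_rfl (by omega) (by omega) hd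
  have m2 := mem i (y + 1) le_rfl (by omega) (by omega) le_rfl (by omega)
  have m3 := mem (i + 1) y (by omega) le_rfl le_rfl (by omega) hdi
  have m4 := mem (i + 1) (y + 1) (by omega) (by omega) le_rfl le_rfl (by omega)
  have hne : idx n i ≠ idx n (i + 1) := by
    intro hc
    obtain ⟨κ, hκ⟩ := idx_eq_iff.1 hc
    have : (n : ℤ) * κ = 1 := by omega
    have := Int.eq_one_or_neg_one_of_mul_eq_one this
    omega
  have hy : ∀ i', base b i' ≤ y → toRow b i' y ≠ toRow b i' (y + 1) := by
    intro i' hd' hc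
    have := congrArg Prod.snd hc
    simp only [toRow] at this
    omega
  have hx : ∀ y' y'', toRow b i y' ≠ toRow b (i + 1) y'' := fun y' y'' hc =>
    hne (congrArg Prod.fst hc)
  have hsub : ({toRow b i y, toRow b i (y + 1), toRow b (i + 1) y, toRow b (i + 1) (y + 1)} :
      Finset (Row n)) ⊆ S := by
    intro x hx
    simp only [Finset.mem_insert, Finset.mem_singleton] at hx
    rcases hx with rfl | rfl | rfl | rfl <;> assumption
  have := Finset.card_le_card hsub
  rw [Finset.card_insert_of_notMem, Finset.card_insert_of_notMem, Finset.card_insert_of_notMem,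
    Finset.card_singleton] at this
  · omega
  · simpa using hy (i + 1) hdi
  · simpa using ⟨hx _ _, hx _ _⟩
  · simpa using ⟨hy i hd, hx _ _, hx _ _⟩

/-- Two boxes of different rows which are in `m` but not in `l`, where `m` has few boxes more than
`l`, have sufficiently different points. -/
lemma Resonant.boxPt_ne (h : Resonant P a b) (hl : IsAdmissible a b l) (hm : IsAdmissible a b m)
    {S : Finset (Row n)} (hS : S.card ≤ 3) (hlm : ∀ r : Row n, r ∉ S → m r.1 r.2 = l r.1 r.2)
    (hr : r' ≠ r) {k k' : ℕ} (hk : l r.1 r.2 ≤ k) (hk' : l r'.1 r'.2 ≤ k')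
    (hkm : k < m r.1 r.2) (hkm' : k' < m r'.1 r'.2) :
    boxPt P r' k' ≠ boxPt P r k ∧ boxPt P r' k' ≠ P.1 * boxPt P r k := by
  have key : ∀ x : ℤ, 0 ≤ x → x ≤ 1 → boxPt P r' k' ≠ P.1 ^ x * boxPt P r k := by
    intro x hx0 hx1 e
    obtain ⟨i, y, i', y', t, hd, hd', er, er', hi, hy, hh⟩ :=
      h.exists_lift (x₁ := x) (x₂ := 0) (x₃ := 0) (by simpa using e)
    rw [← er] at hk hkm
    rw [← er'] at hk' hkm'
    -- on a diagonal, different boxes of `m` not in `l` would give a square of such boxes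
    rcases lt_trichotomy t 0 with ht | ht | ht
    · have hb := base_anti b (show i' + 1 ≤ i by omega)
      have hb' := base_succ_le b i'
      refine h.no_square hl hm hS hlm (z := k' - shift a i') hd' ?_ ?_
      · unfold height; omega
      · have := height_anti hm (show base b (i' + 1) ≤ y' + 1 by omega) (show i' + 1 ≤ i by omega)
          (show y' + 1 ≤ y by omega)
        refine lt_of_lt_of_le ?_ this
        unfold height; omega
    · subst ht
      simp only [add_zero] at hi hy
      exact hr (by rw [← er, ← er', hi, hy])
    · have hb' := base_succ_le b i
      refine h.no_square hl hm hS hlm (z := k - shift a i) hd ?_ ?_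
      · unfold height; omega
      · have := height_anti hm (show base b (i + 1) ≤ y + 1 by omega) (show i + 1 ≤ i' by omega)
          (show y + 1 ≤ y' by omega)
        refine lt_of_lt_of_le ?_ this
        unfold height; omega
  constructor
  · simpa using key 0 le_rfl (by omega)
  · simpa using key 1 (by omega) le_rfl

/-- On a diagonal, an admissible tuple `m` missing a box of the admissible tuple `l` has only
boxes which are also in `l`. -/
lemma Resonant.lt_of_boxPt_eq (h : Resonant P a b) (hl : IsAdmissible a b l)
    (hm : IsAdmissible a b m) {k k' : ℕ} (hk : k < l r.1 r.2) (hkm : m r.1 r.2 ≤ k)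
    (hk' : k' < m r'.1 r'.2) (e : boxPt P r' k' = boxPt P r k) : k' < l r'.1 r'.2 := by
  obtain ⟨i, y, i', y', t, hd, hd', er, er', hi, hy, hh⟩ :=
    h.exists_lift (x₁ := 0) (x₂ := 0) (x₃ := 0) (by simpa using e)
  rw [← er] at hk hkm
  rw [← er'] at hk' ⊢
  rcases le_or_gt 0 t with ht | ht
  · have := height_anti hm hd (show i ≤ i' by omega) (show y ≤ y' by omega)
    unfold height at this
    omega
  · have := height_anti hl hd' (show i' ≤ i by omega) (show y' ≤ y by omega)
    unfold height at this
    omega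

end Nondegeneracy

/-! ### Removable boxes -/

section Boxes

lemma tuple_ext {n : ℕ} {l m : Tuple n} (h : ∀ r : Row n, l r.1 r.2 = m r.1 r.2) : l = m :=
  funext fun i => Finsupp.ext fun s => h (i, s)

/-- Removing a box from the row `r`, if there is one. -/
def subBox {n : ℕ} (l : Tuple n) (r : Row n) : Tuple n :=
  l - Pi.single r.1 (Finsupp.single r.2 1)

lemma subBox_apply {n : ℕ} (l : Tuple n) (r r' : Row n) :
    subBox l r r'.1 r'.2 = l r'.1 r'.2 - if r' = r then 1 else 0 := by
  obtain ⟨i, s⟩ := r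
  obtain ⟨i', s'⟩ := r'
  simp only [subBox, Pi.sub_apply, Finsupp.tsub_apply]
  congr 1
  by_cases h : i' = i
  · subst h
    rw [Pi.single_eq_same, Finsupp.single_apply]
    by_cases h' : s = s' <;> simp [h', eq_comm]
  · rw [Pi.single_eq_of_ne h]
    simp [h]

lemma addBox_subBox {n : ℕ} {l : Tuple n} {r : Row n} (h : 1 ≤ l r.1 r.2) :
    addBox (subBox l r) r.1 r.2 = l := by
  refine tuple_ext fun r' => ?_
  rw [addBox_apply, subBox_apply]
  split_ifs with h'
  · subst h'; omega
  · simp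

lemma subBox_addBox {n : ℕ} (l : Tuple n) (r : Row n) : subBox (addBox l r.1 r.2) r = l := by
  refine tuple_ext fun r' => ?_
  rw [subBox_apply, addBox_apply]
  split_ifs <;> simp

lemma addBox_comm {n : ℕ} (l : Tuple n) (r r' : Row n) :
    addBox (addBox l r.1 r.2) r'.1 r'.2 = addBox (addBox l r'.1 r'.2) r.1 r.2 := by
  refine tuple_ext fun x => ?_
  simp only [addBox_apply]; omega

lemma addBox_injective {n : ℕ} (l : Tuple n) {r r' : Row n}
    (h : addBox l r.1 r.2 = addBox l r'.1 r'.2) : r = r' := by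
  by_contra hc
  have := congrFun h r.1
  have := DFunLike.congr_fun this r.2
  rw [addBox_apply, addBox_apply, if_pos rfl, if_neg hc] at this
  omega

variable {n : ℕ} [NeZero n] {P : Params n} {a b : Fin n → ℕ}

/-- An inequality violated by `l` cannot be repaired by both of two boxes in different rows. -/
lemma isAdmissible_of_addBox {l : Tuple n} {c d : Row n} (hcd : c ≠ d)
    (hc : IsAdmissible a b (addBox l c.1 c.2)) (hd : IsAdmissible a b (addBox l d.1 d.2)) :
    IsAdmissible a b l := by
  rw [isAdmissible_iff] at *
  intro i y hy
  have h1 := hc i y hy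
  have h2 := hd i y hy
  simp only [height_addBox] at h1 h2
  by_cases e : toRow b i y = c
  · have : toRow b i y ≠ d := by rw [e]; exact hcd
    rw [if_neg this] at h2
    split_ifs at h1 h2 <;> omega
  · rw [if_neg e] at h1
    split_ifs at h1 h2 <;> omega

/-- Adding a box to one row does not block a box in another row. -/
lemma isAdmissible_addBox_addBox {l : Tuple n} {c d : Row n} (hcd : c ≠ d)
    (hc : IsAdmissible a b (addBox l c.1 c.2)) (hd : IsAdmissible a b (addBox l d.1 d.2)) :
    IsAdmissible a b (addBox (addBox l c.1 c.2) d.1 d.2) := by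
  rw [isAdmissible_iff] at *
  intro i y hy
  have h1 := hc i y hy
  have h2 := hd i y hy
  simp only [height_addBox] at h1 h2 ⊢
  constructor
  · by_cases e : toRow b i (y + 1) = c
    · have : toRow b i (y + 1) ≠ d := by rw [e]; exact hcd
      rw [if_neg this, if_pos e] at *
      split_ifs at h1 h2 ⊢ <;> omega
    · rw [if_neg e] at *
      split_ifs at h1 h2 ⊢ <;> omega
  · by_cases e : toRow b (i + 1) y = c
    · have : toRow b (i + 1) y ≠ d := by rw [e]; exact hcd
      rw [if_neg this, if_pos e] at *
      split_ifs at h1 h2 ⊢ <;> omega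
    · rw [if_neg e] at *
      split_ifs at h1 h2 ⊢ <;> omega

/-- Every non-empty admissible tuple has a removable box: a box at the end of its row is removable
if it maximizes a functional which is invariant under the period and increases in the directions
of `i` and `y`. -/
lemma Resonant.exists_removable (h : Resonant P a b) {l : Tuple n} (hl : IsAdmissible a b l)
    (hne : l ≠ 0) : ∃ r : Row n, 1 ≤ l r.1 r.2 ∧ IsAdmissible a b (subBox l r) := by
  classical
  have hn := n_pos (n := n)
  set S : ℤ := ∑ j, (a j : ℤ) + ∑ j, (b j : ℤ) with hS
  -- if `a` and `b` were both zero, i.e. `p = p' = n`, no functional would do, as the height could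
  -- be constant in `i`
  have hSpos : 0 < S := by
    have ha : (0 : ℤ) ≤ ∑ j, (a j : ℤ) := Finset.sum_nonneg fun i _ => by positivity
    have hb : (0 : ℤ) ≤ ∑ j, (b j : ℤ) := Finset.sum_nonneg fun i _ => by positivity
    have h1 := h.cast_sum_a
    have h2 := h.cast_sum_b
    have h3 : ((∑ i, (b i + 1) : ℕ) : ℤ) ≠ ((∑ i, (a i + 1) : ℕ) : ℤ) := by exact_mod_cast h.ne
    omega
  set F : ℤ → ℤ → ℤ := fun i y => n * (height a b l i y + y) + S * i with hF
  set F' : Row n → ℤ := fun r => F ((r.1 : ℕ) : ℤ) (base b ((r.1 : ℕ) : ℤ) + r.2) with hF'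
  -- `F` depends only on the row
  have inv : ∀ i y, base b i ≤ y → F i y = F' (toRow b i y) := by
    intro i y hd
    obtain ⟨κ, hκ⟩ := idx_eq_iff.1 (idx_coe (idx n i))
    have eb : base b i = base b ((idx n i : ℕ) : ℤ) - κ * ∑ t, (b t : ℤ) := by
      conv_lhs => rw [hκ]
      unfold base; rw [shift_add_mul]; ring
    have ea : shift a i = shift a ((idx n i : ℕ) : ℤ) + κ * ∑ t, (a t : ℤ) := by
      conv_lhs => rw [hκ]
      rw [shift_add_mul]
    have et : toRow b (((toRow b i y).1 : ℕ) : ℤ)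
        (base b (((toRow b i y).1 : ℕ) : ℤ) + (toRow b i y).2) = toRow b i y := toRow_lift b _
    simp only [hF', hF]
    unfold height
    rw [et]
    have e1 : (toRow b i y).1 = idx n i := rfl
    have e2 : ((toRow b i y).2 : ℤ) = y - base b i := by simp only [toRow]; omega
    rw [e2, e1, ea, eb]
    rw [hS]
    linear_combination (∑ j, (a j : ℤ) + ∑ j, (b j : ℤ)) * hκ
  set T : Finset (Row n) := Finset.univ.biUnion fun i => (l i).support.image fun s => (i, s)
    with hT
  have memT : ∀ r : Row n, r ∈ T ↔ 1 ≤ l r.1 r.2 := by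
    rintro ⟨i, s⟩
    simp only [hT, Finset.mem_biUnion, Finset.mem_univ, true_and, Finset.mem_image,
      Finsupp.mem_support_iff, Prod.mk.injEq]
    constructor
    · rintro ⟨i', s', h1, rfl, rfl⟩; omega
    · intro h1; exact ⟨i, s, by omega, rfl, rfl⟩
  have hTne : T.Nonempty := by
    by_contra hc
    rw [Finset.not_nonempty_iff_eq_empty] at hc
    refine hne (tuple_ext fun r => ?_)
    have := (memT r).not.1 (by rw [hc]; simp)
    simp only [Pi.zero_apply, Finsupp.coe_zero]
    omega
  obtain ⟨r, hr, hmax⟩ := Finset.exists_max_image T F' hTne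
  rw [memT] at hr
  refine ⟨r, hr, ?_⟩
  have hsub : ∀ i y, height a b (subBox l r) i y =
      height a b l i y - if toRow b i y = r then 1 else 0 := by
    intro i y
    have := height_addBox (a := a) (b := b) (subBox l r) r i y
    rw [addBox_subBox hr] at this
    omega
  rw [isAdmissible_iff]
  intro i y hd
  have hl' := (isAdmissible_iff l).1 hl i y hd
  have hdi := (base_succ_le b i).trans hd
  simp only [hsub]
  by_cases er : toRow b i y = r
  -- a neighbouring column of the same height would end in a box with a greater value of `F`
  · have step : ∀ i' y', base b i' ≤ y' → 1 ≤ l (toRow b i' y').1 (toRow b i' y').2 →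
        F i y < F i' y' → False := by
      intro i' y' hd' h1 h2
      have := hmax _ ((memT _).2 h1)
      rw [← inv i' y' hd', ← er, ← inv i y hd] at this
      omega
    have hr' := hr
    rw [← er] at hr'
    constructor
    · by_contra hc
      have heq : height a b l i (y + 1) = height a b l i y := by
        rw [if_pos er] at hc; split_ifs at hc <;> omega
      refine step i (y + 1) (by omega) ?_ ?_
      · unfold height at heq; omega
      · simp only [hF, heq]; nlinarith
    · by_contra hc
      have heq : height a b l (i + 1) y = height a b l i y := by
        rw [if_pos er] at hc; split_ifs at hc <;> omega
      refine step (i + 1) y (by omega) ?_ ?_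
      · unfold height at heq; rw [shift_succ] at heq; omega
      · simp only [hF, heq]; nlinarith
  · rw [if_neg er]
    constructor <;> split_ifs <;> omega

end Boxes

/-! ### Identities for row factors -/

section PhiIdentities

/-- The value of the cubic polynomial `g`. -/
def gPoly (q₁ q₂ q₃ z w : ℂ) : ℂ := (z - q₁ * w) * (z - q₂ * w) * (z - q₃ * w)

/-- The effect of a new box on the contribution of a row. -/
lemma phi_smul_mul {K : Type*} [Field K] [Algebra ℂ K] {q₁ q₂ q₃ : ℂ} (h : q₁ * q₂ * q₃ = 1)
    {y : K} (h1 : 1 - q₁ • y ≠ 0) (h2 : 1 - q₁⁻¹ • y ≠ 0) :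
    phi q₁ q₂ q₃ (q₁ • y) * ((1 - q₁ • y) * (1 - q₂ • y) * (1 - q₃ • y)) =
      phi q₁ q₂ q₃ y * ((1 - q₁⁻¹ • y) * (1 - q₂⁻¹ • y) * (1 - q₃⁻¹ • y)) := by
  have a1 := ne_zero_of_mul₁ h
  have a2 := ne_zero_of_mul₂ h
  have a3 := ne_zero_of_mul₃ h
  have e2 : q₂⁻¹ = q₃ * q₁ := by field_simp; linear_combination -h
  have e3 : q₃⁻¹ = q₂ * q₁ := by field_simp; linear_combination -h
  unfold phi
  rw [e2, e3, smul_smul, smul_smul, smul_smul, inv_mul_cancel₀ a1, one_smul]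
  generalize q₁⁻¹ • y = w at h2 ⊢
  by_cases h0 : 1 - y = 0
  · simp [h0]
  · field_simp

/-- The contributions of two rows to each other's coefficients agree: this is what makes the
operators `e_i` and `f_j` commute off the diagonal. -/
lemma phi_unitary {q₁ q₂ q₃ : ℂ} (h : q₁ * q₂ * q₃ = 1) {x : ℂ} (hx : x ≠ 0) :
    phi q₁ q₂ q₃ (q₁ * x⁻¹) = phi q₁ q₂ q₃ x := by
  have a1 := ne_zero_of_mul₁ h
  unfold phi
  simp only [smul_eq_mul]
  rw [inv_mul_cancel_left₀ a1]
  have e1 : (1 - q₃ * (q₁ * x⁻¹)) * (1 - q₂ * (q₁ * x⁻¹)) =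
      (1 - q₃ * x) * (1 - q₂ * x) * (q₁ * x⁻¹ ^ 2) := by
    field_simp
    linear_combination (q₁ - x ^ 2) * h
  have e2 : (1 - q₁ * x⁻¹) * (1 - x⁻¹) = (1 - x) * (1 - q₁⁻¹ * x) * (q₁ * x⁻¹ ^ 2) := by
    field_simp
    ring
  rw [e1, e2, mul_div_mul_right]
  exact mul_ne_zero a1 (pow_ne_zero _ (inv_ne_zero hx))

end PhiIdentities

/-! ### Exchange relations for the matrix coefficients -/

section Exchange

variable {n : ℕ} {P : Params n} {R : Row n → Row n → Prop}

/-- An asymmetric relation which holds between any two different rows in one direction. -/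
structure TotalRel (R : Row n → Row n → Prop) : Prop where
  irrefl : ∀ r, ¬ R r r
  total : ∀ r r', r ≠ r' → (R r r' ↔ ¬ R r' r)

/-- The reverse of the lexicographic order on rows. -/
def rowGt (r' r : Row n) : Prop := rowLt r r'

lemma totalRel_rowLt : TotalRel (rowLt (n := n)) := by
  constructor
  · intro r; unfold rowLt; omega
  · rintro ⟨i, s⟩ ⟨i', s'⟩ hne
    have : i ≠ i' ∨ s ≠ s' := by
      by_contra hc; push Not at hc; exact hne (by rw [hc.1, hc.2])
    unfold rowLt
    simp only
    omega

lemma totalRel_rowGt : TotalRel (rowGt (n := n)) :=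
  ⟨fun r => totalRel_rowLt.irrefl r, fun r r' h => totalRel_rowLt.total r' r h.symm⟩

open scoped Classical in
/-- The contribution of the row `d` to the coefficient of the row `c`. -/
def theta (R : Row n → Row n → Prop) (P : Params n) (d c : Row n) (x : ℂ) : ℂ :=
  if R d c then phi P.1 P.2.1 P.2.2.1 x else 1

open scoped Classical in
/-- The contribution of the rows outside of `D` to `coefN R N P l c`, where `v` is the point of
`c`. -/
def coefRest (R : Row n → Row n → Prop) (N : ℕ) (P : Params n) (l : Tuple n) (D : Finset (Row n))
    (c : Row n) (v : ℂ) : ℂ :=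
  (∏ j with R (j, N) c, psiEmpty P.2.1 (pt P l (j, N) / v)) *
    ∏ r' ∈ rows n N with R r' c ∧ r' ∉ D, phi P.1 P.2.1 P.2.2.1 (pt P l r' / v)

/-- The coefficient with the contributions of the rows in `D` split off. -/
lemma coefN_eq {N : ℕ} {D : Finset (Row n)} (hD : D ⊆ rows n N) (l : Tuple n) (c : Row n) :
    coefN R N P l c =
      coefRest R N P l D c (pt P l c) * ∏ d ∈ D, theta R P d c (pt P l d / pt P l c) := by
  classical
  unfold coefN coefRest theta
  rw [mul_assoc]
  congr 1
  have e1 : ((rows n N).filter fun r' => R r' c ∧ r' ∉ D) =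
      ((rows n N).filter fun r' => R r' c) \ D.filter fun r' => R r' c := by
    ext r
    simp only [Finset.mem_filter, Finset.mem_sdiff]
    tauto
  rw [← Finset.prod_filter, e1, Finset.prod_sdiff (Finset.filter_subset_filter _ hD)]

lemma coefRest_congr {N : ℕ} {D : Finset (Row n)} (hD : D ⊆ rows n N) {l l' : Tuple n}
    (hl : ∀ r : Row n, r ∉ D → l r.1 r.2 = l' r.1 r.2) (c : Row n) (v : ℂ) :
    coefRest R N P l D c v = coefRest R N P l' D c v := by
  have e : ∀ r, r ∉ D → pt P l r = pt P l' r := fun r hr => by rw [pt_eq, pt_eq, hl r hr]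
  unfold coefRest
  congr 1
  · refine Finset.prod_congr rfl fun j _ => ?_
    rw [e _ fun hc => by simpa using hD hc]
  · refine Finset.prod_congr rfl fun r hr => ?_
    simp only [Finset.mem_filter] at hr
    rw [e r hr.2.2]

lemma pt_addBox_of_ne (l : Tuple n) {r r' : Row n} (h : r' ≠ r) :
    pt P (addBox l r.1 r.2) r' = pt P l r' := by
  rw [pt_eq, pt_eq, addBox_apply, if_neg h, add_zero]

lemma pt_addBox_self (l : Tuple n) (r : Row n) :
    pt P (addBox l r.1 r.2) r = P.1 * pt P l r := by
  rw [pt_eq, pt_eq, addBox_apply, if_pos rfl, pow_succ]; ring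

/-- The contributions of the rows `c` and `d` to each other, if first `c` and then `d` is
increased, starting from the points `x` of `c` and `y` of `d`. -/
def sigma (R : Row n → Row n → Prop) (P : Params n) (c d : Row n) (x y : ℂ) : ℂ :=
  theta R P d c (y / x) * theta R P c d (P.1 * x / y)

/-- The exchange relation: up to an antisymmetric factor, the contribution is `g`. -/
lemma exists_sigma_eq (hR : TotalRel R) (h : P.1 * P.2.1 * P.2.2.1 = 1) {c d : Row n}
    (hcd : c ≠ d) {x y : ℂ} (hx : x ≠ 0) (hy : y ≠ 0) (hxy : x ≠ y) (hxy' : x ≠ P.1 * y)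
    (hyx : y ≠ P.1 * x) :
    ∃ κ : ℂ, sigma R P c d x y = κ * gPoly P.1 P.2.1 P.2.2.1 x y ∧
      sigma R P d c y x = -κ * gPoly P.1 P.2.1 P.2.2.1 y x := by
  obtain ⟨q₁, q₂, q₃, u⟩ := P
  simp only at *
  have a1 := ne_zero_of_mul₁ h
  -- the denominators of the two contributions agree up to sign, the numerators are values of `g`
  have key : ∀ x y : ℂ, x ≠ 0 → y ≠ 0 → x ≠ y → x ≠ q₁ * y → y ≠ q₁ * x →
      ∃ κ : ℂ, phi q₁ q₂ q₃ (q₁ * x / y) = κ * gPoly q₁ q₂ q₃ x y ∧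
        phi q₁ q₂ q₃ (x / y) = -κ * gPoly q₁ q₂ q₃ y x := by
    intro x y hx hy hxy hxy' hyx
    have b1 : y - x ≠ 0 := sub_ne_zero.2 hxy.symm
    have b2 : q₁ * y - x ≠ 0 := sub_ne_zero.2 hxy'.symm
    have b3 : y - q₁ * x ≠ 0 := sub_ne_zero.2 hyx
    have e3 : q₃ = (q₁ * q₂)⁻¹ := by
      have := ne_zero_of_mul₂ h
      field_simp; linear_combination h
    have a2 := ne_zero_of_mul₂ h
    refine ⟨-q₁ / ((y - x) * (q₁ * y - x) * (y - q₁ * x)), ?_, ?_⟩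
    · unfold phi gPoly
      simp only [smul_eq_mul]
      have c1 : 1 - q₁ * x / y = (y - q₁ * x) / y := by field_simp
      have c2 : 1 - q₁⁻¹ * (q₁ * x / y) = (y - x) / y := by field_simp
      rw [c1, c2, e3]
      field_simp
      ring
    · unfold phi gPoly
      simp only [smul_eq_mul]
      have c1 : 1 - x / y = (y - x) / y := by field_simp
      have c2 : 1 - q₁⁻¹ * (x / y) = (q₁ * y - x) / (q₁ * y) := by field_simp
      rw [c1, c2, e3]
      field_simp
  unfold sigma theta
  simp only
  by_cases hc : R c d
  · have hd : ¬ R d c := (hR.total _ _ hcd).1 hc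
    obtain ⟨κ, h1, h2⟩ := key x y hx hy hxy hxy' hyx
    exact ⟨κ, by rw [if_neg hd, if_pos hc, h1, one_mul], by rw [if_neg hd, if_pos hc, h2, mul_one]⟩
  · have hd : R d c := (hR.total _ _ hcd.symm).2 hc
    obtain ⟨κ, h1, h2⟩ := key y x hy hx hxy.symm hyx hxy'
    exact ⟨-κ, by rw [if_neg hc, if_pos hd, h2, mul_one], by
      rw [if_neg hc, if_pos hd, h1, one_mul, neg_neg]⟩

/-- Raising the row `d` and then the row `c`, the coefficients for `R` and for the reverse relation
are exchanged. -/
lemma coefN_mul_coefN_exchange (h : P.1 * P.2.1 * P.2.2.1 = 1) (hu : ∀ i, P.2.2.2 i ≠ 0)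
    {N : ℕ} (l : Tuple n) {c d : Row n} (hcd : c ≠ d) (hc : c.2 < N) (hd : d.2 < N) :
    coefN rowLt N P (addBox l d.1 d.2) c * coefN rowGt N P (addBox l c.1 c.2) d =
      coefN rowLt N P l c * coefN rowGt N P l d := by
  classical
  have hD : ({c, d} : Finset (Row n)) ⊆ rows n N := by
    intro r hr
    simp only [Finset.mem_insert, Finset.mem_singleton] at hr
    rcases hr with rfl | rfl <;> simpa
  have r1 := coefRest_congr (R := rowLt) (P := P) hD (l := addBox l d.1 d.2) (l' := l)
    (fun r hr => by
      simp only [Finset.mem_insert, Finset.mem_singleton, not_or] at hr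
      rw [addBox_apply, if_neg hr.2, add_zero])
  have r2 := coefRest_congr (R := rowGt) (P := P) hD (l := addBox l c.1 c.2) (l' := l)
    (fun r hr => by
      simp only [Finset.mem_insert, Finset.mem_singleton, not_or] at hr
      rw [addBox_apply, if_neg hr.1, add_zero])
  have hxc := pt_ne_zero h hu l c
  have hxd := pt_ne_zero h hu l d
  simp only [coefN_eq hD, Finset.prod_pair hcd, r1, r2, pt_addBox_of_ne l hcd,
    pt_addBox_of_ne l hcd.symm, pt_addBox_self]
  have irr : ∀ r x, theta rowLt P r r x = 1 ∧ theta rowGt P r r x = 1 := fun r x =>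
    ⟨if_neg (totalRel_rowLt.irrefl r), if_neg (totalRel_rowGt.irrefl r)⟩
  simp only [(irr _ _).1, (irr _ _).2]
  have key : theta rowLt P d c (P.1 * pt P l d / pt P l c) *
      theta rowGt P c d (P.1 * pt P l c / pt P l d) =
      theta rowLt P d c (pt P l d / pt P l c) * theta rowGt P c d (pt P l c / pt P l d) := by
    unfold theta rowGt
    split_ifs
    · rw [mul_div_assoc, mul_div_assoc]
      have e1 := phi_unitary h (div_ne_zero hxc hxd)
      have e2 := phi_unitary h (div_ne_zero hxd hxc)
      rw [inv_div] at e1 e2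
      rw [e1, e2, mul_comm]
    · rfl
  linear_combination (coefRest rowLt N P l {c, d} c (pt P l c) *
    coefRest rowGt N P l {c, d} d (pt P l d)) * key

end Exchange

section StepCoef

lemma exists_suppLE {n : ℕ} (l : Tuple n) (S : Finset (Row n)) :
    ∃ N, SuppLE l N ∧ ∀ r ∈ S, r.2 < N := by
  classical
  refine ⟨((Finset.univ.biUnion fun i => (l i).support) ∪ S.image Prod.snd).sup id + 1, ?_, ?_⟩
  · intro i j hj
    by_contra hc
    have : j ∈ (Finset.univ.biUnion fun i => (l i).support) ∪ S.image Prod.snd := by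
      simp only [Finset.mem_union, Finset.mem_biUnion, Finset.mem_univ, true_and,
        Finsupp.mem_support_iff]
      exact .inl ⟨i, hc⟩
    have := Finset.le_sup (f := id) this
    simp only [id] at this
    omega
  · intro r hr
    have : r.2 ∈ (Finset.univ.biUnion fun i => (l i).support) ∪ S.image Prod.snd :=
      Finset.mem_union_right _ (Finset.mem_image_of_mem _ hr)
    have := Finset.le_sup (f := id) this
    simp only [id] at this
    omega

lemma SuppLE.addBox {n : ℕ} {l : Tuple n} {N : ℕ} (hl : SuppLE l N) {r : Row n} (hr : r.2 < N) :
    SuppLE (addBox l r.1 r.2) N := by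
  intro i j hj
  have := addBox_apply l r (i, j)
  rw [if_neg (by intro hc; rw [← hc] at hr; simp only at hr; omega), hl i j hj] at this
  exact this

variable {n : ℕ} [NeZero n] {P : Params n} {R : Row n → Row n → Prop} {a b : Fin n → ℕ}
  {C : ℂ} {G : Tuple n → Row n → ℂ}

/-- `G l r` is `C` times the coefficient for adding a box to the row `r` of the tuple `l`, if both
tuples are admissible, and `0` otherwise. -/
structure IsStepCoef (P : Params n) (a b : Fin n → ℕ) (R : Row n → Row n → Prop) (C : ℂ)
    (G : Tuple n → Row n → ℂ) : Prop where
  eq : ∀ l r N, IsAdmissible a b l → IsAdmissible a b (addBox l r.1 r.2) → SuppLE l N → r.2 < N →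
    G l r = C * coefN R N P l r
  zero : ∀ l r, ¬ (IsAdmissible a b l ∧ IsAdmissible a b (addBox l r.1 r.2)) → G l r = 0

lemma gPoly_eq_zero₁ (q₁ q₂ q₃ v : ℂ) : gPoly q₁ q₂ q₃ (q₁ * v) v = 0 := by simp [gPoly]
lemma gPoly_eq_zero₂ (q₁ q₂ q₃ v : ℂ) : gPoly q₁ q₂ q₃ (q₂ * v) v = 0 := by simp [gPoly]
lemma gPoly_eq_zero₃ (q₁ q₂ q₃ v : ℂ) : gPoly q₁ q₂ q₃ (q₃ * v) v = 0 := by simp [gPoly]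

/-- If `d` can be added only after `c`, then the points of `c` and `d` are proportional with the
factor `q₂` or `q₃`, and `g` vanishes. -/
lemma Resonant.gPoly_eq_zero_of_blocked (h : Resonant P a b) {l : Tuple n} {c d : Row n}
    (hl : IsAdmissible a b l) (hcd : c ≠ d)
    (hm : IsAdmissible a b (addBox (addBox l c.1 c.2) d.1 d.2))
    (hk : ¬ IsAdmissible a b (addBox l d.1 d.2)) :
    gPoly P.1 P.2.1 P.2.2.1 (pt P l d) (pt P l c) = 0 := by
  obtain ⟨c', d', h1, h2, h3, h4⟩ := h.exists_blocked hl hm hk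
    (fun r => by rw [addBox_apply]; omega) (fun r => by simp only [addBox_apply]; omega)
    (fun r => by rw [addBox_apply]; split_ifs <;> omega)
  simp only [addBox_apply] at h1 h2 h3
  have hd : d' = d := by by_contra hc; rw [if_neg hc] at h1; omega
  have hc : c' = c := by
    by_contra hc
    rw [if_neg hc] at h3
    split_ifs at h2 h3 <;> omega
  subst hd hc
  rcases h4 with h4 | h4 <;> rw [h4]
  · exact gPoly_eq_zero₂ _ _ _ _
  · exact gPoly_eq_zero₃ _ _ _ _

/-- The quadratic relation for boxes in different rows. -/
lemma IsStepCoef.exchange (hG : IsStepCoef P a b R C G) (hR : TotalRel R) (h : Resonant P a b)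
    (l : Tuple n) {c d : Row n} (hcd : c ≠ d) :
    gPoly P.1 P.2.1 P.2.2.1 (pt P l c) (pt P l d) * (G l d * G (addBox l d.1 d.2) c) =
      -gPoly P.1 P.2.1 P.2.2.1 (pt P l d) (pt P l c) * (G l c * G (addBox l c.1 c.2) d) := by
  classical
  by_cases hl : IsAdmissible a b l
  swap
  · rw [hG.zero l d (fun hc => hl hc.1), hG.zero l c (fun hc => hl hc.1)]; ring
  by_cases hm : IsAdmissible a b (addBox (addBox l c.1 c.2) d.1 d.2)
  swap
  · rw [hG.zero (addBox l d.1 d.2) c (fun hc => hm (by rw [addBox_comm]; exact hc.2)),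
      hG.zero (addBox l c.1 c.2) d (fun hc => hm hc.2)]
    ring
  have hm' : IsAdmissible a b (addBox (addBox l d.1 d.2) c.1 c.2) := by rwa [addBox_comm]
  -- an intermediate tuple which is not admissible has coefficient zero on one side, and a zero of
  -- `g` on the other
  by_cases hc : IsAdmissible a b (addBox l c.1 c.2)
  swap
  · rw [h.gPoly_eq_zero_of_blocked hl hcd.symm hm' hc, hG.zero l c fun h => hc h.2]; ring
  by_cases hd : IsAdmissible a b (addBox l d.1 d.2)
  swap
  · rw [h.gPoly_eq_zero_of_blocked hl hcd hm hd, hG.zero l d fun h => hd h.2]; ring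
  obtain ⟨N, hlN, hN⟩ := exists_suppLE l {c, d}
  have hcN : c.2 < N := hN c (by simp)
  have hdN : d.2 < N := hN d (by simp)
  rw [hG.eq l d N hl hd hlN hdN, hG.eq l c N hl hc hlN hcN,
    hG.eq (addBox l d.1 d.2) c N hd hm' (hlN.addBox hdN) hcN,
    hG.eq (addBox l c.1 c.2) d N hc hm (hlN.addBox hcN) hdN]
  have hD : ({c, d} : Finset (Row n)) ⊆ rows n N := by
    intro r hr
    simp only [Finset.mem_insert, Finset.mem_singleton] at hr
    rcases hr with rfl | rfl <;> simpa
  have r1 := coefRest_congr (R := R) (P := P) hD (l := addBox l d.1 d.2) (l' := l)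
    (fun r hr => by
      simp only [Finset.mem_insert, Finset.mem_singleton, not_or] at hr
      rw [addBox_apply, if_neg hr.2, add_zero])
  have r2 := coefRest_congr (R := R) (P := P) hD (l := addBox l c.1 c.2) (l' := l)
    (fun r hr => by
      simp only [Finset.mem_insert, Finset.mem_singleton, not_or] at hr
      rw [addBox_apply, if_neg hr.1, add_zero])
  simp only [coefN_eq hD, Finset.prod_pair hcd, r1, r2, pt_addBox_of_ne l hcd,
    pt_addBox_of_ne l hcd.symm, pt_addBox_self]
  have irr : ∀ r x, theta R P r r x = 1 := fun r x => if_neg (hR.irrefl r)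
  simp only [irr]
  obtain ⟨κ, k1, k2⟩ := exists_sigma_eq hR h.mul_eq hcd (pt_ne_zero h.mul_eq h.u_ne l c)
    (pt_ne_zero h.mul_eq h.u_ne l d) (h.pt_ne hl hcd)
    (h.pt_ne_q₁_mul_pt hl (growable_of_isAdmissible hd) c)
    (h.pt_ne_q₁_mul_pt hl (growable_of_isAdmissible hc) d)
  have key : gPoly P.1 P.2.1 P.2.2.1 (pt P l c) (pt P l d) * sigma R P d c (pt P l d) (pt P l c) =
      -gPoly P.1 P.2.1 P.2.2.1 (pt P l d) (pt P l c) *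
        sigma R P c d (pt P l c) (pt P l d) := by
    rw [k1, k2]; ring
  unfold sigma at key
  linear_combination (C ^ 2 * coefRest R N P l {c, d} c (pt P l c) *
    coefRest R N P l {c, d} d (pt P l d)) * key

end StepCoef

/-! ### The cubic relation -/

section Cubic

variable {n : ℕ} [NeZero n] {P : Params n} {R : Row n → Row n → Prop} {a b : Fin n → ℕ}
  {C : ℂ} {G : Tuple n → Row n → ℂ}

/-- The factor by which adding boxes at `p₁`, `p₂`, `p₃`, in this order, is weighted in
`[e₀, [e₁, e₋₁]]`. -/
def serreWeight (p₁ p₂ p₃ : ℂ) : ℂ := p₂ / p₁ - p₁ / p₂ - p₃ / p₂ + p₂ / p₃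

set_option maxRecDepth 20000 in
/-- The alternating sum behind the cubic relation. -/
lemma serreWeight_identity {q₁ q₂ q₃ : ℂ} (h : q₁ * q₂ * q₃ = 1) {x y z : ℂ} (hx : x ≠ 0)
    (hy : y ≠ 0) (hz : z ≠ 0) :
    let g := gPoly q₁ q₂ q₃
    g x y * g x z * g y z * serreWeight x y z - g x z * g x y * g z y * serreWeight x z y -
      g y x * g y z * g x z * serreWeight y x z + g y z * g y x * g z x * serreWeight y z x +
      g z x * g z y * g x y * serreWeight z x y - g z y * g z x * g y x * serreWeight z y x = 0 := by
  intro g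
  -- a polynomial identity in `x`, `y`, `z` and the elementary symmetric functions of the `q_i`
  have hg : ∀ z w, g z w =
      z ^ 3 - (q₁ + q₂ + q₃) * z ^ 2 * w + (q₁ * q₂ + q₁ * q₃ + q₂ * q₃) * z * w ^ 2 -
        w ^ 3 := fun z w => by
    simp only [g, gPoly]; linear_combination (-w ^ 3) * h
  clear_value g
  have hK : ∀ a b c : ℂ, a ≠ 0 → b ≠ 0 → c ≠ 0 → x * y * z = a * b * c → serreWeight a b c =
      ((b ^ 2 - a ^ 2) * c + (b ^ 2 - c ^ 2) * a) * (x * y * z)⁻¹ := by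
    intro a b c ha hb hc e
    rw [e]
    unfold serreWeight
    field_simp
    ring
  rw [hK x y z hx hy hz rfl, hK x z y hx hz hy (by ring), hK y x z hy hx hz (by ring),
    hK y z x hy hz hx (by ring), hK z x y hz hx hy (by ring), hK z y x hz hy hx (by ring)]
  generalize (x * y * z)⁻¹ = t
  rw [hg x y, hg x z, hg y z, hg y x, hg z x, hg z y]
  generalize q₁ + q₂ + q₃ = s₁
  generalize q₁ * q₂ + q₁ * q₃ + q₂ * q₃ = s₂
  ring

/-- Three boxes in different rows, added in a fixed order: by the exchange relation, the product of
the coefficients is a product of values of `g` up to a factor whose dependence on the order is only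
by the signs of the antisymmetric `κ`. -/
lemma IsStepCoef.chain_eq (hG : IsStepCoef P a b R C G) (hR : TotalRel R) (h : Resonant P a b)
    {l : Tuple n} {r₁ r₂ r₃ : Row n} (h12 : r₁ ≠ r₂) (h13 : r₁ ≠ r₃) (h23 : r₂ ≠ r₃)
    (hl : IsAdmissible a b l)
    (hm : IsAdmissible a b (addBox (addBox (addBox l r₁.1 r₁.2) r₂.1 r₂.2) r₃.1 r₃.2))
    {N : ℕ} (hlN : SuppLE l N) {D : Finset (Row n)} (hD : D ⊆ rows n N)
    (hprod : ∀ f : Row n → ℂ, ∏ d ∈ D, f d = f r₁ * f r₂ * f r₃) (hmem : r₁ ∈ D ∧ r₂ ∈ D ∧ r₃ ∈ D)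
    {κ₁₂ κ₁₃ κ₂₃ : ℂ}
    (k12 : sigma R P r₁ r₂ (pt P l r₁) (pt P l r₂) =
      κ₁₂ * gPoly P.1 P.2.1 P.2.2.1 (pt P l r₁) (pt P l r₂))
    (k13 : sigma R P r₁ r₃ (pt P l r₁) (pt P l r₃) =
      κ₁₃ * gPoly P.1 P.2.1 P.2.2.1 (pt P l r₁) (pt P l r₃))
    (k23 : sigma R P r₂ r₃ (pt P l r₂) (pt P l r₃) =
      κ₂₃ * gPoly P.1 P.2.1 P.2.2.1 (pt P l r₂) (pt P l r₃)) :
    G l r₁ * G (addBox l r₁.1 r₁.2) r₂ * G (addBox (addBox l r₁.1 r₁.2) r₂.1 r₂.2) r₃ =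
      (C ^ 3 * (∏ d ∈ D, coefRest R N P l D d (pt P l d)) * (κ₁₂ * κ₁₃ * κ₂₃)) *
        (gPoly P.1 P.2.1 P.2.2.1 (pt P l r₁) (pt P l r₂) *
          gPoly P.1 P.2.1 P.2.2.1 (pt P l r₁) (pt P l r₃) *
          gPoly P.1 P.2.1 P.2.2.1 (pt P l r₂) (pt P l r₃)) := by
  have hN : ∀ r ∈ D, r.2 < N := fun r hr => by simpa using hD hr
  -- if an intermediate tuple is not admissible, then the left hand side vanishes by definition, and
  -- the right hand side by a zero of `g` at the blocking box
  by_cases h1 : IsAdmissible a b (addBox l r₁.1 r₁.2)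
  swap
  · rw [hG.zero l r₁ fun h => h1 h.2]
    obtain ⟨c, d, e1, e2, e3, e4⟩ := h.exists_blocked hl hm h1
      (fun r => by rw [addBox_apply]; omega) (fun r => by simp only [addBox_apply]; omega)
      (fun r => by rw [addBox_apply]; split_ifs <;> omega)
    simp only [addBox_apply] at e1 e2 e3
    have hd : d = r₁ := by by_contra hc; rw [if_neg hc] at e1; omega
    subst hd
    have hc : c = r₂ ∨ c = r₃ := by
      by_contra hc
      push Not at hc
      rw [if_neg hc.1, if_neg hc.2] at e3
      split_ifs at e3 <;> omega
    have hz : gPoly P.1 P.2.1 P.2.2.1 (pt P l d) (pt P l c) = 0 := by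
      rcases e4 with e4 | e4 <;> rw [e4]
      · exact gPoly_eq_zero₂ _ _ _ _
      · exact gPoly_eq_zero₃ _ _ _ _
    rcases hc with rfl | rfl <;> rw [hz] <;> ring
  by_cases h2 : IsAdmissible a b (addBox (addBox l r₁.1 r₁.2) r₂.1 r₂.2)
  swap
  · rw [hG.zero _ r₂ fun h => h2 h.2]
    obtain ⟨c, d, e1, e2, e3, e4⟩ := h.exists_blocked hl hm h2
      (fun r => by simp only [addBox_apply]; omega) (fun r => by simp only [addBox_apply]; omega)
      (fun r => by
        simp only [addBox_apply]
        by_cases hr : r = r₁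
        · rw [if_pos hr, if_neg (by rw [hr]; exact h12)]
        · rw [if_neg hr]; split_ifs <;> omega)
    simp only [addBox_apply] at e1 e2 e3
    have hc : c = r₃ := by
      by_contra hc
      rw [if_neg hc] at e3
      split_ifs at e3 <;> omega
    subst hc
    have hd : d = r₁ ∨ d = r₂ := by
      by_contra hd
      push Not at hd
      rw [if_neg hd.1, if_neg hd.2] at e1
      omega
    have hz : gPoly P.1 P.2.1 P.2.2.1 (pt P l d) (pt P l c) = 0 := by
      rcases e4 with e4 | e4 <;> rw [e4]
      · exact gPoly_eq_zero₂ _ _ _ _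
      · exact gPoly_eq_zero₃ _ _ _ _
    rcases hd with rfl | rfl <;> rw [hz] <;> ring
  have n1 := hN _ hmem.1
  have n2 := hN _ hmem.2.1
  have n3 := hN _ hmem.2.2
  rw [hG.eq l r₁ N hl h1 hlN n1, hG.eq _ r₂ N h1 h2 (hlN.addBox n1) n2,
    hG.eq _ r₃ N h2 hm ((hlN.addBox n1).addBox n2) n3]
  have hrest : ∀ l' : Tuple n, (∀ r : Row n, r ∉ D → l' r.1 r.2 = l r.1 r.2) → ∀ c v,
      coefRest R N P l' D c v = coefRest R N P l D c v := fun l' hl' c v =>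
    coefRest_congr hD hl' c v
  have m1 : ∀ r, r ∉ D → r ≠ r₁ := fun r hr hc => hr (hc ▸ hmem.1)
  have m2 : ∀ r, r ∉ D → r ≠ r₂ := fun r hr hc => hr (hc ▸ hmem.2.1)
  have s1 := hrest (addBox l r₁.1 r₁.2) (fun r hr => by
    simp only [addBox_apply, if_neg (m1 r hr), add_zero])
  have s2 := hrest (addBox (addBox l r₁.1 r₁.2) r₂.1 r₂.2) (fun r hr => by
    simp only [addBox_apply, if_neg (m1 r hr), if_neg (m2 r hr), add_zero])
  have irr : ∀ r x, theta R P r r x = 1 := fun r x => if_neg (hR.irrefl r)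
  simp only [coefN_eq hD, hprod, s1, s2, pt_addBox_self, pt_addBox_of_ne _ h12,
    pt_addBox_of_ne _ h12.symm, pt_addBox_of_ne _ h13.symm, pt_addBox_of_ne _ h23.symm, irr]
  unfold sigma at k12 k13 k23
  rw [show ∀ A B E : ℂ, (C ^ 3 * A * B) * E = C ^ 3 * A * (B * E) by intros; ring]
  rw [show κ₁₂ * κ₁₃ * κ₂₃ * (gPoly P.1 P.2.1 P.2.2.1 (pt P l r₁) (pt P l r₂) *
          gPoly P.1 P.2.1 P.2.2.1 (pt P l r₁) (pt P l r₃) *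
          gPoly P.1 P.2.1 P.2.2.1 (pt P l r₂) (pt P l r₃)) =
    (κ₁₂ * gPoly P.1 P.2.1 P.2.2.1 (pt P l r₁) (pt P l r₂)) *
          (κ₁₃ * gPoly P.1 P.2.1 P.2.2.1 (pt P l r₁) (pt P l r₃)) *
          (κ₂₃ * gPoly P.1 P.2.1 P.2.2.1 (pt P l r₂) (pt P l r₃)) by ring,
    ← k12, ← k13, ← k23]
  ring

/-- The summand of `[e₀, [e₁, e₋₁]]` for boxes added to `r₁`, `r₂`, `r₃` in this order. -/
def serreTerm (P : Params n) (G : Tuple n → Row n → ℂ) (l : Tuple n) (r₁ r₂ r₃ : Row n) : ℂ :=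
  G l r₁ * G (addBox l r₁.1 r₁.2) r₂ * G (addBox (addBox l r₁.1 r₁.2) r₂.1 r₂.2) r₃ *
    serreWeight (pt P l r₁) (pt P (addBox l r₁.1 r₁.2) r₂)
      (pt P (addBox (addBox l r₁.1 r₁.2) r₂.1 r₂.2) r₃)

/-- The cubic relation for boxes in three different rows follows from `serreWeight_identity`. -/
lemma IsStepCoef.serre_of_ne (hG : IsStepCoef P a b R C G) (hR : TotalRel R) (h : Resonant P a b)
    (l : Tuple n) {r₁ r₂ r₃ : Row n} (h12 : r₁ ≠ r₂) (h13 : r₁ ≠ r₃) (h23 : r₂ ≠ r₃) :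
    serreTerm P G l r₁ r₂ r₃ + serreTerm P G l r₁ r₃ r₂ + serreTerm P G l r₂ r₁ r₃ +
      serreTerm P G l r₂ r₃ r₁ + serreTerm P G l r₃ r₁ r₂ + serreTerm P G l r₃ r₂ r₁ = 0 := by
  classical
  have comm : ∀ x y z : Row n, addBox (addBox (addBox l x.1 x.2) y.1 y.2) z.1 z.2 =
      addBox (addBox (addBox l y.1 y.2) x.1 x.2) z.1 z.2 ∧
      addBox (addBox (addBox l x.1 x.2) y.1 y.2) z.1 z.2 =
      addBox (addBox (addBox l x.1 x.2) z.1 z.2) y.1 y.2 := by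
    intro x y z
    exact ⟨by rw [addBox_comm l], by rw [addBox_comm]⟩
  set m := addBox (addBox (addBox l r₁.1 r₁.2) r₂.1 r₂.2) r₃.1 r₃.2 with hmdef
  have c132 := (comm r₁ r₂ r₃).2
  have c213 := (comm r₁ r₂ r₃).1
  have c231 := (comm r₂ r₁ r₃).2
  have c312 := (comm r₁ r₃ r₂).1
  have c321 := (comm r₂ r₃ r₁).1
  by_cases hlm : IsAdmissible a b l ∧ IsAdmissible a b m
  swap
  · have z : ∀ x y z : Row n, addBox (addBox (addBox l x.1 x.2) y.1 y.2) z.1 z.2 = m →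
        serreTerm P G l x y z = 0 := by
      intro x y z e
      unfold serreTerm
      by_cases hl : IsAdmissible a b l
      · rw [hG.zero (addBox (addBox l x.1 x.2) y.1 y.2) z fun hc => hlm ⟨hl, e ▸ hc.2⟩]; ring
      · rw [hG.zero l x fun hc => hl hc.1]; ring
    rw [z r₁ r₂ r₃ rfl, z r₁ r₃ r₂ c132.symm, z r₂ r₁ r₃ c213.symm,
      z r₂ r₃ r₁ (by rw [← c231, ← c213]), z r₃ r₁ r₂ (by rw [← c312, ← c132]),
      z r₃ r₂ r₁ (by rw [← c321, ← c231, ← c213])]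
    ring
  obtain ⟨hl, hm⟩ := hlm
  set D : Finset (Row n) := {r₁, r₂, r₃} with hDdef
  have hcard : D.card ≤ 3 := Finset.card_le_three
  have hmem : r₁ ∈ D ∧ r₂ ∈ D ∧ r₃ ∈ D := by simp [hDdef]
  obtain ⟨N, hlN, hN⟩ := exists_suppLE l D
  have hD : D ⊆ rows n N := fun r hr => by simpa using hN r hr
  have hprod : ∀ f : Row n → ℂ, ∏ d ∈ D, f d = f r₁ * f r₂ * f r₃ := by
    intro f
    rw [hDdef, Finset.prod_insert (by simp [h12, h13]), Finset.prod_pair h23, mul_assoc]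
  have hval : ∀ r : Row n, m r.1 r.2 = l r.1 r.2 + (if r = r₁ then 1 else 0) +
      (if r = r₂ then 1 else 0) + (if r = r₃ then 1 else 0) := fun r => by
    simp only [hmdef, addBox_apply]
  have hoff : ∀ r : Row n, r ∉ D → m r.1 r.2 = l r.1 r.2 := by
    intro r hr
    simp only [hDdef, Finset.mem_insert, Finset.mem_singleton, not_or] at hr
    rw [hval, if_neg hr.1, if_neg hr.2.1, if_neg hr.2.2]
    simp
  have hin : ∀ r ∈ D, l r.1 r.2 < m r.1 r.2 := by
    intro r hr
    simp only [hDdef, Finset.mem_insert, Finset.mem_singleton] at hr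
    rw [hval]
    rcases hr with rfl | rfl | rfl <;> simp <;> omega
  have good : ∀ x ∈ D, ∀ y ∈ D, x ≠ y → ∃ κ : ℂ,
      sigma R P x y (pt P l x) (pt P l y) = κ * gPoly P.1 P.2.1 P.2.2.1 (pt P l x) (pt P l y) ∧
      sigma R P y x (pt P l y) (pt P l x) =
        -κ * gPoly P.1 P.2.1 P.2.2.1 (pt P l y) (pt P l x) := by
    intro x hx y hy hxy
    have g1 := h.boxPt_ne hl hm hcard hoff hxy (le_refl (l y.1 y.2)) (le_refl (l x.1 x.2))
      (hin y hy) (hin x hx)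
    have g2 := h.boxPt_ne hl hm hcard hoff hxy.symm (le_refl (l x.1 x.2)) (le_refl (l y.1 y.2))
      (hin x hx) (hin y hy)
    rw [← pt_eq_boxPt, ← pt_eq_boxPt] at g1 g2
    exact exists_sigma_eq hR h.mul_eq hxy (pt_ne_zero h.mul_eq h.u_ne l x)
      (pt_ne_zero h.mul_eq h.u_ne l y) g1.1 g1.2 g2.2
  obtain ⟨κ₁₂, k12, k21⟩ := good r₁ hmem.1 r₂ hmem.2.1 h12
  obtain ⟨κ₁₃, k13, k31⟩ := good r₁ hmem.1 r₃ hmem.2.2 h13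
  obtain ⟨κ₂₃, k23, k32⟩ := good r₂ hmem.2.1 r₃ hmem.2.2 h23
  have t123 := hG.chain_eq hR h h12 h13 h23 hl hm hlN hD hprod hmem k12 k13 k23
  have t132 := hG.chain_eq hR h h13 h12 h23.symm hl (c132 ▸ hm) hlN hD
    (fun f => by rw [hprod]; ring) (by tauto) k13 k12 k32
  have t213 := hG.chain_eq hR h h12.symm h23 h13 hl (c213 ▸ hm) hlN hD
    (fun f => by rw [hprod]; ring) (by tauto) k21 k23 k13
  have t231 := hG.chain_eq hR h h23 h12.symm h13.symm hl (by rw [← c231, ← c213]; exact hm) hlN hD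
    (fun f => by rw [hprod]; ring) (by tauto) k23 k21 k31
  have t312 := hG.chain_eq hR h h13.symm h23.symm h12 hl (by rw [← c312, ← c132]; exact hm) hlN hD
    (fun f => by rw [hprod]; ring) (by tauto) k31 k32 k12
  have t321 := hG.chain_eq hR h h23.symm h13.symm h12.symm hl
    (by rw [← c321, ← c231, ← c213]; exact hm) hlN hD
    (fun f => by rw [hprod]; ring) (by tauto) k32 k31 k21
  unfold serreTerm
  rw [t123, t132, t213, t231, t312, t321]
  simp only [pt_addBox_of_ne _ h12, pt_addBox_of_ne _ h12.symm, pt_addBox_of_ne _ h13,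
    pt_addBox_of_ne _ h13.symm, pt_addBox_of_ne _ h23, pt_addBox_of_ne _ h23.symm]
  have id := serreWeight_identity h.mul_eq (pt_ne_zero h.mul_eq h.u_ne l r₁)
    (pt_ne_zero h.mul_eq h.u_ne l r₂) (pt_ne_zero h.mul_eq h.u_ne l r₃)
  simp only at id
  generalize C ^ 3 * ∏ d ∈ D, coefRest R N P l D d (pt P l d) = A
  linear_combination (A * κ₁₂ * κ₁₃ * κ₂₃) * id

lemma phi_serreWeight {q₁ q₂ q₃ : ℂ} (h : q₁ * q₂ * q₃ = 1) {v w : ℂ} (hv : v ≠ 0) (hw : w ≠ 0)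
    (h1 : w ≠ v) (h2 : w ≠ q₁ * v) (h3 : w ≠ q₁ * (q₁ * v)) (h4 : v ≠ q₁ * w) :
    phi q₁ q₂ q₃ (w / (q₁ * v)) * serreWeight v (q₁ * v) w +
      phi q₁ q₂ q₃ (w / v) * serreWeight v w (q₁ * v) +
      phi q₁ q₂ q₃ (q₁ * w / v) * serreWeight w v (q₁ * v) = 0 := by
  have a1 := ne_zero_of_mul₁ h
  have a2 := ne_zero_of_mul₂ h
  have e3 : q₃ = (q₁ * q₂)⁻¹ := by field_simp; linear_combination h
  have b1 : v - w ≠ 0 := sub_ne_zero.2 h1.symm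
  have b2 : q₁ * v - w ≠ 0 := sub_ne_zero.2 h2.symm
  have b3 : q₁ ^ 2 * v - w ≠ 0 := by
    rw [pow_two, mul_assoc]; exact sub_ne_zero.2 h3.symm
  have b4 : v - q₁ * w ≠ 0 := sub_ne_zero.2 h4
  have f1 : phi q₁ q₂ q₃ (w / (q₁ * v)) = (q₁ ^ 2 * q₂ * v - w) * (q₁ * v - q₂ * w) * q₁ /
      (q₁ * q₂ * ((q₁ * v - w) * (q₁ * (q₁ * v) - w))) := by
    unfold phi
    simp only [smul_eq_mul]
    have c1 : 1 - w / (q₁ * v) = (q₁ * v - w) / (q₁ * v) := by field_simp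
    have c2 : 1 - q₁⁻¹ * (w / (q₁ * v)) = (q₁ * (q₁ * v) - w) / (q₁ * (q₁ * v)) := by field_simp
    rw [c1, c2, e3]
    field_simp
  have f2 : phi q₁ q₂ q₃ (w / v) = (q₁ * q₂ * v - w) * (v - q₂ * w) * q₁ /
      (q₁ * q₂ * ((v - w) * (q₁ * v - w))) := by
    unfold phi
    simp only [smul_eq_mul]
    have c1 : 1 - w / v = (v - w) / v := by field_simp
    have c2 : 1 - q₁⁻¹ * (w / v) = (q₁ * v - w) / (q₁ * v) := by field_simp
    rw [c1, c2, e3]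
    field_simp
  have f3 : phi q₁ q₂ q₃ (q₁ * w / v) = (q₂ * v - w) * (v - q₁ * q₂ * w) /
      (q₂ * ((v - q₁ * w) * (v - w))) := by
    unfold phi
    simp only [smul_eq_mul]
    have c1 : 1 - q₁ * w / v = (v - q₁ * w) / v := by field_simp
    have c2 : 1 - q₁⁻¹ * (q₁ * w / v) = (v - w) / v := by field_simp
    rw [c1, c2, e3]
    field_simp
  rw [f1, f2, f3]
  unfold serreWeight
  field_simp
  ring

/-- The cubic relation for two boxes in the row `r` and one box in the row `s` follows from
`phi_serreWeight`. -/
lemma IsStepCoef.serre_of_eq (hG : IsStepCoef P a b R C G) (hR : TotalRel R) (h : Resonant P a b)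
    (l : Tuple n) {r s : Row n} (hrs : r ≠ s) :
    serreTerm P G l r r s + serreTerm P G l r s r + serreTerm P G l s r r = 0 := by
  classical
  have c1 : addBox (addBox (addBox l r.1 r.2) r.1 r.2) s.1 s.2 =
      addBox (addBox (addBox l r.1 r.2) s.1 s.2) r.1 r.2 := addBox_comm _ _ _
  have c2 : addBox (addBox (addBox l r.1 r.2) s.1 s.2) r.1 r.2 =
      addBox (addBox (addBox l s.1 s.2) r.1 r.2) r.1 r.2 := by rw [addBox_comm l]
  set m := addBox (addBox (addBox l r.1 r.2) r.1 r.2) s.1 s.2 with hmdef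
  by_cases hlm : IsAdmissible a b l ∧ IsAdmissible a b m
  swap
  · have z : ∀ x y z : Row n, addBox (addBox (addBox l x.1 x.2) y.1 y.2) z.1 z.2 = m →
        serreTerm P G l x y z = 0 := by
      intro x y z e
      unfold serreTerm
      by_cases hl : IsAdmissible a b l
      · rw [hG.zero (addBox (addBox l x.1 x.2) y.1 y.2) z fun hc => hlm ⟨hl, e ▸ hc.2⟩]; ring
      · rw [hG.zero l x fun hc => hl hc.1]; ring
    rw [z r r s rfl, z r s r c1.symm, z s r r (by rw [← c2, ← c1])]
    ring
  obtain ⟨hl, hm⟩ := hlm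
  have hms : IsAdmissible a b (addBox (addBox (addBox l r.1 r.2) s.1 s.2) r.1 r.2) := c1 ▸ hm
  have hms' : IsAdmissible a b (addBox (addBox (addBox l s.1 s.2) r.1 r.2) r.1 r.2) := c2 ▸ hms
  set D : Finset (Row n) := {r, s} with hDdef
  have hmem : r ∈ D ∧ s ∈ D := by simp [hDdef]
  obtain ⟨N, hlN, hN⟩ := exists_suppLE l D
  have hD : D ⊆ rows n N := fun r hr => by simpa using hN r hr
  have hprod : ∀ f : Row n → ℂ, ∏ d ∈ D, f d = f r * f s := fun f => Finset.prod_pair hrs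
  have hval : ∀ x : Row n, m x.1 x.2 = l x.1 x.2 + (if x = r then 1 else 0) +
      (if x = r then 1 else 0) + (if x = s then 1 else 0) := fun r => by
    simp only [hmdef, addBox_apply]
  have hoff : ∀ r : Row n, r ∉ D → m r.1 r.2 = l r.1 r.2 := by
    intro r hr
    simp only [hDdef, Finset.mem_insert, Finset.mem_singleton, not_or] at hr
    rw [hval, if_neg hr.1, if_neg hr.2]
    simp
  have hmr : m r.1 r.2 = l r.1 r.2 + 2 := by rw [hval, if_pos rfl, if_neg hrs]
  have hmS : m s.1 s.2 = l s.1 s.2 + 1 := by rw [hval, if_neg hrs.symm, if_pos rfl]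
  have hcard : D.card ≤ 3 := Finset.card_le_two.trans (by norm_num)
  set v := pt P l r with hvdef
  set w := pt P l s with hwdef
  have hv : v ≠ 0 := pt_ne_zero h.mul_eq h.u_ne l r
  have hw : w ≠ 0 := pt_ne_zero h.mul_eq h.u_ne l s
  have a1 := h.q₁_ne
  have hv2 : boxPt P r ((l r.1 r.2 + 1 : ℕ) : ℤ) = P.1 * v := by
    rw [hvdef, pt_eq_boxPt]
    unfold boxPt
    push_cast
    rw [zpow_add_one₀ a1]; ring
  have g1 := h.boxPt_ne hl hm hcard hoff hrs.symm (le_refl (l r.1 r.2)) (le_refl (l s.1 s.2))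
    (by omega) (by omega)
  have g2 := h.boxPt_ne hl hm hcard hoff hrs.symm (show l r.1 r.2 ≤ l r.1 r.2 + 1 by omega)
    (le_refl (l s.1 s.2)) (by omega) (by omega)
  have g3 := h.boxPt_ne hl hm hcard hoff hrs (le_refl (l s.1 s.2)) (le_refl (l r.1 r.2))
    (by omega) (by omega)
  rw [← pt_eq_boxPt, ← pt_eq_boxPt] at g1 g3
  rw [hv2, ← pt_eq_boxPt] at g2
  -- the vanishing of `phi` at the ratios of points of blocked boxes
  have vanish : ∀ x y : ℂ, y ≠ 0 → (y = P.2.1 * x ∨ y = P.2.2.1 * x) →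
      phi P.1 P.2.1 P.2.2.1 (x / y) = 0 := by
    intro x y hy e
    have hx : x ≠ 0 := by rintro rfl; rcases e with e | e <;> exact hy (by rw [e]; ring)
    unfold phi
    simp only [smul_eq_mul]
    rcases e with e | e
    · have : 1 - P.2.1 * (x / y) = 0 := by rw [e]; have := h.q₂_ne; field_simp; ring
      rw [this]; simp
    · have : 1 - P.2.2.1 * (x / y) = 0 := by rw [e]; have := h.q₃_ne; field_simp; ring
      rw [this]; simp
  have uni : ∀ x : ℂ, x ≠ 0 → phi P.1 P.2.1 P.2.2.1 (P.1 * x⁻¹) = phi P.1 P.2.1 P.2.2.1 x :=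
    fun x hx => phi_unitary h.mul_eq hx
  have nr := hN _ hmem.1
  have ns := hN _ hmem.2
  have irr : ∀ r x, theta R P r r x = 1 := fun r x => if_neg (hR.irrefl r)
  have hrest : ∀ l' : Tuple n, (∀ r : Row n, r ∉ D → l' r.1 r.2 = l r.1 r.2) → ∀ c v,
      coefRest R N P l' D c v = coefRest R N P l D c v := fun l' hl' c v =>
    coefRest_congr hD hl' c v
  have m1 : ∀ x, x ∉ D → x ≠ r := fun x hr hc => hr (hc ▸ hmem.1)
  have m2 : ∀ x, x ∉ D → x ≠ s := fun x hr hc => hr (hc ▸ hmem.2)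
  have s1 := hrest (addBox l r.1 r.2) (fun r hr => by
    simp only [addBox_apply, if_neg (m1 r hr), add_zero])
  have s2 := hrest (addBox (addBox l r.1 r.2) r.1 r.2) (fun r hr => by
    simp only [addBox_apply, if_neg (m1 r hr), add_zero])
  have s3 := hrest (addBox l s.1 s.2) (fun r hr => by
    simp only [addBox_apply, if_neg (m2 r hr), add_zero])
  have s4 := hrest (addBox (addBox l r.1 r.2) s.1 s.2) (fun r hr => by
    simp only [addBox_apply, if_neg (m1 r hr), if_neg (m2 r hr), add_zero])
  have s5 := hrest (addBox (addBox l s.1 s.2) r.1 r.2) (fun r hr => by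
    simp only [addBox_apply, if_neg (m1 r hr), if_neg (m2 r hr), add_zero])
  set A : ℂ := C ^ 3 * coefRest R N P l D r v * coefRest R N P l D r (P.1 * v) *
    coefRest R N P l D s w * theta R P s r (w / v) with hA
  have hθ : ∀ x y : ℂ, x ≠ 0 → y ≠ 0 → ∀ X : ℂ, theta R P s r X * theta R P r s (P.1 * (x / y)) =
      if R s r then phi P.1 P.2.1 P.2.2.1 X else phi P.1 P.2.1 P.2.2.1 (y / x) := by
    intro x y hx hy X
    unfold theta
    by_cases hsr : R s r
    · rw [if_pos hsr, if_pos hsr, if_neg ((hR.total _ _ hrs.symm).1 hsr), mul_one]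
    · have e := uni (y / x) (div_ne_zero hy hx)
      rw [inv_div] at e
      rw [if_neg hsr, if_neg hsr, if_pos ((hR.total _ _ hrs).2 hsr), one_mul, e]
  have hq1v : P.1 * v ≠ 0 := mul_ne_zero a1 hv
  -- the row `r` twice, then the row `s`
  have t1 : G l r * G (addBox l r.1 r.2) r * G (addBox (addBox l r.1 r.2) r.1 r.2) s =
      A * phi P.1 P.2.1 P.2.2.1 (w / (P.1 * v)) := by
    by_cases h1 : IsAdmissible a b (addBox l r.1 r.2)
    swap
    -- the row `s` misses only one box of `m`, so it cannot block the row `r`, which misses two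
    · exfalso
      obtain ⟨c, d, e1, e2, e3, e4⟩ := h.exists_blocked hl hm h1
        (fun r => by rw [addBox_apply]; omega) (fun r => by simp only [hval, addBox_apply]; omega)
        (fun r => by rw [addBox_apply]; split_ifs <;> omega)
      simp only [hval, addBox_apply] at e1 e2 e3
      have hd : d = r := by by_contra hc; rw [if_neg hc] at e1; omega
      subst hd
      rw [if_pos rfl, if_neg hrs] at e3
      split_ifs at e2 e3 <;> omega
    by_cases h2 : IsAdmissible a b (addBox (addBox l r.1 r.2) r.1 r.2)
    swap
    · rw [hG.zero _ r fun h => h2 h.2]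
      obtain ⟨c, d, e1, e2, e3, e4⟩ := h.exists_blocked h1 hm h2
        (fun r => by simp only [addBox_apply]; omega)
        (fun r => by simp only [hval, addBox_apply]; omega)
        (fun r => by simp only [addBox_apply]; split_ifs <;> omega)
      simp only [hval, addBox_apply] at e1 e2 e3
      have hd : d = r := by by_contra hc; rw [if_neg hc] at e1; omega
      subst hd
      rw [if_pos rfl, if_neg hrs] at e3
      have hc : c = s := by
        by_contra hc
        rw [if_neg hc] at e3
        split_ifs at e2 e3 <;> omega
      subst hc
      rw [pt_addBox_self, pt_addBox_of_ne _ hrs.symm] at e4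
      rw [vanish w (P.1 * v) hq1v e4]; ring
    rw [hG.eq l r N hl h1 hlN nr, hG.eq _ r N h1 h2 (hlN.addBox nr) nr,
      hG.eq _ s N h2 hm ((hlN.addBox nr).addBox nr) ns]
    simp only [coefN_eq hD, hprod, s1, s2, pt_addBox_self, pt_addBox_of_ne _ hrs.symm, irr]
    have key := hθ (P.1 * v) w hq1v hw (w / (P.1 * v))
    rw [ite_self] at key
    rw [hA, ← key, ← hvdef, ← hwdef, mul_div_assoc P.1]
    ring
  have t2 : G l r * G (addBox l r.1 r.2) s * G (addBox (addBox l r.1 r.2) s.1 s.2) r =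
      A * phi P.1 P.2.1 P.2.2.1 (w / v) := by
    by_cases h1 : IsAdmissible a b (addBox l r.1 r.2)
    swap
    · exfalso
      obtain ⟨c, d, e1, e2, e3, e4⟩ := h.exists_blocked hl hm h1
        (fun r => by rw [addBox_apply]; omega) (fun r => by simp only [hval, addBox_apply]; omega)
        (fun r => by rw [addBox_apply]; split_ifs <;> omega)
      simp only [hval, addBox_apply] at e1 e2 e3
      have hd : d = r := by by_contra hc; rw [if_neg hc] at e1; omega
      subst hd
      rw [if_pos rfl, if_neg hrs] at e3
      split_ifs at e2 e3 <;> omega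
    by_cases h2 : IsAdmissible a b (addBox (addBox l r.1 r.2) s.1 s.2)
    swap
    · rw [hG.zero _ s fun h => h2 h.2]
      exfalso
      obtain ⟨c, d, e1, e2, e3, e4⟩ := h.exists_blocked hl hm h2
        (fun r => by simp only [addBox_apply]; omega)
        (fun r => by simp only [hval, addBox_apply]; omega)
        (fun x => by
          simp only [addBox_apply]
          by_cases hx : x = r
          · rw [if_pos hx, if_neg (by rw [hx]; exact hrs)]
          · rw [if_neg hx]; split_ifs <;> omega)
      simp only [hval, addBox_apply] at e1 e2 e3
      split_ifs at e2 e3 <;> omega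
    rw [hG.eq l r N hl h1 hlN nr, hG.eq _ s N h1 h2 (hlN.addBox nr) ns,
      hG.eq _ r N h2 hms ((hlN.addBox nr).addBox ns) nr]
    simp only [coefN_eq hD, hprod, s1, s4, pt_addBox_self, pt_addBox_of_ne _ hrs.symm,
      pt_addBox_of_ne _ hrs, irr]
    have key := hθ v w hv hw (w / v)
    rw [ite_self] at key
    rw [hA, ← key, ← hvdef, ← hwdef, mul_div_mul_left _ _ a1, mul_div_assoc P.1]
    ring
  have t3 : G l s * G (addBox l s.1 s.2) r * G (addBox (addBox l s.1 s.2) r.1 r.2) r =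
      A * phi P.1 P.2.1 P.2.2.1 (P.1 * w / v) := by
    by_cases h1 : IsAdmissible a b (addBox l s.1 s.2)
    swap
    · rw [hG.zero _ s fun h => h1 h.2]
      obtain ⟨c, d, e1, e2, e3, e4⟩ := h.exists_blocked hl hm h1
        (fun r => by rw [addBox_apply]; omega) (fun r => by simp only [hval, addBox_apply]; omega)
        (fun r => by rw [addBox_apply]; split_ifs <;> omega)
      simp only [hval, addBox_apply] at e1 e2 e3
      have hd : d = s := by by_contra hc; rw [if_neg hc] at e1; omega
      subst hd
      rw [if_pos rfl, if_neg hrs.symm] at e3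
      have hc : c = r := by
        by_contra hc
        rw [if_neg hc] at e3
        split_ifs at e2 e3 <;> omega
      subst hc
      have e := uni (v / w) (div_ne_zero hv hw)
      rw [inv_div, vanish v w hw e4] at e
      rw [mul_div_assoc, e]; ring
    by_cases h2 : IsAdmissible a b (addBox (addBox l s.1 s.2) r.1 r.2)
    swap
    · exfalso
      obtain ⟨c, d, e1, e2, e3, e4⟩ := h.exists_blocked hl hm h2
        (fun r => by simp only [addBox_apply]; omega)
        (fun r => by simp only [hval, addBox_apply]; omega)
        (fun x => by
          simp only [addBox_apply]
          by_cases hx : x = r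
          · rw [if_pos hx, if_neg (by rw [hx]; exact hrs)]
          · rw [if_neg hx]; split_ifs <;> omega)
      simp only [hval, addBox_apply] at e1 e2 e3
      split_ifs at e2 e3 <;> omega
    rw [hG.eq l s N hl h1 hlN ns, hG.eq _ r N h1 h2 (hlN.addBox ns) nr,
      hG.eq _ r N h2 hms' ((hlN.addBox ns).addBox nr) nr]
    simp only [coefN_eq hD, hprod, s3, s5, pt_addBox_self, pt_addBox_of_ne _ hrs.symm,
      pt_addBox_of_ne _ hrs, irr]
    rw [hA, ← hvdef, ← hwdef, mul_div_mul_left _ _ a1]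
    have key : theta R P s r (P.1 * w / v) * theta R P r s (v / w) =
        phi P.1 P.2.1 P.2.2.1 (P.1 * w / v) := by
      unfold theta
      by_cases hsr : R s r
      · rw [if_pos hsr, if_neg ((hR.total _ _ hrs.symm).1 hsr), mul_one]
      · have e := uni (v / w) (div_ne_zero hv hw)
        rw [inv_div, ← mul_div_assoc] at e
        rw [if_neg hsr, if_pos ((hR.total _ _ hrs).2 hsr), one_mul, e]
    rw [← key]
    ring
  unfold serreTerm
  rw [t1, t2, t3]
  simp only [pt_addBox_self, pt_addBox_of_ne _ hrs, pt_addBox_of_ne _ hrs.symm]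
  have id := phi_serreWeight h.mul_eq hv hw g1.1 g1.2 g2.2 g3.2
  linear_combination A * id

lemma serreTerm_self (h : Resonant P a b) (l : Tuple n) (r : Row n) :
    serreTerm P G l r r r = 0 := by
  have hv : pt P l r ≠ 0 := pt_ne_zero h.mul_eq h.u_ne l r
  have a1 := h.q₁_ne
  unfold serreTerm
  simp only [pt_addBox_self]
  unfold serreWeight
  field_simp
  ring

/-- The cubic relation: the sum over all orders vanishes. -/
lemma IsStepCoef.serre (hG : IsStepCoef P a b R C G) (hR : TotalRel R) (h : Resonant P a b)
    (l : Tuple n) (r₁ r₂ r₃ : Row n) :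
    serreTerm P G l r₁ r₂ r₃ + serreTerm P G l r₁ r₃ r₂ + serreTerm P G l r₂ r₁ r₃ +
      serreTerm P G l r₂ r₃ r₁ + serreTerm P G l r₃ r₁ r₂ + serreTerm P G l r₃ r₂ r₁ = 0 := by
  by_cases h12 : r₁ = r₂
  · subst h12
    by_cases h13 : r₁ = r₃
    · subst h13
      rw [serreTerm_self h]; ring
    · linear_combination 2 * hG.serre_of_eq hR h l h13
  · by_cases h13 : r₁ = r₃
    · subst h13
      linear_combination 2 * hG.serre_of_eq hR h l h12
    · by_cases h23 : r₂ = r₃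
      · subst h23
        linear_combination 2 * hG.serre_of_eq hR h l (Ne.symm h12)
      · exact hG.serre_of_ne hR h l h12 h13 h23

end Cubic

/-! ### Generic parameters and limits of matrix coefficients -/

section Limits

variable {n : ℕ} {P : Params n}

/-- The parameters can be moved along the paths `t ↦ exp (t ^ k)`, with different exponents `k` for
different parameters. A given monomial is equal to `1` only at finitely many `t`, so the non-generic
parameters are met only at countably many `t`. -/
lemma neBot_generic (h : P.1 * P.2.1 * P.2.2.1 = 1) (hu : ∀ i, P.2.2.2 i ≠ 0) :
    (𝓝[{Q | IsGeneric Q}] P).NeBot := by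
  obtain ⟨q₁, q₂, q₃, u⟩ := P
  simp only at h hu
  have h1 := ne_zero_of_mul₁ h
  have h2 := ne_zero_of_mul₂ h
  rw [← mem_closure_iff_nhdsWithin_neBot]
  set γ : ℝ → Params n := fun t => (q₁ * Complex.exp (t : ℂ), q₂ * Complex.exp ((t : ℂ) ^ 2),
    q₃ * Complex.exp (-(t : ℂ) - (t : ℂ) ^ 2), fun i => u i * Complex.exp ((t : ℂ) ^ (3 + (i : ℕ))))
    with hγ
  have hγc : Continuous γ := by
    refine Continuous.prodMk (by fun_prop) (Continuous.prodMk (by fun_prop)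
      (Continuous.prodMk (by fun_prop) (continuous_pi fun i => by fun_prop)))
  have hγ0 : γ 0 = (q₁, q₂, q₃, u) := by simp [hγ]
  rw [← hγ0]
  set B : Set ℝ := ⋃ v : {v : ℤ × ℤ × (Fin n → ℤ) // v ≠ 0},
    {t : ℝ | (γ t).1 ^ v.1.1 * (γ t).2.1 ^ v.1.2.1 * ∏ i, (γ t).2.2.2 i ^ v.1.2.2 i = 1} with hB
  have hBc : B.Countable := by
    refine Set.countable_iUnion fun v => ?_
    obtain ⟨⟨x, y, j⟩, hv⟩ := v
    set p : Polynomial ℝ := Polynomial.C (x : ℝ) * Polynomial.X ^ 1 +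
      Polynomial.C (y : ℝ) * Polynomial.X ^ 2 +
      ∑ i : Fin n, Polynomial.C (j i : ℝ) * Polynomial.X ^ (3 + (i : ℕ)) with hp
    set c : ℂ := q₁ ^ x * q₂ ^ y * ∏ i, u i ^ j i with hc
    have hc0 : c ≠ 0 := mul_ne_zero (mul_ne_zero (zpow_ne_zero _ h1) (zpow_ne_zero _ h2))
      (Finset.prod_ne_zero_iff.2 fun i _ => zpow_ne_zero _ (hu i))
    -- the monomial has absolute value `1` only at the zeros of `p + log ‖c‖`
    have hpc : p + Polynomial.C (Real.log ‖c‖) ≠ 0 := by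
      intro h0
      have coef : ∀ k, (p + Polynomial.C (Real.log ‖c‖)).coeff k = 0 := fun k => by rw [h0]; simp
      have c1 := coef 1
      have c2 := coef 2
      have c3 := fun i : Fin n => coef (3 + i)
      simp only [hp, Polynomial.coeff_add, Polynomial.coeff_C_mul, Polynomial.coeff_X_pow,
        Polynomial.finsetSum_coeff, Polynomial.coeff_C] at c1 c2 c3
      have e1 : ∀ k : Fin n, ¬ (1 = 3 + (k : ℕ)) := fun k => by omega
      have e2 : ∀ k : Fin n, ¬ (2 = 3 + (k : ℕ)) := fun k => by omega
      have e3 : ∀ k i : Fin n, (3 + (i : ℕ) = 3 + (k : ℕ)) ↔ k = i := fun k i => by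
        rw [Fin.ext_iff]; omega
      simp only [e1, e2, if_false, mul_zero, Finset.sum_const_zero] at c1 c2
      simp only [e3] at c3
      norm_num at c1 c2
      refine hv ?_
      have : j = 0 := by
        funext i
        have := c3 i
        rw [if_neg (by omega), if_neg (by omega), if_neg (by omega)] at this
        simp only [mul_ite, mul_one, mul_zero, Finset.sum_ite_eq', Finset.mem_univ, if_true,
          zero_add, add_zero] at this
        exact_mod_cast this
      rw [c1, c2, this]; rfl
    refine Set.Countable.mono ?_ ((p + Polynomial.C (Real.log ‖c‖)).rootSet_finite ℝ).countable
    intro t ht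
    simp only [Set.mem_ofPred_eq, hγ] at ht
    have e : c * Complex.exp ((p.eval t : ℝ) : ℂ) = 1 := by
      rw [← ht, hp, hc]
      simp only [Polynomial.eval_add, Polynomial.eval_mul, Polynomial.eval_C, Polynomial.eval_pow,
        Polynomial.eval_X, Polynomial.eval_finsetSum, mul_zpow, ← Complex.exp_int_mul,
        Finset.prod_mul_distrib]
      push_cast
      rw [Complex.exp_add, Complex.exp_add, Complex.exp_sum, pow_one]
      ring
    have e' := congrArg (fun z : ℂ => Real.log ‖z‖) e
    simp only [norm_mul, norm_one, Real.log_one] at e'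
    rw [Complex.norm_exp_ofReal, Real.log_mul (by simpa using hc0) (Real.exp_pos _).ne',
      Real.log_exp] at e'
    rw [Polynomial.mem_rootSet]
    refine ⟨hpc, ?_⟩
    simp only [map_add, Polynomial.aeval_C, Polynomial.coe_aeval_eq_eval, Algebra.algebraMap_self,
      RingHom.id_apply]
    linarith
  have h0 : (0 : ℝ) ∈ closure Bᶜ := (hBc.dense_compl ℝ) 0
  refine map_mem_closure hγc h0 fun t ht => ?_
  refine ⟨?_, fun i => mul_ne_zero (hu i) (Complex.exp_ne_zero _), fun x y j e => ?_⟩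
  · have : q₁ * Complex.exp (t : ℂ) * (q₂ * Complex.exp ((t : ℂ) ^ 2)) *
        (q₃ * Complex.exp (-(t : ℂ) - (t : ℂ) ^ 2)) = q₁ * q₂ * q₃ *
        Complex.exp ((t : ℂ) + (t : ℂ) ^ 2 + (-(t : ℂ) - (t : ℂ) ^ 2)) := by
      rw [Complex.exp_add, Complex.exp_add]; ring
    rw [this, h]
    simp
  · by_contra hc
    refine ht (Set.mem_iUnion.2 ⟨⟨(x, y, j), fun h0 => hc ?_⟩, e⟩)
    simpa [Prod.ext_iff] using h0

lemma continuous_pt (l : Tuple n) (r : Row n) : Continuous fun Q : Params n => pt Q l r := by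
  simp only [pt_eq]
  fun_prop

/-- The poles of the coefficient are at parameters for which the point of another row is `1` or
`q₁` times the point of `r`. -/
lemma continuousAt_coefN (h : P.1 * P.2.1 * P.2.2.1 = 1) (hu : ∀ i, P.2.2.2 i ≠ 0)
    {R : Row n → Row n → Prop} (hR : TotalRel R) (N : ℕ) {l : Tuple n} {r : Row n}
    (h1 : ∀ r', r' ≠ r → pt P l r' ≠ pt P l r)
    (h2 : ∀ r', pt P l r' ≠ P.1 * pt P l r) :
    ContinuousAt (fun Q => coefN R N Q l r) P := by
  classical
  have hr := pt_ne_zero h hu l r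
  have q1 := ne_zero_of_mul₁ h
  have hdiv : ∀ r', ContinuousAt (fun Q : Params n => pt Q l r' / pt Q l r) P := fun r' =>
    (continuous_pt l r').continuousAt.div (continuous_pt l r).continuousAt hr
  unfold coefN
  refine ContinuousAt.mul ?_ ?_
  · refine tendsto_finsetProd _ fun j hj => ?_
    have hne : (j, N) ≠ r := by
      rintro rfl
      exact hR.irrefl _ (by simpa using hj)
    unfold psiEmpty
    simp only [smul_eq_mul]
    refine ContinuousAt.div ?_ ?_ ?_
    · exact continuousAt_const.sub ((by fun_prop : ContinuousAt (fun Q : Params n => Q.2.1) P).mul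
        (hdiv _))
    · exact continuousAt_const.sub (hdiv _)
    · intro e
      exact h1 _ hne ((div_eq_one_iff_eq hr).1 (sub_eq_zero.1 e).symm)
  · refine tendsto_finsetProd _ fun r' hr' => ?_
    simp only [Finset.mem_filter] at hr'
    have hne : r' ≠ r := by
      rintro rfl
      exact hR.irrefl _ hr'.2
    unfold phi
    simp only [smul_eq_mul]
    refine ContinuousAt.div ?_ ?_ ?_
    · exact (continuousAt_const.sub ((by fun_prop :
        ContinuousAt (fun Q : Params n => Q.2.2.1) P).mul (hdiv _))).mul
        (continuousAt_const.sub ((by fun_prop : ContinuousAt (fun Q : Params n => Q.2.1) P).mul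
        (hdiv _)))
    · exact (continuousAt_const.sub (hdiv _)).mul (continuousAt_const.sub
        (((by fun_prop : ContinuousAt (fun Q : Params n => Q.1) P).inv₀ q1).mul (hdiv _)))
    · refine mul_ne_zero (fun e => ?_) (fun e => ?_)
      · exact h1 _ hne ((div_eq_one_iff_eq hr).1 (sub_eq_zero.1 e).symm)
      · refine h2 r' ?_
        rw [sub_eq_zero] at e
        field_simp at e
        exact e.symm

/-- The product of the coefficients for adding and removing a box. -/
def coefEF (N : ℕ) (Q : Params n) (l : Tuple n) (r : Row n) : ℂ :=
  coefN rowLt N Q l r * coefN rowGt N Q l r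

/-- A row whose end is proportional to the point of `r` with the factor `q₂⁻¹` or `q₃⁻¹` makes the
product of the two coefficients vanish, as it contributes to exactly one of them. -/
lemma coefEF_eq_zero (h : P.1 * P.2.1 * P.2.2.1 = 1) (hu : ∀ i, P.2.2.2 i ≠ 0) {N : ℕ}
    {l : Tuple n} {r c : Row n} (hc : c.2 < N) (hcr : c ≠ r)
    (e : pt P l r = P.2.1 * pt P l c ∨ pt P l r = P.2.2.1 * pt P l c) : coefEF N P l r = 0 := by
  classical
  have h0 := pt_ne_zero h hu l c
  have q2 := ne_zero_of_mul₂ h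
  have q3 := ne_zero_of_mul₃ h
  have hz : phi P.1 P.2.1 P.2.2.1 (pt P l c / pt P l r) = 0 := by
    unfold phi
    simp only [smul_eq_mul]
    rcases e with e | e
    · have : 1 - P.2.1 * (pt P l c / pt P l r) = 0 := by rw [e]; field_simp; ring
      rw [this]; simp
    · have : 1 - P.2.2.1 * (pt P l c / pt P l r) = 0 := by rw [e]; field_simp; ring
      rw [this]; simp
  have hz' : ∀ R : Row n → Row n → Prop, R c r → coefN R N P l r = 0 := by
    intro R hR
    unfold coefN
    rw [Finset.prod_eq_zero (i := c) (by simp [hc, hR]) hz, mul_zero]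
  unfold coefEF
  by_cases hR : rowLt c r
  · rw [hz' _ hR, zero_mul]
  · rw [hz' rowGt ((totalRel_rowLt.total _ _ hcr.symm).2 hR), mul_zero]

/-- The filter of generic parameters tending to `P`. -/
abbrev genericNhds (P : Params n) : Filter (Params n) := 𝓝[{Q | IsGeneric Q}] P

lemma eventually_generic : ∀ᶠ Q in genericNhds P, IsGeneric Q := self_mem_nhdsWithin

lemma tendsto_q₁ : Tendsto (fun Q : Params n => Q.1) (genericNhds P) (𝓝 P.1) :=
  (continuous_fst.tendsto P).mono_left nhdsWithin_le_nhds

end Limits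

section ResonantLimits

variable {n : ℕ} [NeZero n] {P : Params n} {a b : Fin n → ℕ} {l m : Tuple n} {r : Row n} {N : ℕ}

lemma Resonant.neBot (h : Resonant P a b) : (genericNhds P).NeBot := neBot_generic h.mul_eq h.u_ne

lemma Resonant.tendsto_coefN (h : Resonant P a b) {R : Row n → Row n → Prop} (hR : TotalRel R)
    (N : ℕ) (hl : IsAdmissible a b l) (hg : Growable l r) :
    Tendsto (fun Q => coefN R N Q l r) (genericNhds P) (𝓝 (coefN R N P l r)) :=
  (continuousAt_coefN h.mul_eq h.u_ne hR N (fun _ hr => h.pt_ne hl hr)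
    (fun r' => h.pt_ne_q₁_mul_pt hl hg r')).tendsto.mono_left nhdsWithin_le_nhds

lemma Resonant.tendsto_tensorE (h : Resonant P a b) (hl : IsAdmissible a b l) (hg : Growable l r)
    (hN : SuppLE l N) (hr : r.2 < N) :
    Tendsto (fun Q => tensorE Q l r.1 r.2) (genericNhds P)
      (𝓝 (1 / (1 - P.1) * coefN rowLt N P l r)) := by
  have h1 : 1 - P.1 ≠ 0 := sub_ne_zero.2 h.q₁_ne_one.symm
  refine Tendsto.congr' (f₁ := fun Q => 1 / (1 - Q.1) * coefN rowLt N Q l r) ?_ ?_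
  · filter_upwards [eventually_generic] with Q hQ
    exact (tensorE_eq_coefN hQ hN hr.le).symm
  · exact (tendsto_const_nhds.div (tendsto_const_nhds.sub tendsto_q₁) h1).mul
      (h.tendsto_coefN totalRel_rowLt N hl hg)

lemma Resonant.tendsto_tensorF (h : Resonant P a b) (hl : IsAdmissible a b l) (hg : Growable l r)
    (hN : SuppLE l N) (hr : r.2 < N) :
    Tendsto (fun Q => tensorF Q l r.1 r.2) (genericNhds P)
      (𝓝 (P.1 / (1 - P.1) * coefN rowGt N P l r)) := by
  have h1 : 1 - P.1 ≠ 0 := sub_ne_zero.2 h.q₁_ne_one.symm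
  refine Tendsto.congr' (f₁ := fun Q => Q.1 / (1 - Q.1) * coefN rowGt N Q l r) ?_ ?_
  · filter_upwards [eventually_generic] with Q hQ
    exact (tensorF_eq_coefN hQ hN hr).symm
  · exact (tendsto_q₁.div (tendsto_const_nhds.sub tendsto_q₁) h1).mul
      (h.tendsto_coefN totalRel_rowGt N hl hg)

open scoped Classical in
/-- The matrix coefficient `⟨l + 1_r| e(z) |l⟩` on `ℳ`, without the delta function. -/
def stepE (P : Params n) (a b : Fin n → ℕ) (l : Tuple n) (r : Row n) : ℂ :=
  if IsAdmissible a b l ∧ IsAdmissible a b (addBox l r.1 r.2) then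
    1 / (1 - P.1) * coefN rowLt (exists_suppLE l {r}).choose P l r else 0

open scoped Classical in
/-- The matrix coefficient `⟨l| f(z) |l + 1_r⟩` on `ℳ`, without the delta function. -/
def stepF (P : Params n) (a b : Fin n → ℕ) (l : Tuple n) (r : Row n) : ℂ :=
  if IsAdmissible a b l ∧ IsAdmissible a b (addBox l r.1 r.2) then
    P.1 / (1 - P.1) * coefN rowGt (exists_suppLE l {r}).choose P l r else 0

lemma Resonant.isStepCoef_stepE (h : Resonant P a b) :
    IsStepCoef P a b rowLt (1 / (1 - P.1)) (stepE P a b) := by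
  constructor
  · intro l r N hl hl' hN hr
    have := h.neBot
    obtain ⟨h1, h2⟩ := (exists_suppLE l {r}).choose_spec
    have hg := growable_of_isAdmissible hl'
    rw [stepE, if_pos ⟨hl, hl'⟩]
    exact tendsto_nhds_unique (h.tendsto_tensorE hl hg h1 (h2 r (by simp)))
      (h.tendsto_tensorE hl hg hN hr)
  · intro l r hc
    rw [stepE, if_neg hc]

lemma Resonant.isStepCoef_stepF (h : Resonant P a b) :
    IsStepCoef P a b rowGt (P.1 / (1 - P.1)) (stepF P a b) := by
  constructor
  · intro l r N hl hl' hN hr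
    have := h.neBot
    obtain ⟨h1, h2⟩ := (exists_suppLE l {r}).choose_spec
    have hg := growable_of_isAdmissible hl'
    rw [stepF, if_pos ⟨hl, hl'⟩]
    exact tendsto_nhds_unique (h.tendsto_tensorF hl hg h1 (h2 r (by simp)))
      (h.tendsto_tensorF hl hg hN hr)
  · intro l r hc
    rw [stepF, if_neg hc]

lemma Resonant.tendsto_tensorE_stepE (h : Resonant P a b) (hl : IsAdmissible a b l)
    (hl' : IsAdmissible a b (addBox l r.1 r.2)) :
    Tendsto (fun Q => tensorE Q l r.1 r.2) (genericNhds P) (𝓝 (stepE P a b l r)) := by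
  obtain ⟨N, h1, h2⟩ := exists_suppLE l {r}
  rw [h.isStepCoef_stepE.eq l r N hl hl' h1 (h2 r (by simp))]
  exact h.tendsto_tensorE hl (growable_of_isAdmissible hl') h1 (h2 r (by simp))

lemma Resonant.tendsto_tensorF_stepF (h : Resonant P a b) (hl : IsAdmissible a b l)
    (hl' : IsAdmissible a b (addBox l r.1 r.2)) :
    Tendsto (fun Q => tensorF Q l r.1 r.2) (genericNhds P) (𝓝 (stepF P a b l r)) := by
  obtain ⟨N, h1, h2⟩ := exists_suppLE l {r}
  rw [h.isStepCoef_stepF.eq l r N hl hl' h1 (h2 r (by simp))]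
  exact h.tendsto_tensorF hl (growable_of_isAdmissible hl') h1 (h2 r (by simp))

/-- If the row `r` of an admissible tuple is growable, but adding a box is blocked, then the row
which blocks it makes the coefficient vanish. -/
lemma Resonant.coefEF_eq_zero_of_growable (h : Resonant P a b) (hl : IsAdmissible a b l)
    (hl' : ¬ IsAdmissible a b (addBox l r.1 r.2)) (hr : r.2 < N) : coefEF N P l r = 0 := by
  rw [isAdmissible_iff] at hl'
  push Not at hl'
  obtain ⟨i, y, hd, hk⟩ := hl'
  have ha := (isAdmissible_iff l).1 hl i y hd
  have hdi := (base_succ_le b i).trans hd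
  simp only [height_addBox] at hk
  by_cases hc : toRow b i (y + 1) = r ∧ toRow b i y ≠ r ∧
      height a b l i (y + 1) = height a b l i y
  · obtain ⟨e1, e2, e3⟩ := hc
    refine coefEF_eq_zero h.mul_eq h.u_ne (c := toRow b i y) ?_ e2 (.inr ?_)
    · rw [toRow_succ_y hd] at e1
      rw [← e1] at hr; simp only at hr; omega
    · rw [← e1, h.pt_toRow hd, h.pt_toRow (show base b i ≤ y + 1 by omega), e3]
      have := weight_add h.mul_eq (height a b l i y) y i 0 1 0
      simpa using this
  · have hc' : toRow b (i + 1) y = r ∧ toRow b i y ≠ r ∧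
        height a b l (i + 1) y = height a b l i y := by
      have := hk (by
        by_contra hlt
        refine hc ⟨?_, ?_, ?_⟩
        · by_contra h'; rw [if_neg h'] at hlt; split_ifs at hlt <;> omega
        · intro h'; rw [if_pos h'] at hlt; split_ifs at hlt <;> omega
        · split_ifs at hlt <;> omega)
      refine ⟨?_, ?_, ?_⟩
      · by_contra h'; rw [if_neg h'] at this; split_ifs at this <;> omega
      · intro h'; rw [if_pos h'] at this; split_ifs at this <;> omega
      · split_ifs at this <;> omega
    obtain ⟨e1, e2, e3⟩ := hc'
    refine coefEF_eq_zero h.mul_eq h.u_ne (c := toRow b i y) ?_ e2 (.inl ?_)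
    · rw [toRow_succ_i hd] at e1
      rw [← e1] at hr; simp only at hr; omega
    · rw [← e1, h.pt_toRow hd, h.pt_toRow hdi, e3]
      have := weight_add h.mul_eq (height a b l i y) y i 0 0 1
      simpa using this

/-- If removing the box `r` from an admissible tuple is blocked, then the row which blocks it makes
the coefficient vanish. -/
lemma Resonant.coefEF_eq_zero_of_addBox (h : Resonant P a b)
    (hl : IsAdmissible a b (addBox m r.1 r.2)) (hm : ¬ IsAdmissible a b m) (hN : SuppLE m N) :
    coefEF N P m r = 0 := by
  rw [isAdmissible_iff] at hm
  push Not at hm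
  obtain ⟨i, y, hd, hk⟩ := hm
  have ha := (isAdmissible_iff _).1 hl i y hd
  have hdi := (base_succ_le b i).trans hd
  simp only [height_addBox] at ha
  by_cases hc : height a b m i (y + 1) ≤ height a b m i y
  · have hlt := hk hc
    have e1 : toRow b i y = r := by by_contra h'; rw [if_neg h'] at ha; split_ifs at ha <;> omega
    have e2 : toRow b (i + 1) y ≠ r := by
      intro h'; rw [if_pos h', if_pos e1] at ha; omega
    have e3 : height a b m (i + 1) y = height a b m i y + 1 := by
      rw [if_pos e1] at ha; split_ifs at ha <;> omega
    refine coefEF_eq_zero h.mul_eq h.u_ne (c := toRow b (i + 1) y) ?_ e2 (.inr ?_)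
    · by_contra hcN
      have := hN (toRow b (i + 1) y).1 (toRow b (i + 1) y).2 (by omega)
      unfold height at e3
      rw [this, shift_succ] at e3
      push_cast at e3
      omega
    · rw [← e1, h.pt_toRow hd, h.pt_toRow hdi, e3,
        ← weight_diag h.mul_eq (height a b m i y) y i 1]
      have := weight_add h.mul_eq (height a b m i y + 1) y (i + 1) 0 1 0
      simpa using this
  · have e1 : toRow b i y = r := by by_contra h'; rw [if_neg h'] at ha; split_ifs at ha <;> omega
    have e2 : toRow b i (y + 1) ≠ r := by
      intro h'; rw [if_pos h', if_pos e1] at ha; omega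
    have e3 : height a b m i (y + 1) = height a b m i y + 1 := by
      rw [if_pos e1] at ha; split_ifs at ha <;> omega
    refine coefEF_eq_zero h.mul_eq h.u_ne (c := toRow b i (y + 1)) ?_ e2 (.inl ?_)
    · by_contra hcN
      have := hN (toRow b i (y + 1)).1 (toRow b i (y + 1)).2 (by omega)
      unfold height at e3
      rw [this] at e3
      push_cast at e3
      omega
    · rw [← e1, h.pt_toRow hd, h.pt_toRow (show base b i ≤ y + 1 by omega), e3,
        ← weight_diag h.mul_eq (height a b m i y) y i 1]
      have := weight_add h.mul_eq (height a b m i y + 1) (y + 1) i 0 0 1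
      simpa using this

/-- The limit of the residue at a row which can be increased for generic parameters: if it cannot be
increased on `ℳ`, then the residue tends to zero. -/
lemma Resonant.tendsto_coefEF_of_isAdmissible (h : Resonant P a b) (hl : IsAdmissible a b l)
    (hN : SuppLE l N) (hr : r.2 < N) :
    Tendsto (fun Q => 1 / (1 - Q.1) * (Q.1 / (1 - Q.1)) * coefEF N Q l r) (genericNhds P)
      (𝓝 (stepE P a b l r * stepF P a b l r)) := by
  have h1 : 1 - P.1 ≠ 0 := sub_ne_zero.2 h.q₁_ne_one.symm
  by_cases hg : Growable l r
  · have e : stepE P a b l r * stepF P a b l r =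
        1 / (1 - P.1) * (P.1 / (1 - P.1)) * coefEF N P l r := by
      by_cases hl' : IsAdmissible a b (addBox l r.1 r.2)
      · rw [h.isStepCoef_stepE.eq l r N hl hl' hN hr, h.isStepCoef_stepF.eq l r N hl hl' hN hr,
          coefEF]
        ring
      · rw [h.isStepCoef_stepE.zero l r fun hc => hl' hc.2,
          h.coefEF_eq_zero_of_growable hl hl' hr]
        ring
    rw [e]
    exact ((tendsto_const_nhds.div (tendsto_const_nhds.sub tendsto_q₁) h1).mul
      (tendsto_q₁.div (tendsto_const_nhds.sub tendsto_q₁) h1)).mul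
      ((h.tendsto_coefN totalRel_rowLt N hl hg).mul (h.tendsto_coefN totalRel_rowGt N hl hg))
  -- the row above has the same length, and its contribution vanishes for all generic parameters
  · rw [h.isStepCoef_stepE.zero l r fun hc => hg (growable_of_isAdmissible hc.2), zero_mul]
    refine Tendsto.congr' (f₁ := fun _ => 0) ?_ tendsto_const_nhds
    filter_upwards [eventually_generic] with Q hQ
    unfold Growable at hg
    push Not at hg
    have hle := hl.1 r.1 (show r.2 - 1 ≤ r.2 by omega)
    have heq : l r.1 (r.2 - 1) = l r.1 r.2 := le_antisymm hg.2 hle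
    rw [coefEF_eq_zero hQ.mul_eq hQ.u_ne (c := (r.1, r.2 - 1)) (by simp only; omega)
      (fun hc => by have := congrArg Prod.snd hc; simp only at this; omega) (.inr ?_), mul_zero]
    rw [pt_eq, pt_eq]
    simp only
    rw [heq]
    obtain ⟨s, hs⟩ := Nat.exists_eq_succ_of_ne_zero hg.1
    rw [hs, Nat.succ_eq_add_one, Nat.add_sub_cancel, pow_succ]
    ring

/-- The limit of the residue at a row which can be decreased for generic parameters: if it cannot be
decreased on `ℳ`, then the residue tends to zero. -/
lemma Resonant.tendsto_coefEF_of_addBox (h : Resonant P a b)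
    (hl : IsAdmissible a b (addBox m r.1 r.2)) (hN : SuppLE m N) (hr : r.2 < N) :
    Tendsto (fun Q => 1 / (1 - Q.1) * (Q.1 / (1 - Q.1)) * coefEF N Q m r) (genericNhds P)
      (𝓝 (stepE P a b m r * stepF P a b m r)) := by
  have h1 : 1 - P.1 ≠ 0 := sub_ne_zero.2 h.q₁_ne_one.symm
  by_cases hs : Shrinkable m r
  · have e : stepE P a b m r * stepF P a b m r =
        1 / (1 - P.1) * (P.1 / (1 - P.1)) * coefEF N P m r := by
      by_cases hm : IsAdmissible a b m
      · rw [h.isStepCoef_stepE.eq m r N hm hl hN hr, h.isStepCoef_stepF.eq m r N hm hl hN hr,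
          coefEF]
        ring
      · rw [h.isStepCoef_stepE.zero m r fun hc => hm hc.1,
          h.coefEF_eq_zero_of_addBox hl hm hN]
        ring
    rw [e]
    have hlim : ∀ {R : Row n → Row n → Prop}, TotalRel R →
        Tendsto (fun Q => coefN R N Q m r) (genericNhds P) (𝓝 (coefN R N P m r)) := fun hR =>
      (continuousAt_coefN h.mul_eq h.u_ne hR N (fun _ hr => h.pt_ne_of_addBox hl hs hr)
        (fun r' => h.pt_ne_q₁_mul_pt_of_addBox hl r')).tendsto.mono_left nhdsWithin_le_nhds
    exact ((tendsto_const_nhds.div (tendsto_const_nhds.sub tendsto_q₁) h1).mul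
      (tendsto_q₁.div (tendsto_const_nhds.sub tendsto_q₁) h1)).mul
      ((hlim totalRel_rowLt).mul (hlim totalRel_rowGt))
  -- the row below is longer by one, and its contribution vanishes for all generic parameters
  · rw [h.isStepCoef_stepE.zero m r fun hc => hs (shrinkable_of_isAdmissible hc.1), zero_mul]
    refine Tendsto.congr' (f₁ := fun _ => 0) ?_ tendsto_const_nhds
    filter_upwards [eventually_generic] with Q hQ
    unfold Shrinkable at hs
    push Not at hs
    have hle := hl.1 r.1 (show r.2 ≤ r.2 + 1 by omega)
    have e1 := addBox_apply m r r
    have hne : (r.1, r.2 + 1) ≠ r := fun hc => by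
      have := congrArg Prod.snd hc; simp only at this; omega
    have e2 := addBox_apply m r (r.1, r.2 + 1)
    rw [if_neg hne] at e2
    rw [if_pos rfl] at e1
    simp only at e2
    have heq : m r.1 (r.2 + 1) = m r.1 r.2 + 1 := by omega
    have hlt : r.2 + 1 < N := by
      by_contra hc
      have := hN r.1 (r.2 + 1) (by omega)
      omega
    rw [coefEF_eq_zero hQ.mul_eq hQ.u_ne (c := (r.1, r.2 + 1)) hlt hne (.inl ?_), mul_zero]
    rw [pt_eq, pt_eq]
    simp only
    rw [heq, pow_succ, pow_succ]
    linear_combination (- Q.1 ^ m r.1 r.2 * Q.2.2.1 ^ r.2 * Q.2.2.2 r.1) * hQ.mul_eq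

end ResonantLimits

/-! ### Expansions and partial fractions -/

section PartialFractions

variable {ι : Type*} [DecidableEq ι]

/-- The residue at `T = 1 / d a`, up to normalization, of `∏ (1 - c b T) / (1 - d b T)`: the
coefficient of `1 / (1 - d a T)` in the partial fraction decomposition. -/
def residue (s : Finset ι) (c d : ι → ℂ) (a : ι) : ℂ :=
  ∏ b ∈ s, (1 - c b / d a) / (if b = a then 1 else 1 - d b / d a)

lemma mul_div_mul_partial {K : Type*} [Field K] {b c d T X Y Z : K} (r : K) (hX : X = 1 - d * T)
    (hY : Y = 1 - b * T) (hX0 : X ≠ 0) (hY0 : Y ≠ 0) (h : d ≠ b) (hZ : Z = 1 - c * T) :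
    Z / X * (r * Y⁻¹) =
      r * ((d - c) * (d - b)⁻¹) * X⁻¹ + r * -((b - c) * (d - b)⁻¹) * Y⁻¹ := by
  have := sub_ne_zero.2 h
  field_simp
  rw [hX, hY, hZ]
  ring

/-- Partial fractions for simple poles, over any field containing `ℂ`. The field varies in the
induction, since the residue at a new pole is obtained from the decomposition over `ℂ`. -/
theorem partial_fractions (s : Finset ι) (c d : ι → ℂ) (hd : ∀ a ∈ s, d a ≠ 0)
    (hinj : Set.InjOn d s) :
    ∀ (K : Type) [Field K] [Algebra ℂ K] (T : K), (∀ a ∈ s, 1 - d a • T ≠ 0) →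
    ∏ a ∈ s, (1 - c a • T) / (1 - d a • T) =
      algebraMap ℂ K (∏ a ∈ s, c a / d a) +
        ∑ a ∈ s, algebraMap ℂ K (residue s c d a) * (1 - d a • T)⁻¹ := by
  induction s using Finset.induction_on with
  | empty => intro K _ _ T _; simp
  | insert e s he ih =>
    intro K _ _ T hT
    have hd' : ∀ a ∈ s, d a ≠ 0 := fun a ha => hd a (Finset.mem_insert_of_mem ha)
    have hinj' : Set.InjOn d s := hinj.mono (by simp)
    have hde := hd e (Finset.mem_insert_self _ _)
    have hne : ∀ a ∈ s, d a ≠ d e := fun a ha h => he (by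
      have := hinj (Finset.mem_coe.2 (Finset.mem_insert_of_mem ha))
        (Finset.mem_coe.2 (Finset.mem_insert_self e s)) h
      exact this ▸ ha)
    have hTe := hT e (Finset.mem_insert_self _ _)
    have hTs : ∀ a ∈ s, 1 - d a • T ≠ 0 := fun a ha => hT a (Finset.mem_insert_of_mem ha)
    -- the residue at the new pole is the value of the old function there
    have res_e : residue (insert e s) c d e = (1 - c e / d e) * (∏ a ∈ s, c a / d a +
        ∑ a ∈ s, residue s c d a * (1 - d a / d e)⁻¹) := by
      have := ih hd' hinj' ℂ (1 / d e) (fun a ha => by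
        rw [smul_eq_mul, mul_one_div, sub_ne_zero, ne_comm, ne_eq, div_eq_one_iff_eq hde]
        exact hne a ha)
      simp only [smul_eq_mul, mul_one_div, Algebra.algebraMap_self, RingHom.id_apply] at this
      rw [residue, Finset.prod_insert he, if_pos rfl, div_one, ← this]
      congr 1
      refine Finset.prod_congr rfl fun b hb => ?_
      rw [if_neg (fun h : b = e => he (h ▸ hb))]
    have res_s : ∀ a ∈ s, residue (insert e s) c d a =
        (1 - c e / d a) / (1 - d e / d a) * residue s c d a := by
      intro a ha
      rw [residue, Finset.prod_insert he, if_neg (fun h : e = a => he (h ▸ ha)), residue]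
    have alg : ∀ x : ℂ, x • T = algebraMap ℂ K x * T := fun x => Algebra.smul_def x T
    have key : ∀ a ∈ s, (1 - c e • T) / (1 - d e • T) *
        (algebraMap ℂ K (residue s c d a) * (1 - d a • T)⁻¹) =
        algebraMap ℂ K ((1 - c e / d e) * (residue s c d a * (1 - d a / d e)⁻¹)) *
          (1 - d e • T)⁻¹ +
        algebraMap ℂ K ((1 - c e / d a) / (1 - d e / d a) * residue s c d a) *
          (1 - d a • T)⁻¹ := by
      intro a ha
      have h1 := hTs a ha
      have h2 := hd' a ha
      have h3 : d e - d a ≠ 0 := sub_ne_zero.2 (hne a ha).symm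
      have h3' : d a - d e ≠ 0 := sub_ne_zero.2 (hne a ha)
      have e1 : (1 - c e / d e) * (residue s c d a * (1 - d a / d e)⁻¹) =
          residue s c d a * ((d e - c e) * (d e - d a)⁻¹) := by
        have : 1 - d a / d e ≠ 0 := by
          rw [sub_ne_zero, ne_comm, ne_eq, div_eq_one_iff_eq hde]; exact hne a ha
        field_simp
      have e2 : (1 - c e / d a) / (1 - d e / d a) * residue s c d a =
          residue s c d a * -((d a - c e) * (d e - d a)⁻¹) := by
        have : 1 - d e / d a ≠ 0 := by
          rw [sub_ne_zero, ne_comm, ne_eq, div_eq_one_iff_eq h2]; exact (hne a ha).symm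
        field_simp
        ring
      rw [e1, e2, mul_div_mul_partial (d := algebraMap ℂ K (d e)) (b := algebraMap ℂ K (d a))
        (c := algebraMap ℂ K (c e)) (T := T) _ (by rw [alg]) (by rw [alg]) hTe h1
        (fun h => hne a ha ((algebraMap ℂ K).injective h).symm)]
      · simp only [map_mul, map_neg, map_sub, map_inv₀]
      · rw [alg]
    have e0 : (1 - c e • T) / (1 - d e • T) = algebraMap ℂ K (c e / d e) +
        algebraMap ℂ K (1 - c e / d e) * (1 - d e • T)⁻¹ := by
      have h0 : algebraMap ℂ K (d e) ≠ 0 := (map_ne_zero _).2 hde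
      have hX : 1 - d e • T = 1 - algebraMap ℂ K (d e) * T := by rw [alg]
      generalize 1 - d e • T = X at hX hTe
      simp only [alg, map_sub, map_one, map_div₀]
      field_simp
      rw [hX]
      ring
    have hsum : ∑ a ∈ s, algebraMap ℂ K (residue (insert e s) c d a) * (1 - d a • T)⁻¹ =
        ∑ a ∈ s, algebraMap ℂ K ((1 - c e / d a) / (1 - d e / d a) * residue s c d a) *
          (1 - d a • T)⁻¹ := Finset.sum_congr rfl fun a ha => by rw [res_s a ha]
    rw [Finset.prod_insert he, Finset.prod_insert he, Finset.sum_insert he, ih hd' hinj' K T hTs,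
      res_e, hsum, mul_add, Finset.mul_sum, Finset.sum_congr rfl key, Finset.sum_add_distrib,
      ← Finset.sum_mul, e0, mul_add, Finset.mul_sum, map_add, map_sum, map_mul, map_mul]
    ring

end PartialFractions

/-! ### Laurent expansions -/

section Expansions

/-- The variable `T = 1 / z`, expanded at `z = ∞`. -/
def varPlus : LaurentSeries ℂ := HahnSeries.single (1 : ℤ) 1
/-- The variable `T = 1 / z`, expanded at `z = 0`. -/
def varMinus : LaurentSeries ℂ := HahnSeries.single (-1 : ℤ) 1

lemma C_mul_single_one (c : ℂ) (k : ℤ) :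
    (HahnSeries.C c * HahnSeries.single k 1 : LaurentSeries ℂ) = HahnSeries.single k c := by
  simp

lemma algebraMap_laurent (c : ℂ) : algebraMap ℂ (LaurentSeries ℂ) c = HahnSeries.C c := by
  rw [HahnSeries.algebraMap_apply', PowerSeries.algebraMap_apply, Algebra.algebraMap_self,
    RingHom.id_apply, HahnSeries.ofPowerSeries_C]

-- The instance is spelled out, since it differs syntactically from the action on Hahn series.
lemma smul_varPlus (c : ℂ) :
    (letI : SMul ℂ (LaurentSeries ℂ) := Algebra.toSMul; c • varPlus) =
      HahnSeries.single (1 : ℤ) c := by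
  rw [Algebra.smul_def, algebraMap_laurent, varPlus, C_mul_single_one]

lemma smul_varMinus (c : ℂ) :
    (letI : SMul ℂ (LaurentSeries ℂ) := Algebra.toSMul; c • varMinus) =
      HahnSeries.single (-1 : ℤ) c := by
  rw [Algebra.smul_def, algebraMap_laurent, varMinus, C_mul_single_one]

lemma one_sub_smul_varPlus_ne (c : ℂ) :
    1 - (letI : SMul ℂ (LaurentSeries ℂ) := Algebra.toSMul; c • varPlus) ≠ 0 := by
  rw [smul_varPlus]
  intro h
  have := congrArg (fun f : LaurentSeries ℂ => f.coeff 0) h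
  simp [HahnSeries.coeff_one] at this

lemma one_sub_smul_varMinus_ne (c : ℂ) :
    1 - (letI : SMul ℂ (LaurentSeries ℂ) := Algebra.toSMul; c • varMinus) ≠ 0 := by
  rw [smul_varMinus]
  intro h
  have := congrArg (fun f : LaurentSeries ℂ => f.coeff 0) h
  simp [HahnSeries.coeff_one] at this

/-- The geometric series `∑ d^k X^k`. -/
def geom (d : ℂ) : PowerSeries ℂ := PowerSeries.mk fun k => d ^ k

lemma geom_mul (d : ℂ) : (1 - PowerSeries.C d * PowerSeries.X) * geom d = 1 := by
  ext k
  rw [sub_mul, one_mul, map_sub, mul_assoc, PowerSeries.coeff_C_mul]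
  cases k with
  | zero => simp [geom]
  | succ k => simp [geom, PowerSeries.coeff_succ_X_mul, pow_succ', PowerSeries.coeff_one]

lemma inv_one_sub_single_one (d : ℂ) :
    (1 -  HahnSeries.single (1 : ℤ) d)⁻¹ = HahnSeries.ofPowerSeries ℤ ℂ (geom d) := by
  rw [inv_eq_iff_eq_inv, eq_comm, inv_eq_iff_eq_inv, eq_comm]
  refine inv_eq_of_mul_eq_one_right ?_
  have e := congrArg (HahnSeries.ofPowerSeries ℤ ℂ) (geom_mul d)
  rw [map_mul, map_sub, map_one, map_mul, HahnSeries.ofPowerSeries_C,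
    HahnSeries.ofPowerSeries_X, C_mul_single_one] at e
  exact e

lemma inv_one_sub_single_neg {d : ℂ} (hd : d ≠ 0) :
    (1 - HahnSeries.single (-1 : ℤ) d)⁻¹ = 1 - HahnSeries.ofPowerSeries ℤ ℂ (geom d⁻¹) := by
  have e := congrArg (HahnSeries.ofPowerSeries ℤ ℂ) (geom_mul d⁻¹)
  rw [map_mul, map_sub, map_one, map_mul, HahnSeries.ofPowerSeries_C,
    HahnSeries.ofPowerSeries_X] at e
  refine inv_eq_of_mul_eq_one_right ?_
  have h1 : HahnSeries.single (-1 : ℤ) d * (HahnSeries.C d⁻¹ * HahnSeries.single (1 : ℤ) 1) = 1 := by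
    simp [hd]
  linear_combination (HahnSeries.single (-1 : ℤ) d) * e + (HahnSeries.ofPowerSeries ℤ ℂ (geom d⁻¹) ) * h1

lemma coeff_inv_one_sub_single_one (d : ℂ) (k : ℕ) :
    ((1 - HahnSeries.single (1 : ℤ) d)⁻¹).coeff (k : ℤ) = d ^ k := by
  rw [inv_one_sub_single_one, HahnSeries.ofPowerSeries_apply_coeff, geom, PowerSeries.coeff_mk]

lemma coeff_inv_one_sub_single_neg {d : ℂ} (hd : d ≠ 0) (k : ℕ) :
    ((1 - HahnSeries.single (-1 : ℤ) d)⁻¹).coeff (k : ℤ) = (if k = 0 then 1 else 0) - (d⁻¹) ^ k := by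
  rw [inv_one_sub_single_neg hd, HahnSeries.coeff_sub, HahnSeries.ofPowerSeries_apply_coeff,
    geom, PowerSeries.coeff_mk, HahnSeries.coeff_one]
  simp

/-- The expansion of `∏ (1 - c a / z) / (1 - d a / z)` as a power series in `1 / z`. -/
def expandPlus {ι : Type*} (s : Finset ι) (c d : ι → ℂ) : PowerSeries ℂ :=
  ∏ a ∈ s, (1 - PowerSeries.C (c a) * PowerSeries.X) * geom (d a)

/-- The expansion of `∏ (1 - c a / z) / (1 - d a / z)` as a power series in `z`, for `d a ≠ 0`. -/
def expandMinus {ι : Type*} (s : Finset ι) (c d : ι → ℂ) : PowerSeries ℂ :=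
  ∏ a ∈ s, PowerSeries.C (d a)⁻¹ * (PowerSeries.C (c a) - PowerSeries.X) * geom (d a)⁻¹

lemma prod_eq_expandPlus {ι : Type*} (s : Finset ι) (c d : ι → ℂ) :
    ∏ a ∈ s, (1 - HahnSeries.single (1 : ℤ) (c a) : LaurentSeries ℂ) /
        (1 - HahnSeries.single (1 : ℤ) (d a)) =
      HahnSeries.ofPowerSeries ℤ ℂ (expandPlus s c d) := by
  rw [expandPlus, map_prod]
  refine Finset.prod_congr rfl fun a _ => ?_
  rw [div_eq_mul_inv, inv_one_sub_single_one, map_mul, map_sub, map_one, map_mul,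
    HahnSeries.ofPowerSeries_C, HahnSeries.ofPowerSeries_X, C_mul_single_one]

lemma one_sub_div_one_sub_eq {K : Type*} [Field K] {t v D D' g : K} (e : (1 - D' * t) * g = 1)
    (h1 : D * D' = 1) (h3 : v * t = 1) (h0 : 1 - D * v ≠ 0) (C' : K) :
    (1 - C' * v) / (1 - D * v) = D' * (C' - t) * g := by
  rw [div_eq_iff h0]
  have h4 : D' * (1 - D * v) * g = -v := by
    linear_combination (-v * g) * h1 - v * e - D' * g * h3
  linear_combination (t - C') * h4 - h3

lemma prod_eq_expandMinus {ι : Type*} (s : Finset ι) (c d : ι → ℂ) (hd : ∀ a ∈ s, d a ≠ 0) :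
    ∏ a ∈ s, (1 - HahnSeries.single (-1 : ℤ) (c a) : LaurentSeries ℂ) /
        (1 - HahnSeries.single (-1 : ℤ) (d a)) =
      HahnSeries.ofPowerSeries ℤ ℂ (expandMinus s c d) := by
  rw [expandMinus, map_prod]
  refine Finset.prod_congr rfl fun a ha => ?_
  have hda := hd a ha
  have e := congrArg (HahnSeries.ofPowerSeries ℤ ℂ) (geom_mul (d a)⁻¹)
  rw [map_mul, map_sub, map_one, map_mul, HahnSeries.ofPowerSeries_C,
    HahnSeries.ofPowerSeries_X] at e
  have h0 : (1 - HahnSeries.single (-1 : ℤ) (d a) : LaurentSeries ℂ) ≠ 0 := by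
    rw [← smul_varMinus]; exact one_sub_smul_varMinus_ne _
  have h1 : (HahnSeries.C (d a) : LaurentSeries ℂ) * HahnSeries.C (d a)⁻¹ = 1 := by
    rw [← map_mul, mul_inv_cancel₀ hda, map_one]
  have h3 : (HahnSeries.single (-1 : ℤ) 1 * HahnSeries.single (1 : ℤ) 1 : LaurentSeries ℂ) = 1 := by
    rw [HahnSeries.single_mul_single]; simp
  have h5 := one_sub_div_one_sub_eq e h1 h3 (by rwa [C_mul_single_one]) (HahnSeries.C (c a))
  rw [C_mul_single_one, C_mul_single_one] at h5
  rw [h5, map_mul, map_mul, map_sub, HahnSeries.ofPowerSeries_C, HahnSeries.ofPowerSeries_X,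
    HahnSeries.ofPowerSeries_C]

lemma continuousAt_coeff_prod {X ι : Type*} [TopologicalSpace X] {x : X} (s : Finset ι)
    (f : ι → X → PowerSeries ℂ)
    (hf : ∀ a ∈ s, ∀ k, ContinuousAt (fun y => PowerSeries.coeff k (f a y)) x) (k : ℕ) :
    ContinuousAt (fun y => PowerSeries.coeff k (∏ a ∈ s, f a y)) x := by
  classical
  induction s using Finset.induction_on generalizing k with
  | empty => simp only [Finset.prod_empty]; exact continuousAt_const
  | insert e s he ih =>
    simp only [Finset.prod_insert he, PowerSeries.coeff_mul]
    refine tendsto_finsetSum _ fun p _ => ?_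
    exact (hf e (Finset.mem_insert_self _ _) _).mul
      (ih (fun a ha => hf a (Finset.mem_insert_of_mem ha)) _)

end Expansions

/-! ### The eigenvalues of `ψ^±` -/

section Eigenvalues

variable {n : ℕ} {P Q : Params n} {l : Tuple n} {N : ℕ}

/-- The common rational function whose expansions are `tensorPsiPlus` and `tensorPsiMinus`, at
`T = 1 / z`. -/
def tensorPsi {K : Type*} [Field K] [Algebra ℂ K] (Q : Params n) (l : Tuple n) (T : K) : K :=
  ∏ i, fockPsi Q.1 Q.2.1 Q.2.2.1 (l i) (Q.2.2.2 i • T)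

lemma tensorPsiPlus_eq (Q : Params n) (l : Tuple n) :
    tensorPsiPlus Q l = tensorPsi Q l varPlus := by
  unfold tensorPsi
  exact Finset.prod_congr rfl fun i _ => by rw [smul_varPlus]

lemma tensorPsiMinus_eq (Q : Params n) (l : Tuple n) :
    tensorPsiMinus Q l = tensorPsi Q l varMinus := by
  unfold tensorPsi
  exact Finset.prod_congr rfl fun i _ => by rw [smul_varMinus]

lemma tensorPsi_eq_truncated {K : Type*} [Field K] [Algebra ℂ K] {T : K}
    (hT : ∀ c : ℂ, 1 - c • T ≠ 0) (h : Q.1 * Q.2.1 * Q.2.2.1 = 1) (hl : SuppLE l N) :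
    tensorPsi Q l T = (∏ j, psiEmpty Q.2.1 (pt Q l (j, N) • T)) *
      ∏ r ∈ rows n N, phi Q.1 Q.2.1 Q.2.2.1 (pt Q l r • T) := by
  rw [tensorPsi, rows, Finset.prod_product, ← Finset.prod_mul_distrib]
  refine Finset.prod_congr rfl fun i _ => ?_
  rw [fockPsi_eq_truncated h _ _ (hl i) (fun j => by rw [smul_smul]; exact hT _)
    (fun j => by rw [smul_smul]; exact hT _)]
  congr 1
  · rw [smul_smul, pt_eq, hl i N le_rfl, pow_zero, one_mul]
  · refine Finset.prod_congr rfl fun j _ => ?_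
    rw [smul_smul, pt_eq]

/-- Adding a box multiplies the eigenvalue of `ψ^±(z)` by `-g(v, z) / g(z, v)`. -/
lemma tensorPsi_addBox {K : Type*} [Field K] [Algebra ℂ K] {T : K}
    (hT : ∀ c : ℂ, 1 - c • T ≠ 0) (h : Q.1 * Q.2.1 * Q.2.2.1 = 1) (l : Tuple n) (r : Row n) :
    tensorPsi Q (addBox l r.1 r.2) T * ((1 - (Q.1 * pt Q l r) • T) *
        (1 - (Q.2.1 * pt Q l r) • T) * (1 - (Q.2.2.1 * pt Q l r) • T)) =
      tensorPsi Q l T * ((1 - (Q.1⁻¹ * pt Q l r) • T) *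
        (1 - (Q.2.1⁻¹ * pt Q l r) • T) * (1 - (Q.2.2.1⁻¹ * pt Q l r) • T)) := by
  obtain ⟨N, hN, hr⟩ := exists_suppLE l {r}
  have hr : r.2 < N := hr r (by simp)
  rw [tensorPsi_eq_truncated hT h hN, tensorPsi_eq_truncated hT h (hN.addBox hr),
    ← Finset.mul_prod_erase _ _ (mem_rows.2 hr),
    ← Finset.mul_prod_erase _ (fun x => phi Q.1 Q.2.1 Q.2.2.1 (pt Q l x • T)) (mem_rows.2 hr),
    pt_addBox_self]
  have e1 : ∏ j, psiEmpty Q.2.1 (pt Q (addBox l r.1 r.2) (j, N) • T) =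
      ∏ j, psiEmpty Q.2.1 (pt Q l (j, N) • T) :=
    Finset.prod_congr rfl fun j _ => by
      rw [pt_addBox_of_ne l (fun hc => by rw [← hc] at hr; exact lt_irrefl _ hr)]
  have e2 : ∏ x ∈ (rows n N).erase r, phi Q.1 Q.2.1 Q.2.2.1 (pt Q (addBox l r.1 r.2) x • T) =
      ∏ x ∈ (rows n N).erase r, phi Q.1 Q.2.1 Q.2.2.1 (pt Q l x • T) :=
    Finset.prod_congr rfl fun x hx => by rw [pt_addBox_of_ne l (Finset.ne_of_mem_erase hx)]
  have e3 := phi_smul_mul (K := K) h (y := pt Q l r • T) (by rw [smul_smul]; exact hT _)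
    (by rw [smul_smul]; exact hT _)
  simp only [smul_smul] at e3
  rw [e1, e2]
  linear_combination (∏ j, psiEmpty Q.2.1 (pt Q l (j, N) • T)) *
    (∏ x ∈ (rows n N).erase r, phi Q.1 Q.2.1 Q.2.2.1 (pt Q l x • T)) * e3

/-- The linear factors of the truncated formula: for each row of index less than `N` the two
factors of `phi`, and one factor for the tail of each member. -/
abbrev PoleIndex (n : ℕ) : Type := (Row n ⊕ Row n) ⊕ Fin n

/-- The linear factors which are present in the truncation at `N`. -/
def poles (n N : ℕ) : Finset (PoleIndex n) :=
  ((rows n N).disjSum (rows n N)).disjSum Finset.univ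

/-- The zeros of the linear factors. -/
def zeroPt (N : ℕ) (Q : Params n) (l : Tuple n) : PoleIndex n → ℂ
  | .inl (.inl r) => Q.2.2.1 * pt Q l r
  | .inl (.inr r) => Q.2.1 * pt Q l r
  | .inr j => Q.2.1 * pt Q l (j, N)

/-- The poles of the linear factors. -/
def polePt (N : ℕ) (Q : Params n) (l : Tuple n) : PoleIndex n → ℂ
  | .inl (.inl r) => pt Q l r
  | .inl (.inr r) => Q.1⁻¹ * pt Q l r
  | .inr j => pt Q l (j, N)

lemma polePt_ne_zero (h : Q.1 * Q.2.1 * Q.2.2.1 = 1) (hu : ∀ i, Q.2.2.2 i ≠ 0) (a : PoleIndex n) :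
    polePt N Q l a ≠ 0 := by
  rcases a with (r | r) | j
  · exact pt_ne_zero h hu l r
  · exact mul_ne_zero (inv_ne_zero (ne_zero_of_mul₁ h)) (pt_ne_zero h hu l r)
  · exact pt_ne_zero h hu l _

lemma zeroPt_ne_zero (h : Q.1 * Q.2.1 * Q.2.2.1 = 1) (hu : ∀ i, Q.2.2.2 i ≠ 0) (a : PoleIndex n) :
    zeroPt N Q l a ≠ 0 := by
  rcases a with (r | r) | j
  · exact mul_ne_zero (ne_zero_of_mul₃ h) (pt_ne_zero h hu l r)
  · exact mul_ne_zero (ne_zero_of_mul₂ h) (pt_ne_zero h hu l r)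
  · exact mul_ne_zero (ne_zero_of_mul₂ h) (pt_ne_zero h hu l _)

lemma tensorPsi_eq_prod_poles {K : Type*} [Field K] [Algebra ℂ K] {T : K}
    (hT : ∀ c : ℂ, 1 - c • T ≠ 0) (h : Q.1 * Q.2.1 * Q.2.2.1 = 1) (hl : SuppLE l N) :
    tensorPsi Q l T =
      ∏ a ∈ poles n N, (1 - zeroPt N Q l a • T) / (1 - polePt N Q l a • T) := by
  rw [tensorPsi_eq_truncated hT h hl, poles, Finset.prod_disjSum, Finset.prod_disjSum, mul_comm,
    ← Finset.prod_mul_distrib]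
  congr 1
  · refine Finset.prod_congr rfl fun r _ => ?_
    simp only [phi, zeroPt, polePt, smul_smul, mul_div_mul_comm]
  · refine Finset.prod_congr rfl fun j _ => ?_
    simp only [psiEmpty, zeroPt, polePt, smul_smul]

lemma tensorPsiPlus_eq_expand (h : Q.1 * Q.2.1 * Q.2.2.1 = 1) (hl : SuppLE l N) :
    tensorPsiPlus Q l = HahnSeries.ofPowerSeries ℤ ℂ
      (expandPlus (poles n N) (zeroPt N Q l) (polePt N Q l)) := by
  rw [tensorPsiPlus_eq, tensorPsi_eq_prod_poles one_sub_smul_varPlus_ne h hl,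
    ← prod_eq_expandPlus]
  exact Finset.prod_congr rfl fun a _ => by rw [smul_varPlus, smul_varPlus]

lemma tensorPsiMinus_eq_expand (h : Q.1 * Q.2.1 * Q.2.2.1 = 1) (hu : ∀ i, Q.2.2.2 i ≠ 0)
    (hl : SuppLE l N) :
    tensorPsiMinus Q l = HahnSeries.ofPowerSeries ℤ ℂ
      (expandMinus (poles n N) (zeroPt N Q l) (polePt N Q l)) := by
  rw [tensorPsiMinus_eq, tensorPsi_eq_prod_poles one_sub_smul_varMinus_ne h hl,
    ← prod_eq_expandMinus _ _ _ fun a _ => polePt_ne_zero h hu a]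
  exact Finset.prod_congr rfl fun a _ => by rw [smul_varMinus, smul_varMinus]

lemma coeff_ofPowerSeries_of_neg (f : PowerSeries ℂ) {k : ℤ} (hk : k < 0) :
    (HahnSeries.ofPowerSeries ℤ ℂ f).coeff k = 0 := by
  rw [HahnSeries.ofPowerSeries_apply]
  refine HahnSeries.embDomain_of_notMem_range ?_
  rintro ⟨m, rfl⟩
  simp at hk
  omega

lemma coeff_tensorPsiPlus_of_neg (h : Q.1 * Q.2.1 * Q.2.2.1 = 1) (l : Tuple n) {k : ℤ}
    (hk : k < 0) : (tensorPsiPlus Q l).coeff k = 0 := by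
  obtain ⟨N, hN, -⟩ := exists_suppLE l ∅
  rw [tensorPsiPlus_eq_expand h hN, coeff_ofPowerSeries_of_neg _ hk]

lemma coeff_tensorPsiMinus_of_neg (h : Q.1 * Q.2.1 * Q.2.2.1 = 1) (hu : ∀ i, Q.2.2.2 i ≠ 0)
    (l : Tuple n) {k : ℤ} (hk : k < 0) : (tensorPsiMinus Q l).coeff k = 0 := by
  obtain ⟨N, hN, -⟩ := exists_suppLE l ∅
  rw [tensorPsiMinus_eq_expand h hu hN, coeff_ofPowerSeries_of_neg _ hk]

lemma coeff_tensorPsiPlus_zero (h : Q.1 * Q.2.1 * Q.2.2.1 = 1) (l : Tuple n) :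
    (tensorPsiPlus Q l).coeff 0 ≠ 0 := by
  obtain ⟨N, hN, -⟩ := exists_suppLE l ∅
  have := HahnSeries.ofPowerSeries_apply_coeff (Γ := ℤ)
    (expandPlus (poles n N) (zeroPt N Q l) (polePt N Q l)) 0
  rw [Nat.cast_zero] at this
  rw [tensorPsiPlus_eq_expand h hN, this, PowerSeries.coeff_zero_eq_constantCoeff_apply,
    expandPlus, map_prod]
  refine Finset.prod_ne_zero_iff.2 fun a _ => ?_
  rw [map_mul, ← PowerSeries.coeff_zero_eq_constantCoeff_apply (geom _)]
  simp [geom]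

lemma coeff_tensorPsiMinus_zero (h : Q.1 * Q.2.1 * Q.2.2.1 = 1) (hu : ∀ i, Q.2.2.2 i ≠ 0)
    (l : Tuple n) : (tensorPsiMinus Q l).coeff 0 ≠ 0 := by
  obtain ⟨N, hN, -⟩ := exists_suppLE l ∅
  have := HahnSeries.ofPowerSeries_apply_coeff (Γ := ℤ)
    (expandMinus (poles n N) (zeroPt N Q l) (polePt N Q l)) 0
  rw [Nat.cast_zero] at this
  rw [tensorPsiMinus_eq_expand h hu hN, this, PowerSeries.coeff_zero_eq_constantCoeff_apply,
    expandMinus, map_prod]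
  refine Finset.prod_ne_zero_iff.2 fun a _ => ?_
  rw [map_mul, ← PowerSeries.coeff_zero_eq_constantCoeff_apply (geom _)]
  simp [geom, polePt_ne_zero h hu a, zeroPt_ne_zero h hu a]

lemma continuous_zeroPt (N : ℕ) (l : Tuple n) (a : PoleIndex n) :
    Continuous fun Q : Params n => zeroPt N Q l a := by
  rcases a with (r | r) | j <;> simp only [zeroPt, pt_eq] <;> fun_prop

lemma continuousAt_polePt (h : P.1 ≠ 0) (N : ℕ) (l : Tuple n) (a : PoleIndex n) :
    ContinuousAt (fun Q : Params n => polePt N Q l a) P := by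
  rcases a with (r | r) | j
  · exact (continuous_pt l r).continuousAt
  · exact (continuousAt_fst.inv₀ h).mul (continuous_pt l r).continuousAt
  · exact (continuous_pt l _).continuousAt

lemma continuousAt_coeff_mul {X : Type*} [TopologicalSpace X] {x : X} {f g : X → PowerSeries ℂ}
    (hf : ∀ k, ContinuousAt (fun y => PowerSeries.coeff k (f y)) x)
    (hg : ∀ k, ContinuousAt (fun y => PowerSeries.coeff k (g y)) x) (k : ℕ) :
    ContinuousAt (fun y => PowerSeries.coeff k (f y * g y)) x := by
  simp only [PowerSeries.coeff_mul]
  exact tendsto_finsetSum _ fun p _ => (hf _).mul (hg _)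

lemma tendsto_coeff_tensorPsiPlus (h : P.1 * P.2.1 * P.2.2.1 = 1) (l : Tuple n) (k : ℕ) :
    Tendsto (fun Q => (tensorPsiPlus Q l).coeff (k : ℤ)) (genericNhds P)
      (𝓝 ((tensorPsiPlus P l).coeff (k : ℤ))) := by
  obtain ⟨N, hN, -⟩ := exists_suppLE l ∅
  have hc : ContinuousAt (fun Q => PowerSeries.coeff k
      (expandPlus (poles n N) (zeroPt N Q l) (polePt N Q l))) P := by
    refine continuousAt_coeff_prod _ _ (fun a _ => continuousAt_coeff_mul (fun k => ?_)
      (fun k => ?_)) k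
    · simp only [map_sub, PowerSeries.coeff_C_mul]
      exact continuousAt_const.sub ((continuous_zeroPt N l a).continuousAt.mul continuousAt_const)
    · simp only [geom, PowerSeries.coeff_mk]
      exact (continuousAt_polePt (ne_zero_of_mul₁ h) N l a).pow k
  rw [tensorPsiPlus_eq_expand h hN, HahnSeries.ofPowerSeries_apply_coeff]
  refine (hc.tendsto.mono_left nhdsWithin_le_nhds).congr' ?_
  filter_upwards [eventually_generic] with Q hQ
  rw [tensorPsiPlus_eq_expand hQ.mul_eq hN, HahnSeries.ofPowerSeries_apply_coeff]

lemma tendsto_coeff_tensorPsiMinus (h : P.1 * P.2.1 * P.2.2.1 = 1) (hu : ∀ i, P.2.2.2 i ≠ 0)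
    (l : Tuple n) (k : ℕ) :
    Tendsto (fun Q => (tensorPsiMinus Q l).coeff (k : ℤ)) (genericNhds P)
      (𝓝 ((tensorPsiMinus P l).coeff (k : ℤ))) := by
  obtain ⟨N, hN, -⟩ := exists_suppLE l ∅
  have hc : ContinuousAt (fun Q => PowerSeries.coeff k
      (expandMinus (poles n N) (zeroPt N Q l) (polePt N Q l))) P := by
    have hp : ∀ a, ContinuousAt (fun Q => (polePt N Q l a)⁻¹) P := fun a =>
      (continuousAt_polePt (ne_zero_of_mul₁ h) N l a).inv₀ (polePt_ne_zero h hu a)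
    refine continuousAt_coeff_prod _ _ (fun a _ => continuousAt_coeff_mul (fun k => ?_)
      (fun k => ?_)) k
    · simp only [map_sub, PowerSeries.coeff_C_mul, PowerSeries.coeff_C]
      refine (hp a).mul (ContinuousAt.sub ?_ continuousAt_const)
      split_ifs
      · exact (continuous_zeroPt N l a).continuousAt
      · exact continuousAt_const
    · simp only [geom, PowerSeries.coeff_mk]
      exact (hp a).pow k
  rw [tensorPsiMinus_eq_expand h hu hN, HahnSeries.ofPowerSeries_apply_coeff]
  refine (hc.tendsto.mono_left nhdsWithin_le_nhds).congr' ?_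
  filter_upwards [eventually_generic] with Q hQ
  rw [tensorPsiMinus_eq_expand hQ.mul_eq hQ.u_ne hN, HahnSeries.ofPowerSeries_apply_coeff]

/-- The coefficient of `z^{-k}` in `ψ⁺(z) - ψ⁻(z)` on `|l⟩`. -/
def psiDiff (Q : Params n) (l : Tuple n) (k : ℤ) : ℂ :=
  (tensorPsiPlus Q l).coeff k - (tensorPsiMinus Q l).coeff (-k)

lemma tendsto_psiDiff (h : P.1 * P.2.1 * P.2.2.1 = 1) (hu : ∀ i, P.2.2.2 i ≠ 0) (l : Tuple n)
    (k : ℤ) : Tendsto (fun Q => psiDiff Q l k) (genericNhds P) (𝓝 (psiDiff P l k)) := by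
  refine Tendsto.sub ?_ ?_
  · rcases lt_or_ge k 0 with hk | hk
    · rw [coeff_tensorPsiPlus_of_neg h l hk]
      refine tendsto_const_nhds.congr' ?_
      filter_upwards [eventually_generic] with Q hQ
      rw [coeff_tensorPsiPlus_of_neg hQ.mul_eq l hk]
    · lift k to ℕ using hk
      exact tendsto_coeff_tensorPsiPlus h l k
  · rcases lt_or_ge (-k) 0 with hk | hk
    · rw [coeff_tensorPsiMinus_of_neg h hu l hk]
      refine tendsto_const_nhds.congr' ?_
      filter_upwards [eventually_generic] with Q hQ
      rw [coeff_tensorPsiMinus_of_neg hQ.mul_eq hQ.u_ne l hk]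
    · obtain ⟨m, hm⟩ := Int.eq_ofNat_of_zero_le hk
      rw [hm]
      exact tendsto_coeff_tensorPsiMinus h hu l m

end Eigenvalues

/-! ### The difference of the two expansions as a sum over poles -/

section PsiDiff

variable {n : ℕ} {P Q : Params n} {l m : Tuple n} {N : ℕ} {r : Row n}

lemma coeff_geom_sub {d : ℂ} (hd : d ≠ 0) (k : ℤ) :
    ((1 - HahnSeries.single (1 : ℤ) d : LaurentSeries ℂ)⁻¹).coeff k -
      ((1 - HahnSeries.single (-1 : ℤ) d : LaurentSeries ℂ)⁻¹).coeff (-k) = d ^ k := by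
  rcases lt_trichotomy k 0 with hk | rfl | hk
  · rw [inv_one_sub_single_one, coeff_ofPowerSeries_of_neg _ hk]
    obtain ⟨m, hm⟩ := Int.eq_ofNat_of_zero_le (show 0 ≤ -k by omega)
    rw [hm, coeff_inv_one_sub_single_neg hd, if_neg (by omega), show k = -(m : ℤ) by omega]
    simp
  · have h1 := coeff_inv_one_sub_single_one d 0
    have h2 := coeff_inv_one_sub_single_neg hd 0
    simp only [Nat.cast_zero] at h1 h2
    rw [neg_zero, h1, h2]
    simp
  · rw [inv_one_sub_single_neg hd, HahnSeries.coeff_sub, coeff_ofPowerSeries_of_neg _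
      (show -k < 0 by omega), HahnSeries.coeff_one, if_neg (by omega)]
    lift k to ℕ using hk.le
    rw [coeff_inv_one_sub_single_one]
    simp

/-- The expansions of `1 / (1 - d T)` at `T = 0` and at `T = ∞` differ by `∑ d^k T^k`, so the
expansions of a rational function differ by a sum of delta functions at its poles. -/
lemma coeff_sub_coeff_eq_sum {ι : Type*} [DecidableEq ι] (s : Finset ι) (c d : ι → ℂ)
    (hd : ∀ a ∈ s, d a ≠ 0) (hinj : Set.InjOn d s) (k : ℤ) :
    (∏ a ∈ s, (1 - HahnSeries.single (1 : ℤ) (c a) : LaurentSeries ℂ) /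
        (1 - HahnSeries.single (1 : ℤ) (d a))).coeff k -
      (∏ a ∈ s, (1 - HahnSeries.single (-1 : ℤ) (c a) : LaurentSeries ℂ) /
        (1 - HahnSeries.single (-1 : ℤ) (d a))).coeff (-k) =
      ∑ a ∈ s, residue s c d a * d a ^ k := by
  have h1 := partial_fractions s c d hd hinj (LaurentSeries ℂ) varPlus
    fun a _ => one_sub_smul_varPlus_ne _
  have h2 := partial_fractions s c d hd hinj (LaurentSeries ℂ) varMinus
    fun a _ => one_sub_smul_varMinus_ne _
  simp_rw [smul_varPlus] at h1
  simp_rw [smul_varMinus] at h2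
  rw [h1, h2]
  simp only [algebraMap_laurent, HahnSeries.coeff_add, HahnSeries.coeff_sum,
    HahnSeries.C_mul_eq_smul, HahnSeries.coeff_smul, smul_eq_mul]
  have e : (HahnSeries.C (∏ a ∈ s, c a / d a) : LaurentSeries ℂ).coeff k =
      (HahnSeries.C (∏ a ∈ s, c a / d a) : LaurentSeries ℂ).coeff (-k) := by
    generalize ∏ a ∈ s, c a / d a = κ
    simp [HahnSeries.C_apply, HahnSeries.coeff_single, neg_eq_zero]
  rw [e, add_sub_add_left_eq_sub, ← Finset.sum_sub_distrib]
  refine Finset.sum_congr rfl fun a ha => ?_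
  rw [← mul_sub, coeff_geom_sub (hd a ha)]

/-- For generic parameters all poles of the truncated formula are simple. -/
lemma IsGeneric.injective_polePt (h : IsGeneric Q) :
    Set.InjOn (polePt N Q l) (poles n N) := by
  have q1 := ne_zero_of_mul₁ h.mul_eq
  have key : ∀ (r r' : Row n) (ε ε' : ℤ), Q.1 ^ ε * pt Q l r = Q.1 ^ ε' * pt Q l r' →
      r = r' ∧ ε = ε' := by
    intro r r' ε ε' e
    have := h.eq_of_mul_eq (x := ε + l r.1 r.2) (y := r.2) (x' := ε' + l r'.1 r'.2) (y' := r'.2)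
      (i := r.1) (j := r'.1) (by
        rw [zpow_add₀ q1, zpow_add₀ q1]
        rw [pt_eq, pt_eq] at e
        simp only [zpow_natCast]
        linear_combination e)
    have hr : r = r' := Prod.ext this.2.2 (by exact_mod_cast this.2.1)
    subst hr
    exact ⟨rfl, by omega⟩
  rintro ((r | r) | j) ha ((r' | r') | j') ha' e <;>
    simp only [poles, Finset.mem_coe, Finset.inl_mem_disjSum, Finset.inr_mem_disjSum, mem_rows,
      polePt] at e ha ha'
  · rw [(key r r' 0 0 (by simpa using e)).1]
  · have := (key r r' 0 (-1) (by simpa using e)).2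
    omega
  · have := (key r (j', N) 0 0 (by simpa using e)).1
    subst this
    simp at ha
  · have := (key r r' (-1) 0 (by simpa using e)).2
    omega
  · rw [(key r r' (-1) (-1) (by simpa using e)).1]
  · have := (key r (j', N) (-1) 0 (by simpa using e)).2
    omega
  · have := (key (j, N) r' 0 0 (by simpa using e)).1
    subst this
    simp at ha'
  · have := (key (j, N) r' 0 (-1) (by simpa using e)).2
    omega
  · have := (key (j, N) (j', N) 0 0 (by simpa using e)).1
    have := (Prod.ext_iff.1 this).1
    simp only at this
    rw [this]

/-- In the product of the coefficients for the two orders each other row contributes exactly once. -/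
lemma coefEF_eq (hr : r.2 < N) : coefEF N Q l r =
    (∏ j, psiEmpty Q.2.1 (pt Q l (j, N) / pt Q l r)) *
      ∏ r' ∈ (rows n N).erase r, phi Q.1 Q.2.1 Q.2.2.1 (pt Q l r' / pt Q l r) := by
  classical
  have tot : ∀ r' : Row n, r' ≠ r → (rowGt r' r ↔ ¬ rowLt r' r) := fun r' h => by
    have := totalRel_rowLt.total r r' h.symm
    unfold rowGt
    tauto
  have e1 : Finset.univ.filter (fun j : Fin n => rowGt (j, N) r) =
      Finset.univ.filter (fun j : Fin n => ¬ rowLt (j, N) r) :=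
    Finset.filter_congr fun j _ => tot _ (fun hc => by rw [← hc] at hr; exact lt_irrefl _ hr)
  have e2 : (rows n N).filter (fun r' => rowGt r' r) =
      ((rows n N).erase r).filter (fun r' => ¬ rowLt r' r) := by
    ext r'
    simp only [Finset.mem_filter, Finset.mem_erase]
    by_cases h : r' = r
    · subst h
      simp [rowGt, totalRel_rowLt.irrefl r']
    · simp [h, tot r' h]
  have e3 : (rows n N).filter (fun r' => rowLt r' r) =
      ((rows n N).erase r).filter (fun r' => rowLt r' r) := by
    ext r'
    simp only [Finset.mem_filter, Finset.mem_erase]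
    by_cases h : r' = r
    · subst h
      simp [totalRel_rowLt.irrefl r']
    · simp [h]
  unfold coefEF coefN
  rw [e1, e2, e3, ← Finset.prod_filter_mul_prod_filter_not Finset.univ
    (fun j : Fin n => rowLt (j, N) r), ← Finset.prod_filter_mul_prod_filter_not
    ((rows n N).erase r) (fun r' => rowLt r' r)]
  ring

/-- The residue at a point `x` of the product over the poles, if the row `r` contributes `w`. -/
lemma prod_poles_eq (hr : r.2 < N) (x : ℂ) (f : PoleIndex n → ℂ)
    (hf₁ : ∀ r' ≠ r, f (.inl (.inl r')) = 1 - pt Q l r' / x)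
    (hf₂ : ∀ r' ≠ r, f (.inl (.inr r')) = 1 - Q.1⁻¹ * pt Q l r' / x)
    (hf₃ : ∀ j, f (.inr j) = 1 - pt Q l (j, N) / x) :
    ∏ a ∈ poles n N, (1 - zeroPt N Q l a / x) / f a =
      (1 - Q.2.2.1 * pt Q l r / x) * (1 - Q.2.1 * pt Q l r / x) /
        (f (.inl (.inl r)) * f (.inl (.inr r))) *
      ((∏ j, psiEmpty Q.2.1 (pt Q l (j, N) / x)) *
        ∏ r' ∈ (rows n N).erase r, phi Q.1 Q.2.1 Q.2.2.1 (pt Q l r' / x)) := by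
  rw [poles, Finset.prod_disjSum, Finset.prod_disjSum, ← Finset.prod_mul_distrib,
    ← Finset.mul_prod_erase _ _ (mem_rows.2 hr), mul_assoc, mul_comm (∏ j, psiEmpty _ _)]
  congr 1
  · simp only [zeroPt, mul_div_mul_comm]
  · congr 1
    · refine Finset.prod_congr rfl fun r' hr' => ?_
      have := Finset.ne_of_mem_erase hr'
      rw [hf₁ r' this, hf₂ r' this]
      simp only [zeroPt, phi, smul_eq_mul, div_mul_div_comm, mul_div_assoc]
    · refine Finset.prod_congr rfl fun j _ => ?_
      rw [hf₃]
      simp only [zeroPt, psiEmpty, smul_eq_mul, mul_div_assoc]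

/-- The residue at the point of a row is the product of the coefficients for adding and removing a
box in this row. -/
lemma IsGeneric.residue_inl_inl (h : IsGeneric Q) (hr : r.2 < N) :
    residue (poles n N) (zeroPt N Q l) (polePt N Q l) (.inl (.inl r)) =
      (1 - Q.2.2.1) * (1 - Q.2.1) / (1 - Q.1⁻¹) * coefEF N Q l r := by
  have h0 := pt_ne_zero h.mul_eq h.u_ne l r
  rw [coefEF_eq hr, residue]
  rw [prod_poles_eq (l := l) (Q := Q) hr (polePt N Q l (.inl (.inl r)))
    (fun b => if b = .inl (.inl r) then 1 else 1 - polePt N Q l b / polePt N Q l (.inl (.inl r)))]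
  · simp [polePt, h0]
  · intro r' hr'; simp [polePt, hr']
  · intro r' hr'; simp [polePt]
  · intro j; simp [polePt]

/-- The residue at the point of the last box of a row is, up to a constant, the product of the
coefficients for removing this box and adding it again. -/
lemma IsGeneric.residue_inl_inr (h : IsGeneric Q) (hr : r.2 < N)
    (hm : addBox m r.1 r.2 = l) :
    residue (poles n N) (zeroPt N Q l) (polePt N Q l) (.inl (.inr r)) =
      (1 - Q.1 * Q.2.2.1) * (1 - Q.1 * Q.2.1) / (1 - Q.1) * coefEF N Q m r := by
  have q1 := ne_zero_of_mul₁ h.mul_eq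
  have h0 := pt_ne_zero h.mul_eq h.u_ne m r
  have e0 : polePt N Q l (.inl (.inr r)) = pt Q m r := by
    rw [← hm]
    simp only [polePt, pt_addBox_self]
    field_simp
  have e1 : pt Q l r = Q.1 * pt Q m r := by rw [← hm, pt_addBox_self]
  have e2 : ∀ r', r' ≠ r → pt Q l r' = pt Q m r' := fun r' hr' => by
    rw [← hm, pt_addBox_of_ne m hr']
  have e3 : ∀ j, pt Q l (j, N) = pt Q m (j, N) := fun j => e2 _ fun hc => by
    rw [← hc] at hr; exact lt_irrefl _ hr
  rw [coefEF_eq hr, residue, e0]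
  rw [prod_poles_eq (l := l) (Q := Q) hr (pt Q m r)
    (fun b => if b = .inl (.inr r) then 1 else 1 - polePt N Q l b / pt Q m r)]
  · rw [e1]
    congr 1
    · simp only [polePt, e1, reduceCtorEq, Sum.inl.injEq, if_true, if_false]
      rw [mul_one, ← mul_assoc, ← mul_assoc, mul_div_cancel_right₀ _ h0,
        mul_div_cancel_right₀ _ h0, mul_div_cancel_right₀ _ h0, mul_comm Q.1 Q.2.2.1,
        mul_comm Q.1 Q.2.1]
    · congr 1
      · exact Finset.prod_congr rfl fun j _ => by rw [e3]
      · exact Finset.prod_congr rfl fun r' hr' => by rw [e2 _ (Finset.ne_of_mem_erase hr')]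
  · intro r' hr'; simp [polePt]
  · intro r' hr'; simp [polePt, hr']
  · intro j; simp [polePt]

lemma residue_eq_zero {ι : Type*} [DecidableEq ι] {s : Finset ι} {c d : ι → ℂ} {a b : ι}
    (hb : b ∈ s) (ha : d a ≠ 0) (h : c b = d a) : residue s c d a = 0 := by
  rw [residue]
  exact Finset.prod_eq_zero hb (by rw [h, div_self ha, sub_self, zero_div])

/-- The pole below an empty row is cancelled by the next row. -/
lemma IsGeneric.residue_inl_inr_eq_zero (h : IsGeneric Q) (hl : SuppLE l N)
    (ha : Antitone (l r.1)) (hr : r.2 < N) (h0 : l r.1 r.2 = 0) :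
    residue (poles n N) (zeroPt N Q l) (polePt N Q l) (.inl (.inr r)) = 0 := by
  have q1 := ne_zero_of_mul₁ h.mul_eq
  have h1 : l r.1 (r.2 + 1) = 0 := Nat.le_zero.1 (h0 ▸ ha (Nat.le_succ r.2))
  have e : Q.2.1 * pt Q l (r.1, r.2 + 1) = Q.1⁻¹ * pt Q l r := by
    rw [pt_eq, pt_eq, h0, h1]
    field_simp
    linear_combination (Q.2.2.1 ^ r.2 * Q.2.2.2 r.1) * h.mul_eq
  rcases Nat.lt_or_ge (r.2 + 1) N with hN | hN
  · refine residue_eq_zero (b := .inl (.inr (r.1, r.2 + 1))) ?_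
      (polePt_ne_zero h.mul_eq h.u_ne _) e
    simpa [poles] using hN
  · obtain rfl : N = r.2 + 1 := by omega
    exact residue_eq_zero (b := .inr r.1) (by simp [poles]) (polePt_ne_zero h.mul_eq h.u_ne _) e

/-- The pole of the empty tail is cancelled by the last row before it, which is empty, too. -/
lemma IsGeneric.residue_inr_eq_zero (h : IsGeneric Q) (hl : SuppLE l N) (j : Fin n) :
    residue (poles n (N + 1)) (zeroPt (N + 1) Q l) (polePt (N + 1) Q l) (.inr j) = 0 := by
  refine residue_eq_zero (b := .inl (.inl (j, N))) (by simp [poles])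
    (polePt_ne_zero h.mul_eq h.u_ne _) ?_
  simp only [zeroPt, polePt, pt_eq, hl j N le_rfl, hl j (N + 1) (by omega)]
  ring

/-- The product `g(1,1) = (1 - q₁)(1 - q₂)(1 - q₃)`. -/
def gOne (Q : Params n) : ℂ := (1 - Q.1) * (1 - Q.2.1) * (1 - Q.2.2.1)

/-- The diagonal part of the relation between `e(z)` and `f(w)`, for generic parameters. -/
lemma IsGeneric.psiDiff_eq (h : IsGeneric Q) (h1 : Q.1 ≠ 1) (hl : SuppLE l N)
    (ha : ∀ i, Antitone (l i)) (k : ℤ) :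
    psiDiff Q l k = gOne Q *
      (∑ r ∈ rows n (N + 1), (if l r.1 r.2 = 0 then 0 else
        1 / (1 - Q.1) * (Q.1 / (1 - Q.1)) * coefEF (N + 1) Q (subBox l r) r *
          pt Q (subBox l r) r ^ k) -
      ∑ r ∈ rows n (N + 1), 1 / (1 - Q.1) * (Q.1 / (1 - Q.1)) * coefEF (N + 1) Q l r *
        pt Q l r ^ k) := by
  have q1 := ne_zero_of_mul₁ h.mul_eq
  have h1' : 1 - Q.1 ≠ 0 := sub_ne_zero.2 h1.symm
  have hl' : SuppLE l (N + 1) := fun i j hj => hl i j (by omega)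
  have hs := coeff_sub_coeff_eq_sum (poles n (N + 1)) (zeroPt (N + 1) Q l) (polePt (N + 1) Q l)
    (fun a _ => polePt_ne_zero h.mul_eq h.u_ne a) h.injective_polePt k
  rw [prod_eq_expandPlus, prod_eq_expandMinus _ _ _ fun a _ => polePt_ne_zero h.mul_eq h.u_ne a,
    ← tensorPsiPlus_eq_expand h.mul_eq hl', ← tensorPsiMinus_eq_expand h.mul_eq h.u_ne hl'] at hs
  rw [psiDiff, hs, poles, Finset.sum_disjSum, Finset.sum_disjSum]
  rw [← poles, Finset.sum_eq_zero (s := Finset.univ) fun j _ => by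
    rw [h.residue_inr_eq_zero hl j, zero_mul], add_zero, add_comm, mul_sub, Finset.mul_sum,
    Finset.mul_sum, sub_eq_add_neg, ← Finset.sum_neg_distrib]
  have hq := h.mul_eq
  congr 1
  · refine Finset.sum_congr rfl fun r hr => ?_
    rw [mem_rows] at hr
    split_ifs with h0
    · rw [h.residue_inl_inr_eq_zero hl' (ha _) hr h0]; simp
    · have hm := addBox_subBox (l := l) (r := r) (by omega)
      rw [h.residue_inl_inr hr hm]
      have e0 : polePt (N + 1) Q l (.inl (.inr r)) = pt Q (subBox l r) r := by
        conv_lhs => rw [← hm]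
        simp only [polePt, pt_addBox_self]
        field_simp
      rw [e0, gOne]
      field_simp
      have : (1 - Q.1 * Q.2.2.1) * (1 - Q.1 * Q.2.1) = Q.1 * (1 - Q.2.1) * (1 - Q.2.2.1) := by
        linear_combination (Q.1 - 1) * hq
      linear_combination (coefEF (N + 1) Q (subBox l r) r * pt Q (subBox l r) r ^ k) * this
  · refine Finset.sum_congr rfl fun r hr => ?_
    rw [mem_rows] at hr
    rw [h.residue_inl_inl hr, gOne]
    have e : 1 - Q.1⁻¹ = -(1 - Q.1) / Q.1 := by field_simp; ring
    rw [e]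
    simp only [polePt]
    field_simp

variable [NeZero n] {a b : Fin n → ℕ}

/-- The diagonal part of the relation between `e(z)` and `f(w)` on `ℳ`, as a limit of the relation
for generic parameters. -/
lemma Resonant.psiDiff_eq (h : Resonant P a b) (hl : IsAdmissible a b l) (hN : SuppLE l N) (k : ℤ) :
    psiDiff P l k = gOne P *
      (∑ r ∈ rows n (N + 1), (if l r.1 r.2 = 0 then 0 else
        stepE P a b (subBox l r) r * stepF P a b (subBox l r) r * pt P (subBox l r) r ^ k) -
      ∑ r ∈ rows n (N + 1), stepE P a b l r * stepF P a b l r * pt P l r ^ k) := by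
  have := h.neBot
  have hN' : SuppLE l (N + 1) := fun i j hj => hN i j (by omega)
  have hpt : ∀ (l : Tuple n) r, Tendsto (fun Q => pt Q l r ^ k) (genericNhds P)
      (𝓝 (pt P l r ^ k)) := fun l r =>
    (((continuous_pt l r).continuousAt.zpow₀ k
      (.inl (pt_ne_zero h.mul_eq h.u_ne l r))).tendsto).mono_left nhdsWithin_le_nhds
  refine tendsto_nhds_unique (tendsto_psiDiff h.mul_eq h.u_ne l k) ?_
  have hne : ∀ᶠ Q in genericNhds P, Q.1 ≠ 1 := tendsto_q₁.eventually_ne h.q₁_ne_one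
  have hg : Tendsto (gOne (n := n)) (genericNhds P) (𝓝 (gOne P)) := by
    have : Continuous (gOne (n := n)) := by unfold gOne; fun_prop
    exact (this.tendsto P).mono_left nhdsWithin_le_nhds
  have hlim := hg.mul ((tendsto_finsetSum (rows n (N + 1)) fun r hr =>
    show Tendsto (fun Q => if l r.1 r.2 = 0 then 0 else
        1 / (1 - Q.1) * (Q.1 / (1 - Q.1)) * coefEF (N + 1) Q (subBox l r) r *
          pt Q (subBox l r) r ^ k) (genericNhds P) (𝓝 (if l r.1 r.2 = 0 then 0 else
        stepE P a b (subBox l r) r * stepF P a b (subBox l r) r * pt P (subBox l r) r ^ k)) by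
      split_ifs with h0
      · exact tendsto_const_nhds
      · have hm := addBox_subBox (l := l) (r := r) (by omega)
        exact (h.tendsto_coefEF_of_addBox (by rwa [hm]) (fun i j hj => by
          have := subBox_apply l r (i, j)
          simp only at this
          rw [this, hN' i j hj, Nat.zero_sub]) (mem_rows.1 hr)).mul (hpt _ r)).sub
    (tendsto_finsetSum (rows n (N + 1)) fun r hr =>
      (h.tendsto_coefEF_of_isAdmissible hl hN' (mem_rows.1 hr)).mul (hpt l r)))
  refine hlim.congr' ?_
  filter_upwards [eventually_generic, hne] with Q hQ h1
  exact (hQ.psiDiff_eq h1 hN hl.1 k).symm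

end PsiDiff

/-! ### Operators on the space `ℳ` -/

lemma SuppLE.mono {n : ℕ} {l : Tuple n} {N M : ℕ} (hl : SuppLE l N) (h : N ≤ M) : SuppLE l M :=
  fun i j hj => hl i j (h.trans hj)

section Ket

variable {n : ℕ} [NeZero n] {P : Params n} {a b : Fin n → ℕ} {R : Row n → Row n → Prop} {C : ℂ}
  {G : Tuple n → Row n → ℂ} {l : Tuple n} {N M : ℕ}

open scoped Classical in
/-- The basis vector `|l⟩` of `ℳ`, or zero if `l` is not admissible. -/
def ket (a b : Fin n → ℕ) (l : Tuple n) : MSpace a b :=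
  if h : IsAdmissible a b l then Finsupp.single ⟨l, h⟩ 1 else 0

lemma ket_coe (l : AdmTuple a b) : ket a b l.1 = Finsupp.single l 1 := by
  rw [ket, dif_pos l.2]

lemma ket_of_not (h : ¬ IsAdmissible a b l) : ket a b l = 0 := by
  rw [ket, dif_neg h]

lemma end_ext {V : Type*} [AddCommGroup V] [Module ℂ V] {A B : MSpace a b →ₗ[ℂ] V}
    (h : ∀ l, IsAdmissible a b l → A (ket a b l) = B (ket a b l)) : A = B := by
  refine Finsupp.lhom_ext' fun l => LinearMap.ext_ring ?_
  have := h l.1 l.2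
  rwa [ket_coe] at this

/-- The operator with matrix coefficients `G l r v^k` between `|l⟩` and `|l + 1_r⟩`, where `v` is
the point of the added box. -/
def eOp (P : Params n) (a b : Fin n → ℕ) (G : Tuple n → Row n → ℂ) (k : ℤ) :
    Module.End ℂ (MSpace a b) :=
  Finsupp.linearCombination ℂ fun l : AdmTuple a b =>
    ∑ r ∈ rows n ((exists_suppLE l.1 ∅).choose + 1),
      (G l.1 r * pt P l.1 r ^ k) • ket a b (addBox l.1 r.1 r.2)

/-- The operator with matrix coefficients `G l r v^k` between `|l + 1_r⟩` and `|l⟩`, where `v` is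
the point of the removed box. -/
def fOp (P : Params n) (a b : Fin n → ℕ) (G : Tuple n → Row n → ℂ) (k : ℤ) :
    Module.End ℂ (MSpace a b) :=
  Finsupp.linearCombination ℂ fun l : AdmTuple a b =>
    ∑ r ∈ rows n (exists_suppLE l.1 ∅).choose, if l.1 r.1 r.2 = 0 then 0 else
      (G (subBox l.1 r) r * pt P (subBox l.1 r) r ^ k) • ket a b (subBox l.1 r)

/-- The diagonal operator with the eigenvalues `χ`. -/
def diagOp (a b : Fin n → ℕ) (χ : Tuple n → ℂ) : Module.End ℂ (MSpace a b) :=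
  Finsupp.linearCombination ℂ fun l : AdmTuple a b => χ l.1 • Finsupp.single l 1

lemma diagOp_ket (χ : Tuple n → ℂ) (l : Tuple n) :
    diagOp a b χ (ket a b l) = χ l • ket a b l := by
  by_cases h : IsAdmissible a b l
  · rw [show l = (⟨l, h⟩ : AdmTuple a b).1 from rfl, ket_coe, diagOp,
      Finsupp.linearCombination_single, one_smul]
  · rw [ket_of_not h, map_zero, smul_zero]

lemma IsStepCoef.lt_of_ne_zero (hG : IsStepCoef P a b R C G) (hl : SuppLE l N) {r : Row n}
    (h : G l r ≠ 0) : r.2 < N + 1 := by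
  by_contra hc
  refine h (hG.zero l r fun hadm => ?_)
  obtain h0 | h0 := growable_of_isAdmissible hadm.2
  · omega
  · rw [hl _ _ (show N ≤ r.2 - 1 by omega)] at h0
    omega

lemma IsStepCoef.isAdmissible (hG : IsStepCoef P a b R C G) {r : Row n} (h : G l r ≠ 0) :
    IsAdmissible a b l ∧ IsAdmissible a b (addBox l r.1 r.2) := by
  by_contra hc
  exact h (hG.zero l r hc)

lemma IsStepCoef.eOp_ket (hG : IsStepCoef P a b R C G) (hl : SuppLE l N) (hM : N + 1 ≤ M) (k : ℤ) :
    eOp P a b G k (ket a b l) =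
      ∑ r ∈ rows n M, (G l r * pt P l r ^ k) • ket a b (addBox l r.1 r.2) := by
  by_cases h : IsAdmissible a b l
  · rw [show l = (⟨l, h⟩ : AdmTuple a b).1 from rfl, ket_coe, eOp,
      Finsupp.linearCombination_single, one_smul]
    have hs := (exists_suppLE l ∅).choose_spec.1
    set N' := (exists_suppLE l ∅).choose
    have aux : ∀ {A B : ℕ}, SuppLE l A → A + 1 ≤ B → 
        ∑ r ∈ rows n (A + 1), (G l r * pt P l r ^ k) • ket a b (addBox l r.1 r.2) =
        ∑ r ∈ rows n B, (G l r * pt P l r ^ k) • ket a b (addBox l r.1 r.2) := by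
      intro A B hA hAB
      refine Finset.sum_subset (fun r hr => ?_) fun r _ hr => ?_
      · rw [mem_rows] at hr ⊢; omega
      · rw [mem_rows] at hr
        have : G l r = 0 := by
          by_contra hc
          exact hr (hG.lt_of_ne_zero hA hc)
        rw [this, zero_mul, zero_smul]
    exact (aux hs (le_max_left (N' + 1) M)).trans (((aux hl hM).symm.trans
      (aux hl (hM.trans (le_max_right _ _)))).symm)
  · rw [ket_of_not h, map_zero, Finset.sum_eq_zero]
    intro r _
    rw [hG.zero l r fun hc => h hc.1, zero_mul, zero_smul]

lemma fOp_ket (G : Tuple n → Row n → ℂ) (h : IsAdmissible a b l) (hl : SuppLE l N) (k : ℤ) :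
    fOp P a b G k (ket a b l) = ∑ r ∈ rows n N, if l r.1 r.2 = 0 then 0 else
      (G (subBox l r) r * pt P (subBox l r) r ^ k) • ket a b (subBox l r) := by
  rw [show l = (⟨l, h⟩ : AdmTuple a b).1 from rfl, ket_coe, fOp,
    Finsupp.linearCombination_single, one_smul]
  have hs := (exists_suppLE l ∅).choose_spec.1
  set N' := (exists_suppLE l ∅).choose
  have aux : ∀ {A B : ℕ}, SuppLE l A → A ≤ B → 
      (∑ r ∈ rows n A, if l r.1 r.2 = 0 then 0 else
      (G (subBox l r) r * pt P (subBox l r) r ^ k) • ket a b (subBox l r)) =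
      ∑ r ∈ rows n B, if l r.1 r.2 = 0 then 0 else
      (G (subBox l r) r * pt P (subBox l r) r ^ k) • ket a b (subBox l r) := by
    intro A B hA hAB
    refine Finset.sum_subset (fun r hr => ?_) fun r _ hr => ?_
    · rw [mem_rows] at hr ⊢; omega
    · rw [mem_rows] at hr
      rw [if_pos (hA _ _ (by omega))]
  exact (aux hs (le_max_left N' N)).trans (aux hl (le_max_right N' N)).symm

lemma IsStepCoef.eOp_eOp_ket (hG : IsStepCoef P a b R C G) (hl : SuppLE l N) (hM : N + 2 ≤ M)
    (j k : ℤ) : eOp P a b G j (eOp P a b G k (ket a b l)) =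
      ∑ x ∈ rows n M ×ˢ rows n M,
        (pt P (addBox l x.1.1 x.1.2) x.2 ^ j * pt P l x.1 ^ k) •
          (G l x.1 * G (addBox l x.1.1 x.1.2) x.2) •
            ket a b (addBox (addBox l x.1.1 x.1.2) x.2.1 x.2.2) := by
  rw [hG.eOp_ket hl (show N + 1 ≤ M by omega), map_sum, Finset.sum_product]
  refine Finset.sum_congr rfl fun r hr => ?_
  rw [map_smul]
  by_cases h : G l r = 0
  · simp [h]
  · rw [hG.eOp_ket (SuppLE.addBox (hl.mono (Nat.le_succ N)) (hG.lt_of_ne_zero hl h))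
      (show N + 1 + 1 ≤ M by omega), Finset.smul_sum]
    refine Finset.sum_congr rfl fun s _ => ?_
    simp only [smul_smul]
    congr 1
    ring

lemma IsStepCoef.eOp_eOp_eOp_ket (hG : IsStepCoef P a b R C G) (hl : SuppLE l N) (hM : N + 3 ≤ M)
    (i j k : ℤ) : eOp P a b G i (eOp P a b G j (eOp P a b G k (ket a b l))) =
      ∑ r₁ ∈ rows n M, ∑ r₂ ∈ rows n M, ∑ r₃ ∈ rows n M,
        (G l r₁ * G (addBox l r₁.1 r₁.2) r₂ * G (addBox (addBox l r₁.1 r₁.2) r₂.1 r₂.2) r₃ *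
          (pt P l r₁ ^ k * pt P (addBox l r₁.1 r₁.2) r₂ ^ j *
            pt P (addBox (addBox l r₁.1 r₁.2) r₂.1 r₂.2) r₃ ^ i)) •
          ket a b (addBox (addBox (addBox l r₁.1 r₁.2) r₂.1 r₂.2) r₃.1 r₃.2) := by
  rw [hG.eOp_ket hl (show N + 1 ≤ M by omega), map_sum, map_sum]
  refine Finset.sum_congr rfl fun r hr => ?_
  rw [map_smul, map_smul]
  by_cases h : G l r = 0
  · simp [h]
  · rw [hG.eOp_eOp_ket (SuppLE.addBox (hl.mono (Nat.le_succ N)) (hG.lt_of_ne_zero hl h))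
      (show N + 1 + 2 ≤ M by omega), Finset.sum_product, Finset.smul_sum]
    refine Finset.sum_congr rfl fun s _ => ?_
    rw [Finset.smul_sum]
    refine Finset.sum_congr rfl fun t _ => ?_
    simp only [smul_smul]
    congr 1
    ring

end Ket

/-! ### Multiplication of formal series by linear factors -/

section FormalSeries

variable {V W : Type*} [AddCommGroup V] [Module ℂ V] [AddCommGroup W] [Module ℂ W]

/-- `gZW` with coefficients in an arbitrary module. -/
def gZW' (q₁ q₂ q₃ : ℂ) (F : ℤ → ℤ → V) : ℤ → ℤ → V :=
  let m (q : ℂ) (F : ℤ → ℤ → V) : ℤ → ℤ → V := fun i j => F (i + 1) j - q • F i (j + 1)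
  m q₁ (m q₂ (m q₃ F))

/-- `gWZ` with coefficients in an arbitrary module. -/
def gWZ' (q₁ q₂ q₃ : ℂ) (F : ℤ → ℤ → V) : ℤ → ℤ → V :=
  let m (q : ℂ) (F : ℤ → ℤ → V) : ℤ → ℤ → V := fun i j => F i (j + 1) - q • F (i + 1) j
  m q₁ (m q₂ (m q₃ F))

lemma map_gZW' (Λ : V →ₗ[ℂ] W) (q₁ q₂ q₃ : ℂ) (F : ℤ → ℤ → V) (i j : ℤ) :
    Λ (gZW' q₁ q₂ q₃ F i j) = gZW' q₁ q₂ q₃ (fun i j => Λ (F i j)) i j := by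
  simp only [gZW', map_sub, map_smul]

lemma map_gWZ' (Λ : V →ₗ[ℂ] W) (q₁ q₂ q₃ : ℂ) (F : ℤ → ℤ → V) (i j : ℤ) :
    Λ (gWZ' q₁ q₂ q₃ F i j) = gWZ' q₁ q₂ q₃ (fun i j => Λ (F i j)) i j := by
  simp only [gWZ', map_sub, map_smul]

lemma gZW'_sum {ι : Type*} (s : Finset ι) (q₁ q₂ q₃ : ℂ) (F : ι → ℤ → ℤ → V) (i j : ℤ) :
    gZW' q₁ q₂ q₃ (fun i j => ∑ x ∈ s, F x i j) i j = ∑ x ∈ s, gZW' q₁ q₂ q₃ (F x) i j := by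
  simp only [gZW', Finset.smul_sum, ← Finset.sum_sub_distrib]

lemma gWZ'_sum {ι : Type*} (s : Finset ι) (q₁ q₂ q₃ : ℂ) (F : ι → ℤ → ℤ → V) (i j : ℤ) :
    gWZ' q₁ q₂ q₃ (fun i j => ∑ x ∈ s, F x i j) i j = ∑ x ∈ s, gWZ' q₁ q₂ q₃ (F x) i j := by
  simp only [gWZ', Finset.smul_sum, ← Finset.sum_sub_distrib]

lemma gZW'_pow {q₁ q₂ q₃ z w : ℂ} (hz : z ≠ 0) (hw : w ≠ 0) (x : V) (i j : ℤ) :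
    gZW' q₁ q₂ q₃ (fun i j => (z ^ i * w ^ j) • x) i j =
      (gPoly q₁ q₂ q₃ z w * (z ^ i * w ^ j)) • x := by
  simp only [gZW', smul_smul, ← sub_smul, zpow_add₀ hz, zpow_add₀ hw, zpow_one, gPoly]
  congr 1
  ring

lemma gWZ'_pow {q₁ q₂ q₃ z w : ℂ} (hz : z ≠ 0) (hw : w ≠ 0) (x : V) (i j : ℤ) :
    gWZ' q₁ q₂ q₃ (fun i j => (z ^ i * w ^ j) • x) i j =
      (gPoly q₁ q₂ q₃ w z * (z ^ i * w ^ j)) • x := by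
  simp only [gWZ', smul_smul, ← sub_smul, zpow_add₀ hz, zpow_add₀ hw, zpow_one, gPoly]
  congr 1
  ring

end FormalSeries

/-! ### Relations between the raising operators -/

section RaisingRelations

variable {n : ℕ} [NeZero n] {P : Params n} {a b : Fin n → ℕ} {R : Row n → Row n → Prop} {C : ℂ}
  {G : Tuple n → Row n → ℂ} {l : Tuple n} {N M : ℕ}

/-- The relation `g(z,w) e(z) e(w) = -g(w,z) e(w) e(z)`. -/
theorem IsStepCoef.quadratic_relation (hG : IsStepCoef P a b R C G) (hR : TotalRel R)
    (h : Resonant P a b) (i j : ℤ) :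
    gZW' P.1 P.2.1 P.2.2.1 (fun i j => eOp P a b G i * eOp P a b G j) i j =
      -gWZ' P.1 P.2.1 P.2.2.1 (fun i j => eOp P a b G j * eOp P a b G i) i j := by
  refine end_ext fun l _ => ?_
  obtain ⟨N, hN, -⟩ := exists_suppLE l ∅
  have hpt := fun l r => pt_ne_zero h.mul_eq h.u_ne l r
  have h1 := map_gZW' (LinearMap.applyₗ (ket a b l) : Module.End ℂ (MSpace a b) →ₗ[ℂ] _)
    P.1 P.2.1 P.2.2.1 (fun i j => eOp P a b G i * eOp P a b G j) i j
  have h2 := map_gWZ' (LinearMap.applyₗ (ket a b l) : Module.End ℂ (MSpace a b) →ₗ[ℂ] _)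
    P.1 P.2.1 P.2.2.1 (fun i j => eOp P a b G j * eOp P a b G i) i j
  simp only [LinearMap.applyₗ_apply_apply, Module.End.mul_apply,
    hG.eOp_eOp_ket hN le_rfl] at h1 h2
  rw [LinearMap.neg_apply, h1, h2, gZW'_sum, gWZ'_sum, ← Finset.sum_neg_distrib]
  -- exchanging the two rows matches the terms of the two sides
  refine Finset.sum_equiv (Equiv.prodComm _ _) (by simp [and_comm]) fun x _ => ?_
  obtain ⟨r, s⟩ := x
  rw [Equiv.prodComm_apply, Prod.swap_prod_mk]
  have e : ∀ i j : ℤ, pt P (addBox l s.1 s.2) r ^ j * pt P l s ^ i =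
    pt P l s ^ i * pt P (addBox l s.1 s.2) r ^ j := fun i j => mul_comm _ _
  simp only [e]
  rw [gZW'_pow (hpt _ _) (hpt _ _), gWZ'_pow (hpt _ _) (hpt _ _)]
  by_cases hrs : s = r
  · subst hrs
    rw [pt_addBox_self, gPoly_eq_zero₁]
    simp
  · rw [pt_addBox_of_ne l hrs, pt_addBox_of_ne l (Ne.symm hrs), addBox_comm l r s]
    have := hG.exchange hR h l hrs
    simp only [smul_smul, ← neg_smul]
    congr 1
    linear_combination (pt P l s ^ i * pt P l r ^ j) * this

/-- The summand for boxes in three given rows is not zero, but it is after symmetrization. -/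
theorem IsStepCoef.serre_relation (hG : IsStepCoef P a b R C G) (hR : TotalRel R)
    (h : Resonant P a b) :
    ⁅eOp P a b G 0, ⁅eOp P a b G 1, eOp P a b G (-1)⁆⁆ = 0 := by
  refine end_ext fun l _ => ?_
  obtain ⟨N, hN, -⟩ := exists_suppLE l ∅
  simp only [Ring.lie_def, mul_sub, sub_mul, LinearMap.sub_apply, Module.End.mul_apply,
    hG.eOp_eOp_eOp_ket hN le_rfl, LinearMap.zero_apply]
  set S := rows n (N + 3)
  set T : Row n → Row n → Row n → MSpace a b := fun r₁ r₂ r₃ => serreTerm P G l r₁ r₂ r₃ •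
    ket a b (addBox (addBox (addBox l r₁.1 r₁.2) r₂.1 r₂.2) r₃.1 r₃.2) with hT
  have sum_eq : ∑ r₁ ∈ S, ∑ r₂ ∈ S, ∑ r₃ ∈ S, T r₁ r₂ r₃ = 0 := by
    have sym : ∀ r₁ r₂ r₃, T r₁ r₂ r₃ + T r₁ r₃ r₂ + T r₂ r₁ r₃ + T r₂ r₃ r₁ + T r₃ r₁ r₂ +
        T r₃ r₂ r₁ = 0 := by
      intro r₁ r₂ r₃
      simp only [hT]
      rw [addBox_comm (addBox l r₁.1 r₁.2) r₃ r₂, addBox_comm l r₂ r₁,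
        addBox_comm (addBox l r₂.1 r₂.2) r₃ r₁, addBox_comm l r₂ r₁,
        addBox_comm l r₃ r₁, addBox_comm (addBox l r₁.1 r₁.2) r₃ r₂,
        addBox_comm l r₃ r₂, addBox_comm (addBox l r₂.1 r₂.2) r₃ r₁, addBox_comm l r₂ r₁]
      simp only [← add_smul]
      rw [hG.serre hR h l r₁ r₂ r₃, zero_smul]
    have s132 : ∑ r₁ ∈ S, ∑ r₂ ∈ S, ∑ r₃ ∈ S, T r₁ r₃ r₂ =
        ∑ r₁ ∈ S, ∑ r₂ ∈ S, ∑ r₃ ∈ S, T r₁ r₂ r₃ :=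
      Finset.sum_congr rfl fun r₁ _ => Finset.sum_comm
    have s213 : ∑ r₁ ∈ S, ∑ r₂ ∈ S, ∑ r₃ ∈ S, T r₂ r₁ r₃ =
        ∑ r₁ ∈ S, ∑ r₂ ∈ S, ∑ r₃ ∈ S, T r₁ r₂ r₃ :=
      Finset.sum_comm
    have s231 : ∑ r₁ ∈ S, ∑ r₂ ∈ S, ∑ r₃ ∈ S, T r₂ r₃ r₁ =
        ∑ r₁ ∈ S, ∑ r₂ ∈ S, ∑ r₃ ∈ S, T r₁ r₂ r₃ := by
      rw [Finset.sum_comm]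
      exact Finset.sum_congr rfl fun r₁ _ => Finset.sum_comm
    have s312 : ∑ r₁ ∈ S, ∑ r₂ ∈ S, ∑ r₃ ∈ S, T r₃ r₁ r₂ =
        ∑ r₁ ∈ S, ∑ r₂ ∈ S, ∑ r₃ ∈ S, T r₁ r₂ r₃ := by
      rw [← s213]
      exact Finset.sum_congr rfl fun r₁ _ => Finset.sum_comm
    have s321 : ∑ r₁ ∈ S, ∑ r₂ ∈ S, ∑ r₃ ∈ S, T r₃ r₂ r₁ =
        ∑ r₁ ∈ S, ∑ r₂ ∈ S, ∑ r₃ ∈ S, T r₁ r₂ r₃ := by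
      rw [← s231]
      exact Finset.sum_congr rfl fun r₁ _ => Finset.sum_comm
    have h0 : ∑ r₁ ∈ S, ∑ r₂ ∈ S, ∑ r₃ ∈ S, (T r₁ r₂ r₃ + T r₁ r₃ r₂ + T r₂ r₁ r₃ + T r₂ r₃ r₁ +
        T r₃ r₁ r₂ + T r₃ r₂ r₁) = 0 := by simp only [sym, Finset.sum_const_zero]
    simp only [Finset.sum_add_distrib] at h0
    rw [s132, s213, s231, s312, s321] at h0
    have : (6 : ℂ) • ∑ r₁ ∈ S, ∑ r₂ ∈ S, ∑ r₃ ∈ S, T r₁ r₂ r₃ = 0 := by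
      rw [← h0]; module
    exact (smul_eq_zero.1 this).resolve_left (by norm_num)
  rw [← sum_eq]
  simp only [← Finset.sum_sub_distrib, ← sub_smul]
  refine Finset.sum_congr rfl fun r₁ _ => Finset.sum_congr rfl fun r₂ _ =>
    Finset.sum_congr rfl fun r₃ _ => ?_
  simp only [hT, serreTerm, serreWeight]
  congr 1
  simp only [zpow_zero, zpow_one, zpow_neg, div_eq_mul_inv]
  ring

end RaisingRelations

/-! ### Relations between the raising and the diagonal operators -/

section DiagonalRelations

variable {n : ℕ} [NeZero n] {P : Params n} {a b : Fin n → ℕ} {R : Row n → Row n → Prop} {C : ℂ}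
  {G : Tuple n → Row n → ℂ} {l : Tuple n}

lemma coeff_one_sub_single_mul (ε i : ℤ) (c : ℂ) (f : LaurentSeries ℂ) :
    ((1 - HahnSeries.single ε c) * f).coeff (ε * (i + 1)) =
      f.coeff (ε * (i + 1)) - c * f.coeff (ε * i) := by
  rw [sub_mul, one_mul, HahnSeries.coeff_sub, mul_add, mul_one, HahnSeries.coeff_single_mul_add]

lemma gZW'_coeff (q₁ q₂ q₃ w : ℂ) (hw : w ≠ 0) (ε : ℤ) (f : LaurentSeries ℂ) (i j : ℤ) :
    gZW' q₁ q₂ q₃ (fun i j => f.coeff (ε * i) * w ^ j) i j =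
      ((1 - HahnSeries.single ε (q₁ * w)) * ((1 - HahnSeries.single ε (q₂ * w)) *
        ((1 - HahnSeries.single ε (q₃ * w)) * f))).coeff (ε * (i + 1 + 1 + 1)) * w ^ j := by
  simp only [coeff_one_sub_single_mul, gZW', smul_eq_mul, zpow_add₀ hw, zpow_one]
  ring

lemma gWZ'_coeff {q₁ q₂ q₃ : ℂ} (h : q₁ * q₂ * q₃ = 1) (w : ℂ) (hw : w ≠ 0) (ε : ℤ)
    (f : LaurentSeries ℂ) (i j : ℤ) :
    gWZ' q₁ q₂ q₃ (fun i j => f.coeff (ε * i) * w ^ j) i j =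
      -(((1 - HahnSeries.single ε (q₁⁻¹ * w)) * ((1 - HahnSeries.single ε (q₂⁻¹ * w)) *
        ((1 - HahnSeries.single ε (q₃⁻¹ * w)) * f))).coeff (ε * (i + 1 + 1 + 1)) * w ^ j) := by
  have h1 := ne_zero_of_mul₁ h
  have h2 := ne_zero_of_mul₂ h
  have h3 := ne_zero_of_mul₃ h
  have e3 : q₃ = q₁⁻¹ * q₂⁻¹ := by field_simp; linear_combination h
  subst e3
  simp only [coeff_one_sub_single_mul, gWZ', smul_eq_mul, zpow_add₀ hw, zpow_one]
  field_simp
  ring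

/-- The eigenvalues `χ i` of the modes of a series `ψ(z)` which commutes with `e(w)` in the way
prescribed by the relations of `ℰ`. -/
def IsPsiEigenvalue (P : Params n) (χ : ℤ → Tuple n → ℂ) : Prop :=
  ∀ l r i j, gZW' P.1 P.2.1 P.2.2.1 (fun i j => χ i (addBox l r.1 r.2) * pt P l r ^ j) i j =
    -gWZ' P.1 P.2.1 P.2.2.1 (fun i j => χ i l * pt P l r ^ j) i j

lemma Resonant.isPsiEigenvalue_plus (h : Resonant P a b) :
    IsPsiEigenvalue P fun i l => (tensorPsiPlus P l).coeff i := by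
  intro l r i j
  have hw := pt_ne_zero h.mul_eq h.u_ne l r
  have h1 := gZW'_coeff P.1 P.2.1 P.2.2.1 _ hw 1 (tensorPsiPlus P (addBox l r.1 r.2)) i j
  have h2 := gWZ'_coeff h.mul_eq _ hw 1 (tensorPsiPlus P l) i j
  have h3 := tensorPsi_addBox one_sub_smul_varPlus_ne h.mul_eq l r
  rw [← tensorPsiPlus_eq, ← tensorPsiPlus_eq] at h3
  simp only [smul_varPlus] at h3
  simp only [one_mul] at h1 h2
  rw [h1, h2, neg_neg]
  congr 2
  linear_combination h3

lemma Resonant.isPsiEigenvalue_minus (h : Resonant P a b) :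
    IsPsiEigenvalue P fun i l => (tensorPsiMinus P l).coeff (-i) := by
  intro l r i j
  have hw := pt_ne_zero h.mul_eq h.u_ne l r
  have h1 := gZW'_coeff P.1 P.2.1 P.2.2.1 _ hw (-1) (tensorPsiMinus P (addBox l r.1 r.2)) i j
  have h2 := gWZ'_coeff h.mul_eq _ hw (-1) (tensorPsiMinus P l) i j
  have h3 := tensorPsi_addBox one_sub_smul_varMinus_ne h.mul_eq l r
  rw [← tensorPsiMinus_eq, ← tensorPsiMinus_eq] at h3
  simp only [smul_varMinus] at h3
  simp only [neg_mul, one_mul] at h1 h2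
  rw [h1, h2, neg_neg]
  congr 2
  linear_combination h3

lemma gZW'_smul {V : Type*} [AddCommGroup V] [Module ℂ V] (q₁ q₂ q₃ : ℂ) (c : ℤ → ℤ → ℂ) (x : V)
    (i j : ℤ) : gZW' q₁ q₂ q₃ (fun i j => c i j • x) i j = gZW' q₁ q₂ q₃ c i j • x := by
  have := map_gZW' (LinearMap.toSpanSingleton ℂ V x) q₁ q₂ q₃ c i j
  simpa using this.symm

lemma gWZ'_smul {V : Type*} [AddCommGroup V] [Module ℂ V] (q₁ q₂ q₃ : ℂ) (c : ℤ → ℤ → ℂ) (x : V)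
    (i j : ℤ) : gWZ' q₁ q₂ q₃ (fun i j => c i j • x) i j = gWZ' q₁ q₂ q₃ c i j • x := by
  have := map_gWZ' (LinearMap.toSpanSingleton ℂ V x) q₁ q₂ q₃ c i j
  simpa using this.symm

/-- The relation between `ψ(z)` and `e(w)`. -/
theorem IsStepCoef.psi_relation (hG : IsStepCoef P a b R C G) {χ : ℤ → Tuple n → ℂ}
    (hχ : IsPsiEigenvalue P χ) (i j : ℤ) :
    gZW' P.1 P.2.1 P.2.2.1 (fun i j => diagOp a b (χ i) * eOp P a b G j) i j =
      -gWZ' P.1 P.2.1 P.2.2.1 (fun i j => eOp P a b G j * diagOp a b (χ i)) i j := by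
  refine end_ext fun l _ => ?_
  obtain ⟨N, hN, -⟩ := exists_suppLE l ∅
  have h1 := map_gZW' (LinearMap.applyₗ (ket a b l) : Module.End ℂ (MSpace a b) →ₗ[ℂ] _)
    P.1 P.2.1 P.2.2.1 (fun i j => diagOp a b (χ i) * eOp P a b G j) i j
  have h2 := map_gWZ' (LinearMap.applyₗ (ket a b l) : Module.End ℂ (MSpace a b) →ₗ[ℂ] _)
    P.1 P.2.1 P.2.2.1 (fun i j => eOp P a b G j * diagOp a b (χ i)) i j
  have e1 : ∀ (i j : ℤ) (r : Row n),
      (G l r * pt P l r ^ j) • χ i (addBox l r.1 r.2) • ket a b (addBox l r.1 r.2) =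
      (χ i (addBox l r.1 r.2) * pt P l r ^ j) • G l r • ket a b (addBox l r.1 r.2) :=
    fun i j r => by simp only [smul_smul]; congr 1; ring
  have e2 : ∀ (i j : ℤ) (r : Row n),
      χ i l • (G l r * pt P l r ^ j) • ket a b (addBox l r.1 r.2) =
      (χ i l * pt P l r ^ j) • G l r • ket a b (addBox l r.1 r.2) :=
    fun i j r => by simp only [smul_smul]; congr 1; ring
  simp only [LinearMap.applyₗ_apply_apply, Module.End.mul_apply, diagOp_ket, map_smul, map_sum,
    hG.eOp_ket hN le_rfl, e1, Finset.smul_sum, e2] at h1 h2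
  rw [LinearMap.neg_apply, h1, h2, gZW'_sum, gWZ'_sum, ← Finset.sum_neg_distrib]
  refine Finset.sum_congr rfl fun r _ => ?_
  rw [gZW'_smul, gWZ'_smul, hχ, neg_smul]

end DiagonalRelations

/-! ### Transposition -/

section Transpose

variable {n : ℕ} [NeZero n] {P : Params n} {a b : Fin n → ℕ} {R : Row n → Row n → Prop} {C : ℂ}
  {G : Tuple n → Row n → ℂ} {l m : Tuple n}

/-- The bilinear form for which the basis vectors are orthonormal. -/
def pairing (a b : Fin n → ℕ) : MSpace a b →ₗ[ℂ] MSpace a b →ₗ[ℂ] ℂ :=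
  Finsupp.linearCombination ℂ fun l => Finsupp.lapply l

open scoped Classical in
lemma pairing_ket (hl : IsAdmissible a b l) (hm : IsAdmissible a b m) :
    pairing a b (ket a b l) (ket a b m) = if l = m then 1 else 0 := by
  rw [show l = (⟨l, hl⟩ : AdmTuple a b).1 from rfl, ket_coe,
    show m = (⟨m, hm⟩ : AdmTuple a b).1 from rfl, ket_coe, pairing,
    Finsupp.linearCombination_single, one_smul, Finsupp.lapply_apply, Finsupp.single_apply]
  simp [Subtype.ext_iff, eq_comm]

lemma pairing_single (x : MSpace a b) (l : AdmTuple a b) :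
    pairing a b x (Finsupp.single l 1) = x l := by
  have : (pairing a b).flip (Finsupp.single l 1) = Finsupp.lapply l := by
    refine Finsupp.lhom_ext' fun m => LinearMap.ext_ring ?_
    simp [pairing, Finsupp.single_apply, eq_comm]
  exact LinearMap.congr_fun this x

lemma end_ext_pairing {A B : Module.End ℂ (MSpace a b)}
    (h : ∀ x y, pairing a b (A x) y = pairing a b (B x) y) : A = B := by
  refine LinearMap.ext fun x => Finsupp.ext fun l => ?_
  rw [← pairing_single, ← pairing_single, h]

/-- `A` is the transpose of `B`. -/
def IsTranspose (A B : Module.End ℂ (MSpace a b)) : Prop :=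
  ∀ x y, pairing a b (A x) y = pairing a b x (B y)

lemma isTranspose_of_ket {A B : Module.End ℂ (MSpace a b)}
    (h : ∀ l m, IsAdmissible a b l → IsAdmissible a b m →
      pairing a b (A (ket a b l)) (ket a b m) = pairing a b (ket a b l) (B (ket a b m))) :
    IsTranspose A B := by
  have : (pairing a b) ∘ₗ A = (pairing a b).compl₂ B :=
    end_ext fun l hl => end_ext fun m hm => by simpa using h l m hl hm
  intro x y
  simpa using LinearMap.congr_fun (LinearMap.congr_fun this x) y

lemma IsTranspose.mul {A B A' B' : Module.End ℂ (MSpace a b)} (h : IsTranspose A B)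
    (h' : IsTranspose A' B') : IsTranspose (A * A') (B' * B) := fun x y => by
  rw [Module.End.mul_apply, h, h', Module.End.mul_apply]

lemma IsTranspose.sub {A B A' B' : Module.End ℂ (MSpace a b)} (h : IsTranspose A B)
    (h' : IsTranspose A' B') : IsTranspose (A - A') (B - B') := fun x y => by
  rw [LinearMap.sub_apply, map_sub, LinearMap.sub_apply, h, h', LinearMap.sub_apply, map_sub]

lemma IsTranspose.neg_left {A B : Module.End ℂ (MSpace a b)} (h : IsTranspose A (-B)) :
    IsTranspose (-A) B := fun x y => by
  rw [LinearMap.neg_apply, map_neg, LinearMap.neg_apply, h, LinearMap.neg_apply, map_neg, neg_neg]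

lemma IsTranspose.eq {A A' B : Module.End ℂ (MSpace a b)} (h : IsTranspose A B)
    (h' : IsTranspose A' B) : A = A' := end_ext_pairing fun x y => by rw [h, h']

lemma IsTranspose.gZW' {F F' : ℤ → ℤ → Module.End ℂ (MSpace a b)} {q₁ q₂ q₃ : ℂ}
    (h : ∀ i j, IsTranspose (F i j) (F' i j)) (i j : ℤ) :
    IsTranspose (gZW' q₁ q₂ q₃ F i j) (gZW' q₁ q₂ q₃ F' i j) := by
  intro x y
  have h1 := map_gZW' (((pairing a b).flip y) ∘ₗ LinearMap.applyₗ x) q₁ q₂ q₃ F i j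
  have h2 := map_gZW' ((pairing a b x) ∘ₗ LinearMap.applyₗ y) q₁ q₂ q₃ F' i j
  simp only [LinearMap.comp_apply, LinearMap.flip_apply, LinearMap.applyₗ_apply_apply] at h1 h2
  rw [h1, h2]
  congr
  funext i j
  exact h i j x y

lemma IsTranspose.gWZ' {F F' : ℤ → ℤ → Module.End ℂ (MSpace a b)} {q₁ q₂ q₃ : ℂ}
    (h : ∀ i j, IsTranspose (F i j) (F' i j)) (i j : ℤ) :
    IsTranspose (gWZ' q₁ q₂ q₃ F i j) (gWZ' q₁ q₂ q₃ F' i j) := by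
  intro x y
  have h1 := map_gWZ' (((pairing a b).flip y) ∘ₗ LinearMap.applyₗ x) q₁ q₂ q₃ F i j
  have h2 := map_gWZ' ((pairing a b x) ∘ₗ LinearMap.applyₗ y) q₁ q₂ q₃ F' i j
  simp only [LinearMap.comp_apply, LinearMap.flip_apply, LinearMap.applyₗ_apply_apply] at h1 h2
  rw [h1, h2]
  congr
  funext i j
  exact h i j x y

lemma isTranspose_diagOp (χ : Tuple n → ℂ) : IsTranspose (diagOp a b χ) (diagOp a b χ) := by
  classical
  refine isTranspose_of_ket fun l m hl hm => ?_
  rw [diagOp_ket, diagOp_ket, map_smul, LinearMap.smul_apply, map_smul, pairing_ket hl hm]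
  split_ifs with h
  · rw [h]
  · simp

lemma IsStepCoef.isTranspose_fOp (hG : IsStepCoef P a b R C G) (k : ℤ) :
    IsTranspose (fOp P a b G k) (eOp P a b G k) := by
  classical
  refine isTranspose_of_ket fun l m hl hm => ?_
  obtain ⟨N₁, h1, -⟩ := exists_suppLE l ∅
  obtain ⟨N₂, h2, -⟩ := exists_suppLE m ∅
  rw [fOp_ket G hl (h1.mono (Nat.le_add_right N₁ (N₂ + 1))) k,
    hG.eOp_ket h2 (show N₂ + 1 ≤ N₁ + (N₂ + 1) by omega) k]
  simp only [map_sum, LinearMap.sum_apply]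
  refine Finset.sum_congr rfl fun r _ => ?_
  have key : (l = addBox m r.1 r.2) ↔ (l r.1 r.2 ≠ 0 ∧ subBox l r = m) := by
    constructor
    · rintro rfl
      refine ⟨?_, subBox_addBox _ _⟩
      rw [addBox_apply, if_pos rfl]; omega
    · rintro ⟨h0, rfl⟩
      exact (addBox_subBox (by omega)).symm
  by_cases hlm : l = addBox m r.1 r.2
  · obtain ⟨h0, hs⟩ := key.1 hlm
    rw [if_neg h0, hs, ← hlm, map_smul, LinearMap.smul_apply, map_smul, pairing_ket hm hm,
      pairing_ket hl hl, if_pos rfl, if_pos rfl]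
  · have e1 : pairing a b (ket a b l) (ket a b (addBox m r.1 r.2)) = 0 := by
      by_cases h' : IsAdmissible a b (addBox m r.1 r.2)
      · rw [pairing_ket hl h', if_neg hlm]
      · rw [ket_of_not h', map_zero]
    rw [map_smul, e1, smul_zero]
    split_ifs with h0
    · simp
    · have hne : subBox l r ≠ m := fun hc => hlm (key.2 ⟨h0, hc⟩)
      by_cases h' : IsAdmissible a b (subBox l r)
      · rw [map_smul, LinearMap.smul_apply, pairing_ket h' hm, if_neg hne, smul_zero]
      · rw [ket_of_not h']; simp

theorem IsStepCoef.quadratic_relation_fOp (hG : IsStepCoef P a b R C G) (hR : TotalRel R)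
    (h : Resonant P a b) (i j : ℤ) :
    gWZ' P.1 P.2.1 P.2.2.1 (fun i j => fOp P a b G i * fOp P a b G j) i j =
      -gZW' P.1 P.2.1 P.2.2.1 (fun i j => fOp P a b G j * fOp P a b G i) i j := by
  have h1 := IsTranspose.gWZ' (q₁ := P.1) (q₂ := P.2.1) (q₃ := P.2.2.1)
    (fun i j => (hG.isTranspose_fOp i).mul (hG.isTranspose_fOp j)) i j
  have h2 := IsTranspose.gZW' (q₁ := P.1) (q₂ := P.2.1) (q₃ := P.2.2.1)
    (fun i j => (hG.isTranspose_fOp j).mul (hG.isTranspose_fOp i)) i j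
  rw [hG.quadratic_relation hR h] at h2
  exact h1.eq h2.neg_left

lemma commutator_commutator_eq {A : Type*} [Ring A] (x y z : A) :
    (z * y - y * z) * x - x * (z * y - y * z) = x * (y * z - z * y) - (y * z - z * y) * x := by
  noncomm_ring

theorem IsStepCoef.serre_relation_fOp (hG : IsStepCoef P a b R C G) (hR : TotalRel R)
    (h : Resonant P a b) :
    ⁅fOp P a b G 0, ⁅fOp P a b G 1, fOp P a b G (-1)⁆⁆ = 0 := by
  have t := hG.isTranspose_fOp
  have h1 := ((t 0).mul (((t 1).mul (t (-1))).sub ((t (-1)).mul (t 1)))).sub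
    ((((t 1).mul (t (-1))).sub ((t (-1)).mul (t 1))).mul (t 0))
  have h2 := hG.serre_relation hR h
  simp only [Ring.lie_def] at h2 ⊢
  refine h1.eq (B := _) ?_
  intro x y
  have e : (eOp P a b G (-1) * eOp P a b G 1 - eOp P a b G 1 * eOp P a b G (-1)) * eOp P a b G 0 -
      eOp P a b G 0 * (eOp P a b G (-1) * eOp P a b G 1 - eOp P a b G 1 * eOp P a b G (-1)) = 0 := by
    exact (commutator_commutator_eq _ _ _).trans h2
  rw [e]
  simp

theorem IsStepCoef.psi_relation_fOp (hG : IsStepCoef P a b R C G) {χ : ℤ → Tuple n → ℂ}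
    (hχ : IsPsiEigenvalue P χ) (i j : ℤ) :
    gWZ' P.1 P.2.1 P.2.2.1 (fun i j => diagOp a b (χ i) * fOp P a b G j) i j =
      -gZW' P.1 P.2.1 P.2.2.1 (fun i j => fOp P a b G j * diagOp a b (χ i)) i j := by
  have h1 := IsTranspose.gWZ' (q₁ := P.1) (q₂ := P.2.1) (q₃ := P.2.2.1)
    (fun i j => (isTranspose_diagOp (χ i)).mul (hG.isTranspose_fOp j)) i j
  have h2 := IsTranspose.gZW' (q₁ := P.1) (q₂ := P.2.1) (q₃ := P.2.2.1)
    (fun i j => (hG.isTranspose_fOp j).mul (isTranspose_diagOp (χ i))) i j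
  rw [hG.psi_relation hχ] at h2
  exact h1.eq h2.neg_left

end Transpose

/-! ### The relation between `e(z)` and `f(w)` -/

section Commutator

variable {n : ℕ} [NeZero n] {P : Params n} {a b : Fin n → ℕ} {l m : Tuple n} {r s : Row n}

/-- Adding a box commutes with removing a box of another row. -/
lemma Resonant.stepE_mul_stepF (h : Resonant P a b) (hrs : r ≠ s)
    (hr : IsAdmissible a b (addBox m r.1 r.2)) (hs : IsAdmissible a b (addBox m s.1 s.2)) :
    stepE P a b (addBox m r.1 r.2) s * stepF P a b (addBox m s.1 s.2) r =
      stepE P a b m s * stepF P a b m r := by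
  have hm := isAdmissible_of_addBox hrs hr hs
  have hrs' := isAdmissible_addBox_addBox hrs hr hs
  have hsr' := isAdmissible_addBox_addBox hrs.symm hs hr
  obtain ⟨N, hN, hN'⟩ := exists_suppLE m {r, s}
  have hrN : r.2 < N := hN' r (by simp)
  have hsN : s.2 < N := hN' s (by simp)
  rw [h.isStepCoef_stepE.eq _ s N hr hrs' (hN.addBox hrN) hsN,
    h.isStepCoef_stepF.eq _ r N hs hsr' (hN.addBox hsN) hrN,
    h.isStepCoef_stepE.eq _ s N hm hs hN hsN, h.isStepCoef_stepF.eq _ r N hm hr hN hrN]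
  have := coefN_mul_coefN_exchange h.mul_eq h.u_ne m hrs.symm hsN hrN
  linear_combination (1 / (1 - P.1) * (P.1 / (1 - P.1))) * this

lemma Resonant.gOne_ne_zero (h : Resonant P a b) : gOne P ≠ 0 :=
  mul_ne_zero (mul_ne_zero (sub_ne_zero.2 h.q₁_ne_one.symm) (sub_ne_zero.2 h.q₂_ne_one.symm))
    (sub_ne_zero.2 h.q₃_ne_one.symm)

/-- The relation between `e(z)` and `f(w)`: off the diagonal by `Resonant.stepE_mul_stepF`, on the
diagonal by `Resonant.psiDiff_eq`. -/
theorem Resonant.commutator_relation (h : Resonant P a b) (i j : ℤ) :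
    eOp P a b (stepE P a b) i * fOp P a b (stepF P a b) j -
      fOp P a b (stepF P a b) j * eOp P a b (stepE P a b) i =
      (gOne P)⁻¹ • (diagOp a b (fun l => (tensorPsiPlus P l).coeff (i + j)) -
        diagOp a b fun l => (tensorPsiMinus P l).coeff (-(i + j))) := by
  classical
  refine end_ext fun l hl => ?_
  obtain ⟨N, hN, -⟩ := exists_suppLE l ∅
  set X : Row n → Row n → MSpace a b := fun r s => if l r.1 r.2 = 0 then 0 else
    (stepF P a b (subBox l r) r * pt P (subBox l r) r ^ j *
      (stepE P a b (subBox l r) s * pt P (subBox l r) s ^ i)) •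
        ket a b (addBox (subBox l r) s.1 s.2) with hX
  set Y : Row n → Row n → MSpace a b := fun r s => if addBox l s.1 s.2 r.1 r.2 = 0 then 0 else
    (stepE P a b l s * pt P l s ^ i * (stepF P a b (subBox (addBox l s.1 s.2) r) r *
      pt P (subBox (addBox l s.1 s.2) r) r ^ j)) • ket a b (subBox (addBox l s.1 s.2) r) with hY
  have hef : eOp P a b (stepE P a b) i (fOp P a b (stepF P a b) j (ket a b l)) =
      ∑ r ∈ rows n (N + 1), ∑ s ∈ rows n (N + 1), X r s := by
    rw [fOp_ket _ hl (hN.mono (Nat.le_succ N)), map_sum]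
    refine Finset.sum_congr rfl fun r _ => ?_
    simp only [hX]
    split_ifs with h0
    · simp
    · have hN' : SuppLE (subBox l r) N := fun i' j' hj => by
        have := subBox_apply l r (i', j')
        simp only at this
        rw [this, hN i' j' hj, Nat.zero_sub]
      rw [map_smul, h.isStepCoef_stepE.eOp_ket hN' le_rfl, Finset.smul_sum]
      exact Finset.sum_congr rfl fun s _ => by rw [smul_smul]
  have hfe : fOp P a b (stepF P a b) j (eOp P a b (stepE P a b) i (ket a b l)) =
      ∑ r ∈ rows n (N + 1), ∑ s ∈ rows n (N + 1), Y r s := by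
    rw [h.isStepCoef_stepE.eOp_ket hN le_rfl, map_sum, Finset.sum_comm]
    refine Finset.sum_congr rfl fun s hs => ?_
    rw [map_smul]
    by_cases h0 : stepE P a b l s = 0
    · simp [hY, h0]
    · rw [fOp_ket _ (h.isStepCoef_stepE.isAdmissible h0).2
        (SuppLE.addBox (hN.mono (Nat.le_succ N)) (mem_rows.1 hs)), Finset.smul_sum]
      refine Finset.sum_congr rfl fun r _ => ?_
      simp only [hY]
      split_ifs
      · simp
      · rw [smul_smul]
  have off : ∀ r s, s ≠ r → X r s = Y r s := by
    intro r s hsr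
    have e0 : addBox l s.1 s.2 r.1 r.2 = l r.1 r.2 := by
      rw [addBox_apply, if_neg hsr.symm, add_zero]
    simp only [hX, hY, e0]
    split_ifs with h0
    · rfl
    · have hm := addBox_subBox (l := l) (r := r) (by omega)
      generalize subBox l r = m at hm
      subst hm
      rw [addBox_comm m r s, subBox_addBox]
      by_cases hs : IsAdmissible a b (addBox m s.1 s.2)
      · congr 1
        rw [pt_addBox_of_ne m hsr, pt_addBox_of_ne m hsr.symm]
        linear_combination (-(pt P m s ^ i * pt P m r ^ j)) * h.stepE_mul_stepF hsr.symm hl hs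
      · rw [ket_of_not hs, smul_zero, smul_zero]
  have diagY : ∀ r, Y r r = (stepE P a b l r * stepF P a b l r * pt P l r ^ (i + j)) •
      ket a b l := by
    intro r
    have e0 : addBox l r.1 r.2 r.1 r.2 ≠ 0 := by rw [addBox_apply, if_pos rfl]; omega
    simp only [hY]
    rw [if_neg e0, subBox_addBox, zpow_add₀ (pt_ne_zero h.mul_eq h.u_ne l r)]
    congr 1; ring
  have diagX : ∀ r, X r r = (if l r.1 r.2 = 0 then 0 else stepE P a b (subBox l r) r *
      stepF P a b (subBox l r) r * pt P (subBox l r) r ^ (i + j)) • ket a b l := by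
    intro r
    simp only [hX]
    split_ifs with h0
    · simp
    · rw [addBox_subBox (by omega), zpow_add₀ (pt_ne_zero h.mul_eq h.u_ne _ r)]
      congr 1; ring
  have hsum : ∑ r ∈ rows n (N + 1), ∑ s ∈ rows n (N + 1), (X r s - Y r s) =
      ∑ r ∈ rows n (N + 1), (X r r - Y r r) := by
    refine Finset.sum_congr rfl fun r hr => ?_
    refine Finset.sum_eq_single_of_mem r hr fun s _ hsr => ?_
    rw [off r s hsr, sub_self]
  rw [LinearMap.sub_apply, Module.End.mul_apply, Module.End.mul_apply, hef, hfe,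
    ← Finset.sum_sub_distrib]
  simp only [← Finset.sum_sub_distrib]
  rw [hsum]
  simp only [diagX, diagY, Finset.sum_sub_distrib, ← Finset.sum_smul, ← sub_smul]
  rw [LinearMap.smul_apply, LinearMap.sub_apply, diagOp_ket, diagOp_ket, ← sub_smul, smul_smul]
  congr 1
  have := h.psiDiff_eq hl hN (i + j)
  rw [psiDiff] at this
  rw [this, inv_mul_cancel_left₀ h.gOne_ne_zero]

end Commutator

/-! ### The action of `ℰ` on `ℳ` -/

section Action

variable {n : ℕ} [NeZero n] {P : Params n} {a b : Fin n → ℕ} {l m : Tuple n}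

/-- The operators by which the generators of `ℰ` act on `ℳ`. -/
def genOp (P : Params n) (a b : Fin n → ℕ) : Gen → Module.End ℂ (MSpace a b)
  | .e k => eOp P a b (stepE P a b) k
  | .f k => fOp P a b (stepF P a b) k
  | .psiPlus k => diagOp a b fun l => (tensorPsiPlus P l).coeff (k : ℤ)
  | .psiMinus k => diagOp a b fun l => (tensorPsiMinus P l).coeff (k : ℤ)
  | .psiPlusInv => diagOp a b fun l => ((tensorPsiPlus P l).coeff 0)⁻¹
  | .psiMinusInv => diagOp a b fun l => ((tensorPsiMinus P l).coeff 0)⁻¹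

lemma diagOp_mul (χ χ' : Tuple n → ℂ) :
    diagOp a b χ * diagOp a b χ' = diagOp a b fun l => χ l * χ' l :=
  end_ext fun l _ => by
    rw [Module.End.mul_apply, diagOp_ket, map_smul, diagOp_ket, diagOp_ket, smul_smul, mul_comm]

lemma diagOp_comm (χ χ' : Tuple n → ℂ) :
    diagOp a b χ * diagOp a b χ' = diagOp a b χ' * diagOp a b χ := by
  simp only [diagOp_mul, mul_comm]

lemma diagOp_eq_zero {χ : Tuple n → ℂ} (h : ∀ l, χ l = 0) : diagOp a b χ = 0 :=
  end_ext fun l _ => by rw [diagOp_ket, h, zero_smul, LinearMap.zero_apply]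

lemma diagOp_eq_one {χ : Tuple n → ℂ} (h : ∀ l, χ l = 1) : diagOp a b χ = 1 :=
  end_ext fun l _ => by rw [diagOp_ket, h, one_smul, Module.End.one_apply]

/-- The action of the free algebra. -/
def freeAction (P : Params n) (a b : Fin n → ℕ) : FreeE →ₐ[ℂ] Module.End ℂ (MSpace a b) :=
  FreeAlgebra.lift ℂ (genOp P a b)

lemma freeAction_ι (x : Gen) : freeAction P a b (FreeAlgebra.ι ℂ x) = genOp P a b x :=
  FreeAlgebra.lift_ι_apply _ _

lemma freeAction_eMode (k : ℤ) : freeAction P a b (eMode k) = eOp P a b (stepE P a b) k :=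
  freeAction_ι _

lemma freeAction_fMode (k : ℤ) : freeAction P a b (fMode k) = fOp P a b (stepF P a b) k :=
  freeAction_ι _

lemma Resonant.freeAction_psiPlusMode (h : Resonant P a b) (k : ℤ) :
    freeAction P a b (psiPlusMode k) = diagOp a b fun l => (tensorPsiPlus P l).coeff k := by
  unfold psiPlusMode
  split_ifs with hk
  · rw [freeAction_ι, genOp, Int.toNat_of_nonneg hk]
  · rw [map_zero, diagOp_eq_zero fun l => coeff_tensorPsiPlus_of_neg h.mul_eq l (by omega)]

lemma Resonant.freeAction_psiMinusMode (h : Resonant P a b) (k : ℤ) :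
    freeAction P a b (psiMinusMode k) = diagOp a b fun l => (tensorPsiMinus P l).coeff (-k) := by
  unfold psiMinusMode
  split_ifs with hk
  · rw [freeAction_ι, genOp, Int.toNat_of_nonneg (by omega)]
  · rw [map_zero, diagOp_eq_zero fun l =>
      coeff_tensorPsiMinus_of_neg h.mul_eq h.u_ne l (by omega)]

lemma freeAction_gZW (q₁ q₂ q₃ : ℂ) (F : ℤ → ℤ → FreeE) (i j : ℤ) :
    freeAction P a b (gZW q₁ q₂ q₃ F i j) =
      gZW' q₁ q₂ q₃ (fun i j => freeAction P a b (F i j)) i j := by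
  simp only [gZW, mulZW, gZW', map_sub, map_smul]

lemma freeAction_gWZ (q₁ q₂ q₃ : ℂ) (F : ℤ → ℤ → FreeE) (i j : ℤ) :
    freeAction P a b (gWZ q₁ q₂ q₃ F i j) =
      gWZ' q₁ q₂ q₃ (fun i j => freeAction P a b (F i j)) i j := by
  simp only [gWZ, mulWZ, gWZ', map_sub, map_smul]

theorem Resonant.freeAction_rel (h : Resonant P a b) ⦃x y : FreeE⦄
    (hxy : Rel P.1 P.2.1 P.2.2.1 x y) : freeAction P a b x = freeAction P a b y := by
  have hE := h.isStepCoef_stepE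
  have hF := h.isStepCoef_stepF
  cases hxy with
  | ee i j =>
    rw [map_neg, freeAction_gZW, freeAction_gWZ]
    simp only [map_mul, freeAction_eMode]
    exact hE.quadratic_relation totalRel_rowLt h i j
  | ff i j =>
    rw [map_neg, freeAction_gZW, freeAction_gWZ]
    simp only [map_mul, freeAction_fMode]
    exact hF.quadratic_relation_fOp totalRel_rowGt h i j
  | psiPlus_e i j =>
    rw [map_neg, freeAction_gZW, freeAction_gWZ]
    simp only [map_mul, freeAction_eMode, h.freeAction_psiPlusMode]
    exact hE.psi_relation h.isPsiEigenvalue_plus i j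
  | psiMinus_e i j =>
    rw [map_neg, freeAction_gZW, freeAction_gWZ]
    simp only [map_mul, freeAction_eMode, h.freeAction_psiMinusMode]
    exact hE.psi_relation h.isPsiEigenvalue_minus i j
  | psiPlus_f i j =>
    rw [map_neg, freeAction_gZW, freeAction_gWZ]
    simp only [map_mul, freeAction_fMode, h.freeAction_psiPlusMode]
    exact hF.psi_relation_fOp h.isPsiEigenvalue_plus i j
  | psiMinus_f i j =>
    rw [map_neg, freeAction_gZW, freeAction_gWZ]
    simp only [map_mul, freeAction_fMode, h.freeAction_psiMinusMode]
    exact hF.psi_relation_fOp h.isPsiEigenvalue_minus i j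
  | ef i j =>
    rw [map_sub, map_mul, map_mul, map_smul, map_sub, freeAction_eMode, freeAction_fMode,
      h.freeAction_psiPlusMode, h.freeAction_psiMinusMode]
    exact h.commutator_relation i j
  | psiPlus_psiPlus i j =>
    simp only [map_mul, h.freeAction_psiPlusMode]
    exact diagOp_comm _ _
  | psiMinus_psiMinus i j =>
    simp only [map_mul, h.freeAction_psiMinusMode]
    exact diagOp_comm _ _
  | psiPlus_psiMinus i j =>
    simp only [map_mul, h.freeAction_psiPlusMode, h.freeAction_psiMinusMode]
    exact diagOp_comm _ _
  | psiPlus_inv_right =>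
    rw [map_mul, map_one, h.freeAction_psiPlusMode, freeAction_ι, genOp, diagOp_mul]
    exact diagOp_eq_one fun l => mul_inv_cancel₀ (coeff_tensorPsiPlus_zero h.mul_eq l)
  | psiPlus_inv_left =>
    rw [map_mul, map_one, h.freeAction_psiPlusMode, freeAction_ι, genOp, diagOp_mul]
    exact diagOp_eq_one fun l => inv_mul_cancel₀ (coeff_tensorPsiPlus_zero h.mul_eq l)
  | psiMinus_inv_right =>
    rw [map_mul, map_one, h.freeAction_psiMinusMode, freeAction_ι, genOp, diagOp_mul, neg_zero]
    exact diagOp_eq_one fun l => mul_inv_cancel₀ (coeff_tensorPsiMinus_zero h.mul_eq h.u_ne l)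
  | psiMinus_inv_left =>
    rw [map_mul, map_one, h.freeAction_psiMinusMode, freeAction_ι, genOp, diagOp_mul, neg_zero]
    exact diagOp_eq_one fun l => inv_mul_cancel₀ (coeff_tensorPsiMinus_zero h.mul_eq h.u_ne l)
  | serre_e =>
    simp only [Ring.lie_def, map_sub, map_mul, map_zero, freeAction_eMode]
    simpa only [Ring.lie_def] using hE.serre_relation totalRel_rowLt h
  | serre_f =>
    simp only [Ring.lie_def, map_sub, map_mul, map_zero, freeAction_fMode]
    simpa only [Ring.lie_def] using hF.serre_relation_fOp totalRel_rowGt h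

/-- The action of `ℰ` on `ℳ`. -/
def action (h : Resonant P a b) : QAlg P.1 P.2.1 P.2.2.1 →ₐ[ℂ] Module.End ℂ (MSpace a b) :=
  RingQuot.liftAlgHom ℂ ⟨freeAction P a b, h.freeAction_rel⟩

lemma action_gen (h : Resonant P a b) (x : Gen) :
    action h (gen P.1 P.2.1 P.2.2.1 x) = genOp P a b x := by
  rw [action, gen, RingQuot.liftAlgHom_mkAlgHom_apply, freeAction_ι]

end Action

/-! ### Matrix coefficients of the action -/

section TensorCoefficients

variable {n : ℕ}

lemma matE_addBox (Q : Params n) (k : ℤ) (l : Tuple n) (r : Row n) :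
    matE Q k (addBox l r.1 r.2) l = tensorE Q l r.1 r.2 * pt Q l r ^ k := by
  classical
  rw [matE, finsum_eq_single _ r]
  · rw [if_pos rfl]
  · intro r' hne
    rw [if_neg fun hc => hne (addBox_injective _ hc).symm]

lemma matE_of_ne (Q : Params n) (k : ℤ) {l m : Tuple n} (h : ∀ r : Row n, m ≠ addBox l r.1 r.2) :
    matE Q k m l = 0 := by
  rw [matE, finsum_eq_zero_of_forall_eq_zero fun r => if_neg (h r)]

lemma matF_addBox (Q : Params n) (k : ℤ) (m : Tuple n) (r : Row n) :
    matF Q k m (addBox m r.1 r.2) = tensorF Q m r.1 r.2 * pt Q m r ^ k := by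
  classical
  rw [matF, finsum_eq_single _ r]
  · rw [if_pos rfl]
  · intro r' hne
    rw [if_neg fun hc => hne (addBox_injective _ hc).symm]

lemma matF_of_ne (Q : Params n) (k : ℤ) {l m : Tuple n} (h : ∀ r : Row n, l ≠ addBox m r.1 r.2) :
    matF Q k m l = 0 := by
  rw [matF, finsum_eq_zero_of_forall_eq_zero fun r => if_neg (h r)]

/-- The number of boxes. -/
def size (l : Tuple n) : ℤ := ∑ i, (l i).sum fun _ m => (m : ℤ)

lemma size_addBox (l : Tuple n) (r : Row n) : size (addBox l r.1 r.2) = size l + 1 := by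
  have : ∀ i, ((addBox l r.1 r.2) i).sum (fun _ m => (m : ℤ)) =
      (l i).sum (fun _ m => (m : ℤ)) + if i = r.1 then 1 else 0 := by
    intro i
    rw [addBox, Pi.add_apply, Finsupp.sum_add_index' (by simp) (by simp)]
    congr 1
    split_ifs with h
    · subst h; simp
    · rw [Pi.single_eq_of_ne h]; simp
  simp [size, this, Finset.sum_add_distrib]

end TensorCoefficients

section Induced

variable {n : ℕ} [NeZero n] {P : Params n} {a b : Fin n → ℕ} {R : Row n → Row n → Prop} {C : ℂ}
  {G : Tuple n → Row n → ℂ} {l : Tuple n}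

open scoped Classical in
lemma ket_apply (l : Tuple n) (m : AdmTuple a b) : ket a b l m = if l = m.1 then 1 else 0 := by
  by_cases h : IsAdmissible a b l
  · rw [show l = (⟨l, h⟩ : AdmTuple a b).1 from rfl, ket_coe, Finsupp.single_apply]
    simp [Subtype.ext_iff]
  · rw [ket_of_not h, if_neg (fun hc : l = m.1 => h (by rw [hc]; exact m.2))]
    rfl

lemma IsStepCoef.eOp_single_apply (hG : IsStepCoef P a b R C G) (k : ℤ) (l m : AdmTuple a b)
    {r : Row n} (hm : m.1 = addBox l.1 r.1 r.2) :
    eOp P a b G k (Finsupp.single l 1) m = G l.1 r * pt P l.1 r ^ k := by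
  classical
  obtain ⟨N, hN, hr⟩ := exists_suppLE l.1 {r}
  have hr := hr r (by simp)
  rw [← ket_coe, hG.eOp_ket hN le_rfl, Finsupp.finsetSum_apply,
    Finset.sum_eq_single_of_mem r (mem_rows.2 (by omega))]
  · rw [Finsupp.smul_apply, ket_apply, if_pos hm.symm, smul_eq_mul, mul_one]
  · intro r' _ hne
    rw [Finsupp.smul_apply, ket_apply, if_neg, smul_zero]
    intro hc
    exact hne (addBox_injective _ (hc.trans hm))

lemma IsStepCoef.eOp_single_apply_of_ne (hG : IsStepCoef P a b R C G) (k : ℤ) (l m : AdmTuple a b)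
    (hm : ∀ r : Row n, m.1 ≠ addBox l.1 r.1 r.2) :
    eOp P a b G k (Finsupp.single l 1) m = 0 := by
  classical
  obtain ⟨N, hN, -⟩ := exists_suppLE l.1 ∅
  rw [← ket_coe, hG.eOp_ket hN le_rfl, Finsupp.finsetSum_apply]
  refine Finset.sum_eq_zero fun r _ => ?_
  rw [Finsupp.smul_apply, ket_apply, if_neg (fun hc => hm r hc.symm), smul_zero]

lemma IsStepCoef.fOp_single_apply (hG : IsStepCoef P a b R C G) (k : ℤ) (l m : AdmTuple a b) :
    fOp P a b G k (Finsupp.single l 1) m = eOp P a b G k (Finsupp.single m 1) l := by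
  rw [← pairing_single, hG.isTranspose_fOp k, pairing, Finsupp.linearCombination_single, one_smul,
    Finsupp.lapply_apply]

open scoped Classical in
lemma diagOp_single_apply (χ : Tuple n → ℂ) (l m : AdmTuple a b) :
    diagOp a b χ (Finsupp.single l 1) m = if m.1 = l.1 then χ l.1 else 0 := by
  rw [← ket_coe, diagOp_ket, Finsupp.smul_apply, ket_apply]
  simp [eq_comm]

lemma Resonant.tendsto_pt_zpow (h : Resonant P a b) (l : Tuple n) (r : Row n) (k : ℤ) :
    Tendsto (fun Q => pt Q l r ^ k) (genericNhds P) (𝓝 (pt P l r ^ k)) :=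
  (((continuous_pt l r).continuousAt.zpow₀ k
    (.inl (pt_ne_zero h.mul_eq h.u_ne l r))).tendsto).mono_left nhdsWithin_le_nhds

theorem Resonant.tendsto_matE (h : Resonant P a b) (k : ℤ) (m l : AdmTuple a b) :
    Tendsto (fun Q => matE Q k m.1 l.1) (genericNhds P)
      (𝓝 (genOp P a b (.e k) (Finsupp.single l 1) m)) := by
  rw [genOp]
  by_cases hm : ∃ r : Row n, m.1 = addBox l.1 r.1 r.2
  · obtain ⟨r, hr⟩ := hm
    rw [h.isStepCoef_stepE.eOp_single_apply k l m hr]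
    simp only [hr, matE_addBox]
    exact (h.tendsto_tensorE_stepE l.2 (hr ▸ m.2)).mul (h.tendsto_pt_zpow _ _ _)
  · push Not at hm
    rw [h.isStepCoef_stepE.eOp_single_apply_of_ne k l m hm]
    simp only [matE_of_ne _ k hm]
    exact tendsto_const_nhds

theorem Resonant.tendsto_matF (h : Resonant P a b) (k : ℤ) (m l : AdmTuple a b) :
    Tendsto (fun Q => matF Q k m.1 l.1) (genericNhds P)
      (𝓝 (genOp P a b (.f k) (Finsupp.single l 1) m)) := by
  rw [genOp, h.isStepCoef_stepF.fOp_single_apply]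
  by_cases hm : ∃ r : Row n, l.1 = addBox m.1 r.1 r.2
  · obtain ⟨r, hr⟩ := hm
    rw [h.isStepCoef_stepF.eOp_single_apply k m l hr]
    simp only [hr, matF_addBox]
    exact (h.tendsto_tensorF_stepF m.2 (hr ▸ l.2)).mul (h.tendsto_pt_zpow _ _ _)
  · push Not at hm
    rw [h.isStepCoef_stepF.eOp_single_apply_of_ne k m l hm]
    simp only [matF_of_ne _ k hm]
    exact tendsto_const_nhds

theorem Resonant.tendsto_matPsiPlus (h : Resonant P a b) (k : ℕ) (m l : AdmTuple a b) :
    Tendsto (fun Q => matPsiPlus Q k m.1 l.1) (genericNhds P)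
      (𝓝 (genOp P a b (.psiPlus k) (Finsupp.single l 1) m)) := by
  rw [genOp, diagOp_single_apply]
  unfold matPsiPlus
  split_ifs
  · exact tendsto_coeff_tensorPsiPlus h.mul_eq l.1 k
  · exact tendsto_const_nhds

theorem Resonant.tendsto_matPsiMinus (h : Resonant P a b) (k : ℕ) (m l : AdmTuple a b) :
    Tendsto (fun Q => matPsiMinus Q k m.1 l.1) (genericNhds P)
      (𝓝 (genOp P a b (.psiMinus k) (Finsupp.single l 1) m)) := by
  rw [genOp, diagOp_single_apply]
  unfold matPsiMinus
  split_ifs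
  · exact tendsto_coeff_tensorPsiMinus h.mul_eq h.u_ne l.1 k
  · exact tendsto_const_nhds

theorem Resonant.isInducedAction (h : Resonant P a b) :
    IsInducedAction P.2.2.2 a b (action h) := by
  intro m l
  beta_reduce
  simp only [action_gen]
  exact ⟨fun k => h.tendsto_matE k m l, fun k => h.tendsto_matF k m l,
    fun k => h.tendsto_matPsiPlus k m l, fun k => h.tendsto_matPsiMinus k m l⟩

section Relations

variable (q₁ q₂ q₃ : ℂ)

lemma gen_psiPlusInv_mul : gen q₁ q₂ q₃ .psiPlusInv * gen q₁ q₂ q₃ (.psiPlus 0) = 1 := by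
  have := RingQuot.mkAlgHom_rel ℂ (Rel.psiPlus_inv_left (q₁ := q₁) (q₂ := q₂) (q₃ := q₃))
  simpa [psiPlusMode, gen] using this

lemma gen_psiPlus_mul_inv : gen q₁ q₂ q₃ (.psiPlus 0) * gen q₁ q₂ q₃ .psiPlusInv = 1 := by
  have := RingQuot.mkAlgHom_rel ℂ (Rel.psiPlus_inv_right (q₁ := q₁) (q₂ := q₂) (q₃ := q₃))
  simpa [psiPlusMode, gen] using this

lemma gen_psiMinusInv_mul : gen q₁ q₂ q₃ .psiMinusInv * gen q₁ q₂ q₃ (.psiMinus 0) = 1 := by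
  have := RingQuot.mkAlgHom_rel ℂ (Rel.psiMinus_inv_left (q₁ := q₁) (q₂ := q₂) (q₃ := q₃))
  simpa [psiMinusMode, gen] using this

lemma gen_psiMinus_mul_inv : gen q₁ q₂ q₃ (.psiMinus 0) * gen q₁ q₂ q₃ .psiMinusInv = 1 := by
  have := RingQuot.mkAlgHom_rel ℂ (Rel.psiMinus_inv_right (q₁ := q₁) (q₂ := q₂) (q₃ := q₃))
  simpa [psiMinusMode, gen] using this

end Relations

/-- An action of `ℰ` is determined by the operators of `e_k`, `f_k`, `ψ^±_k`. -/
lemma algHom_ext_of_gen {q₁ q₂ q₃ : ℂ} {A : Type*} [Ring A] [Algebra ℂ A]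
    {ρ ρ' : QAlg q₁ q₂ q₃ →ₐ[ℂ] A}
    (he : ∀ k, ρ (gen q₁ q₂ q₃ (.e k)) = ρ' (gen q₁ q₂ q₃ (.e k)))
    (hf : ∀ k, ρ (gen q₁ q₂ q₃ (.f k)) = ρ' (gen q₁ q₂ q₃ (.f k)))
    (hp : ∀ k, ρ (gen q₁ q₂ q₃ (.psiPlus k)) = ρ' (gen q₁ q₂ q₃ (.psiPlus k)))
    (hm : ∀ k, ρ (gen q₁ q₂ q₃ (.psiMinus k)) = ρ' (gen q₁ q₂ q₃ (.psiMinus k))) : ρ = ρ' := by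
  refine RingQuot.ringQuot_ext' ℂ _ _ (FreeAlgebra.hom_ext (funext fun x => ?_))
  change ρ (gen q₁ q₂ q₃ x) = ρ' (gen q₁ q₂ q₃ x)
  cases x with
  | e k => exact he k
  | f k => exact hf k
  | psiPlus k => exact hp k
  | psiMinus k => exact hm k
  | psiPlusInv =>
    refine left_inv_eq_right_inv (a := ρ (gen q₁ q₂ q₃ (.psiPlus 0))) ?_ ?_
    · rw [← map_mul, gen_psiPlusInv_mul, map_one]
    · rw [hp, ← map_mul, gen_psiPlus_mul_inv, map_one]
  | psiMinusInv =>
    refine left_inv_eq_right_inv (a := ρ (gen q₁ q₂ q₃ (.psiMinus 0))) ?_ ?_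
    · rw [← map_mul, gen_psiMinusInv_mul, map_one]
    · rw [hm, ← map_mul, gen_psiMinus_mul_inv, map_one]

theorem Resonant.isInducedAction_unique (h : Resonant P a b)
    {ρ ρ' : QAlg P.1 P.2.1 P.2.2.1 →ₐ[ℂ] Module.End ℂ (MSpace a b)}
    (hρ : IsInducedAction P.2.2.2 a b ρ) (hρ' : IsInducedAction P.2.2.2 a b ρ') : ρ' = ρ := by
  have := h.neBot
  have ext : ∀ A B : Module.End ℂ (MSpace a b),
      (∀ m l : AdmTuple a b, A (Finsupp.single l 1) m = B (Finsupp.single l 1) m) → A = B :=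
    fun A B hAB => Finsupp.lhom_ext' fun l => LinearMap.ext_ring (Finsupp.ext fun m => hAB m l)
  refine algHom_ext_of_gen (A := Module.End ℂ (MSpace a b)) (fun k => ?_) (fun k => ?_)
    (fun k => ?_) (fun k => ?_)
  · exact ext _ _ fun m l => tendsto_nhds_unique ((hρ' m l).1 k) ((hρ m l).1 k)
  · exact ext _ _ fun m l => tendsto_nhds_unique ((hρ' m l).2.1 k) ((hρ m l).2.1 k)
  · exact ext _ _ fun m l => tendsto_nhds_unique ((hρ' m l).2.2.1 k) ((hρ m l).2.2.1 k)
  · exact ext _ _ fun m l => tendsto_nhds_unique ((hρ' m l).2.2.2 k) ((hρ m l).2.2.2 k)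

end Induced

/-! ### The grading -/

section Grading

variable {n : ℕ} [NeZero n] {P : Params n} {a b : Fin n → ℕ}

lemma gradedPiece_eq (d : ℤ) :
    gradedPiece a b d = Finsupp.supported ℂ ℂ {l : AdmTuple a b | size l.1 = d} := by
  rw [Finsupp.supported_eq_span_single, gradedPiece]
  congr 1
  ext v
  constructor
  · rintro ⟨l, h1, h2⟩; exact ⟨l, h1, h2.symm⟩
  · rintro ⟨l, h1, h2⟩; exact ⟨l, h1, h2.symm⟩

lemma ket_mem_gradedPiece (l : Tuple n) : ket a b l ∈ gradedPiece a b (size l) := by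
  by_cases h : IsAdmissible a b l
  · rw [gradedPiece_eq, show l = (⟨l, h⟩ : AdmTuple a b).1 from rfl, ket_coe]
    exact Finsupp.single_mem_supported _ _ rfl
  · rw [ket_of_not h]; exact zero_mem _

theorem isInternal_gradedPiece (a b : Fin n → ℕ) : DirectSum.IsInternal (gradedPiece a b) := by
  rw [DirectSum.isInternal_submodule_iff_iSupIndep_and_iSup_eq_top]
  simp only [funext (gradedPiece_eq (a := a) (b := b))]
  constructor
  · intro d
    have : (⨆ (j : ℤ) (_ : j ≠ d), Finsupp.supported ℂ ℂ {l : AdmTuple a b | size l.1 = j}) ≤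
        Finsupp.supported ℂ ℂ {l : AdmTuple a b | size l.1 ≠ d} :=
      iSup₂_le fun j hj => Finsupp.supported_mono fun l hl => by
        rw [Set.mem_ofPred_eq] at hl ⊢; omega
    refine Disjoint.mono_right this (Finsupp.disjoint_supported_supported ?_)
    exact Set.disjoint_left.2 fun l hl hl' => hl' hl
  · rw [← Finsupp.supported_iUnion, eq_top_iff]
    intro v _ l _
    simp

theorem Resonant.isGradedModule (h : Resonant P a b) :
    IsGradedModule (action h) (gradedPiece a b) := by
  refine ⟨isInternal_gradedPiece a b, fun x d => ?_⟩
  rw [gradedPiece, Submodule.map_span_le]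
  rintro _ ⟨l, hl, rfl⟩
  rw [action_gen, ← ket_coe]
  change size l.1 = d at hl
  have hdiag : ∀ χ : Tuple n → ℂ, diagOp a b χ (ket a b l.1) ∈ gradedPiece a b (d + 0) := by
    intro χ
    rw [diagOp_ket, add_zero, ← hl]
    exact Submodule.smul_mem _ _ (ket_mem_gradedPiece _)
  obtain ⟨N, hN, -⟩ := exists_suppLE l.1 ∅
  cases x with
  | e k =>
    rw [genOp, h.isStepCoef_stepE.eOp_ket hN le_rfl]
    refine Submodule.sum_mem _ fun r _ => Submodule.smul_mem _ _ ?_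
    have := ket_mem_gradedPiece (a := a) (b := b) (addBox l.1 r.1 r.2)
    rw [size_addBox, hl] at this
    exact this
  | f k =>
    rw [genOp, fOp_ket _ l.2 hN]
    refine Submodule.sum_mem _ fun r _ => ?_
    split_ifs with h0
    · exact zero_mem _
    · refine Submodule.smul_mem _ _ ?_
      have h1 := ket_mem_gradedPiece (a := a) (b := b) (subBox l.1 r)
      have h2 := size_addBox (subBox l.1 r) r
      rw [addBox_subBox (by omega)] at h2
      rwa [show size (subBox l.1 r) = d + Gen.deg (.f k) by simp only [Gen.deg]; omega] at h1
  | psiPlus k => rw [genOp]; exact hdiag _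
  | psiMinus k => rw [genOp]; exact hdiag _
  | psiPlusInv => rw [genOp]; exact hdiag _
  | psiMinusInv => rw [genOp]; exact hdiag _

end Grading

/-! ### Simplicity of the joint spectrum of the `ψ^±` -/

section LinearFactors

/-- The linear factor `1 - c / z`, expanded in `1 / z`. -/
def linearFactor (c : ℂ) : LaurentSeries ℂ := 1 - HahnSeries.single (1 : ℤ) c

lemma linearFactor_ne_zero (c : ℂ) : linearFactor c ≠ 0 := by
  rw [linearFactor, ← smul_varPlus]; exact one_sub_smul_varPlus_ne c

/-- Unique factorization for products of linear factors. -/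
lemma eq_of_prod_linearFactor_eq {s t : Multiset ℂ} (hs : ∀ c ∈ s, c ≠ 0) (ht : ∀ c ∈ t, c ≠ 0)
    (h : (s.map linearFactor).prod = (t.map linearFactor).prod) : s = t := by
  set Φ : Polynomial ℂ →+* LaurentSeries ℂ :=
    (HahnSeries.ofPowerSeries ℤ ℂ).comp Polynomial.coeToPowerSeries.ringHom
  have hΦ : Function.Injective Φ :=
    HahnSeries.ofPowerSeries_injective.comp (Polynomial.coe_injective ℂ)
  set lin : ℂ → Polynomial ℂ := fun c => Polynomial.C (-c) * Polynomial.X + Polynomial.C 1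
  have hlin : ∀ c, Φ (lin c) = linearFactor c := by
    intro c
    simp only [Φ, lin, linearFactor, RingHom.comp_apply, Polynomial.coeToPowerSeries.ringHom_apply,
      Polynomial.coe_C, Polynomial.coe_X, map_add, map_mul,
      HahnSeries.ofPowerSeries_C, HahnSeries.ofPowerSeries_X, map_neg, map_one, neg_mul,
      C_mul_single_one]
    ring
  have hp : ∀ s : Multiset ℂ, Φ ((s.map lin).prod) = (s.map linearFactor).prod := by
    intro s
    rw [map_multiset_prod, Multiset.map_map]
    simp only [Function.comp_def, hlin]
  have hroots : ∀ s : Multiset ℂ, (∀ c ∈ s, c ≠ 0) → (s.map lin).prod.roots = s.map (·⁻¹) := by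
    intro s
    induction s using Multiset.induction_on with
    | empty => intro _; simp
    | cons c s ih =>
      intro hs
      have hc : c ≠ 0 := hs c (Multiset.mem_cons_self c s)
      have h0 : (Multiset.map lin (c ::ₘ s)).prod ≠ 0 := by
        intro h0
        have := hp (c ::ₘ s)
        rw [h0, map_zero] at this
        refine Multiset.prod_ne_zero ?_ this.symm
        intro hm
        obtain ⟨d, -, hd⟩ := Multiset.mem_map.1 hm
        exact linearFactor_ne_zero d hd
      rw [Multiset.map_cons, Multiset.prod_cons] at h0 ⊢
      rw [Polynomial.roots_mul h0, ih fun d hd => hs d (Multiset.mem_cons_of_mem hd),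
        Multiset.map_cons, Polynomial.roots_C_mul_X_add_C 1 (neg_ne_zero.2 hc)]
      simp
  have := congrArg Polynomial.roots (hΦ ((hp s).trans (h.trans (hp t).symm)))
  rw [hroots s hs, hroots t ht] at this
  exact Multiset.map_injective inv_injective this

/-- A finitely supported function on `ℂ` which is invariant under multiplication by some `q`, which
is not a root of unity, vanishes outside of zero. -/
lemma eq_zero_of_invariant (f : ℂ →₀ ℤ) {q : ℂ} (hq0 : q ≠ 0) (hq : ∀ k : ℕ, 0 < k → q ^ k ≠ 1)
    (hf : ∀ x, f (q⁻¹ * x) = f x) {x : ℂ} (hx : x ≠ 0) : f x = 0 := by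
  by_contra hne
  have hpow : ∀ k : ℕ, f (q ^ k * x) ≠ 0 := by
    intro k
    induction k with
    | zero => simpa using hne
    | succ k ih =>
      rw [← hf, pow_succ', mul_assoc, inv_mul_cancel_left₀ hq0]
      exact ih
  have hle : ∀ i j : ℕ, i < j → q ^ i * x ≠ q ^ j * x := by
    intro i j hij e
    have := mul_right_cancel₀ hx e
    obtain ⟨d, rfl⟩ := Nat.exists_eq_add_of_lt hij
    rw [add_assoc, pow_add] at this
    exact hq (d + 1) (by omega) (mul_left_cancel₀ (pow_ne_zero i hq0)
      (by rw [mul_one]; exact this.symm))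
  have hinj : Function.Injective fun k : ℕ => q ^ k * x := by
    intro i j e
    rcases lt_trichotomy i j with h | h | h
    · exact absurd e (hle i j h)
    · exact h
    · exact absurd e.symm (hle j i h)
  exact Set.infinite_of_injective_forall_mem hinj (s := (f.support : Set ℂ))
    (fun k => by simpa using hpow k) f.support.finite_toSet

end LinearFactors

section Spectrum

variable {n : ℕ} {P : Params n} {l m : Tuple n} {N : ℕ}

/-- The points of the ends of the rows, with multiplicities. -/
def endCount (P : Params n) (N : ℕ) (l : Tuple n) : ℂ →₀ ℤ :=
  ∑ r ∈ rows n N, Finsupp.single (pt P l r) 1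

/-- The points of the boxes, with multiplicities. -/
def boxCount (P : Params n) (N : ℕ) (l : Tuple n) : ℂ →₀ ℤ :=
  ∑ r ∈ rows n N, ∑ k ∈ Finset.range (l r.1 r.2), Finsupp.single (boxPt P r k) 1

/-- The points of the ends of the rows, as a multiset. -/
def endPts (P : Params n) (N : ℕ) (l : Tuple n) : Multiset ℂ := (rows n N).val.map (pt P l)

lemma count_endPts (P : Params n) (N : ℕ) (l : Tuple n) (x : ℂ) :
    ((endPts P N l).count x : ℤ) = endCount P N l x := by
  rw [endPts, Multiset.count_map, endCount, Finsupp.finsetSum_apply]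
  simp only [Finsupp.single_apply, eq_comm (a := pt P l _)]
  rw [← Finset.filter_val, Finset.card_val, Finset.card_filter]
  push_cast
  rfl

lemma prod_rows_linearFactor (P : Params n) (N : ℕ) (l : Tuple n) (c : ℂ) :
    ∏ r ∈ rows n N, (1 - HahnSeries.single (1 : ℤ) (c * pt P l r) : LaurentSeries ℂ) =
      (((endPts P N l).map (c * ·)).map linearFactor).prod := by
  rw [endPts, Multiset.map_map, Multiset.map_map]
  rfl

/-- Equality of two eigenvalues of `ψ^±`, with the denominators cleared. -/
lemma mul_eq_mul_of_tensorPsi_eq {K : Type*} [Field K] [Algebra ℂ K] {T : K}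
    (hT : ∀ c : ℂ, 1 - c • T ≠ 0) (h : P.1 * P.2.1 * P.2.2.1 = 1)
    (hl : SuppLE l N) (hm : SuppLE m N) (e : tensorPsi P l T = tensorPsi P m T) :
    (∏ r ∈ rows n N, (1 - (P.2.2.1 * pt P l r) • T)) *
        (∏ r ∈ rows n N, (1 - (P.2.1 * pt P l r) • T)) *
      ((∏ r ∈ rows n N, (1 - (1 * pt P m r) • T)) *
        (∏ r ∈ rows n N, (1 - (P.1⁻¹ * pt P m r) • T))) =
    (∏ r ∈ rows n N, (1 - (P.2.2.1 * pt P m r) • T)) *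
        (∏ r ∈ rows n N, (1 - (P.2.1 * pt P m r) • T)) *
      ((∏ r ∈ rows n N, (1 - (1 * pt P l r) • T)) *
        (∏ r ∈ rows n N, (1 - (P.1⁻¹ * pt P l r) • T))) := by
  rw [tensorPsi_eq_truncated hT h hl, tensorPsi_eq_truncated hT h hm] at e
  have htail : ∏ j, psiEmpty P.2.1 (pt P l (j, N) • T) =
      ∏ j, psiEmpty P.2.1 (pt P m (j, N) • T) :=
    Finset.prod_congr rfl fun j _ => by rw [pt_eq, pt_eq, hl j N le_rfl, hm j N le_rfl]
  have htail0 : ∏ j, psiEmpty P.2.1 (pt P m (j, N) • T) ≠ 0 :=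
    Finset.prod_ne_zero_iff.2 fun j _ => by
      unfold psiEmpty
      rw [smul_smul]
      exact div_ne_zero (hT _) (hT _)
  rw [htail] at e
  have e' := mul_left_cancel₀ htail0 e
  have hphi : ∀ l : Tuple n, ∏ r ∈ rows n N, phi P.1 P.2.1 P.2.2.1 (pt P l r • T) =
      ((∏ r ∈ rows n N, (1 - (P.2.2.1 * pt P l r) • T)) *
        (∏ r ∈ rows n N, (1 - (P.2.1 * pt P l r) • T))) /
      ((∏ r ∈ rows n N, (1 - (1 * pt P l r) • T)) *
        (∏ r ∈ rows n N, (1 - (P.1⁻¹ * pt P l r) • T))) := by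
    intro l
    rw [← Finset.prod_mul_distrib, ← Finset.prod_mul_distrib, ← Finset.prod_div_distrib]
    refine Finset.prod_congr rfl fun r _ => ?_
    unfold phi
    rw [smul_smul, smul_smul, smul_smul, one_mul]
  rw [hphi, hphi] at e'
  have hden : ∀ (l : Tuple n) (c : ℂ), ∏ r ∈ rows n N, (1 - (c * pt P l r) • T) ≠ 0 :=
    fun l c => Finset.prod_ne_zero_iff.2 fun r _ => hT _
  exact (div_eq_div_iff (mul_ne_zero (hden _ _) (hden _ _))
    (mul_ne_zero (hden _ _) (hden _ _))).1 e'

/-- Comparing numerators and denominators, equal eigenvalues give an equality of multisets. -/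
lemma endPts_add_eq (h : P.1 * P.2.1 * P.2.2.1 = 1) (hu : ∀ i, P.2.2.2 i ≠ 0)
    (hl : SuppLE l N) (hm : SuppLE m N) (e : tensorPsiPlus P l = tensorPsiPlus P m) :
    (endPts P N l).map (P.2.2.1 * ·) + (endPts P N l).map (P.2.1 * ·) +
        ((endPts P N m).map (1 * ·) + (endPts P N m).map (P.1⁻¹ * ·)) =
      (endPts P N m).map (P.2.2.1 * ·) + (endPts P N m).map (P.2.1 * ·) +
        ((endPts P N l).map (1 * ·) + (endPts P N l).map (P.1⁻¹ * ·)) := by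
  have hne : ∀ (l : Tuple n) (c : ℂ), c ≠ 0 → ∀ x ∈ (endPts P N l).map (c * ·), x ≠ 0 := by
    intro l c hc x hx
    simp only [endPts, Multiset.map_map, Multiset.mem_map] at hx
    obtain ⟨r, -, rfl⟩ := hx
    exact mul_ne_zero hc (pt_ne_zero h hu l r)
  have h1 := inv_ne_zero (ne_zero_of_mul₁ h)
  have h2 := ne_zero_of_mul₂ h
  have h3 := ne_zero_of_mul₃ h
  refine eq_of_prod_linearFactor_eq ?_ ?_ ?_
  · simp only [Multiset.mem_add]
    rintro c ((hc | hc) | (hc | hc))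
    exacts [hne _ _ h3 c hc, hne _ _ h2 c hc, hne _ _ one_ne_zero c hc, hne _ _ h1 c hc]
  · simp only [Multiset.mem_add]
    rintro c ((hc | hc) | (hc | hc))
    exacts [hne _ _ h3 c hc, hne _ _ h2 c hc, hne _ _ one_ne_zero c hc, hne _ _ h1 c hc]
  · simp only [Multiset.map_add, Multiset.prod_add, ← prod_rows_linearFactor]
    rw [tensorPsiPlus_eq, tensorPsiPlus_eq] at e
    simpa only [smul_varPlus] using mul_eq_mul_of_tensorPsi_eq one_sub_smul_varPlus_ne h hl hm e

/-- The boxes of a row form a chain in which neighbours are proportional with the factor `q₁`, so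
the boxes determine the ends by a difference operator. -/
lemma endCount_eq_boxCount (h : P.1 ≠ 0) (N : ℕ) (l : Tuple n) (x : ℂ) :
    endCount P N l x = endCount P N 0 x + boxCount P N l (P.1⁻¹ * x) - boxCount P N l x := by
  simp only [endCount, boxCount, Finsupp.finsetSum_apply, ← Finset.sum_add_distrib,
    ← Finset.sum_sub_distrib]
  refine Finset.sum_congr rfl fun r _ => ?_
  have hstep : ∀ k : ℕ, boxPt P r ((k + 1 : ℕ) : ℤ) = P.1 * boxPt P r k := by
    intro k
    simp only [boxPt]
    push_cast
    rw [zpow_add₀ h, zpow_one]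
    ring
  have := Finset.sum_range_sub
    (fun k : ℕ => (Finsupp.single (boxPt P r k) (1 : ℤ) : ℂ →₀ ℤ) x) (l r.1 r.2)
  have e : ∀ k : ℕ, (Finsupp.single (boxPt P r k) (1 : ℤ) : ℂ →₀ ℤ) (P.1⁻¹ * x) =
      (Finsupp.single (boxPt P r ((k + 1 : ℕ) : ℤ)) (1 : ℤ) : ℂ →₀ ℤ) x := by
    intro k
    simp only [Finsupp.single_apply, hstep, eq_inv_mul_iff_mul_eq₀ h]
  rw [Finset.sum_sub_distrib] at this
  simp only [e, pt_eq_boxPt]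
  have e0 : ((0 : Tuple n) r.1 r.2 : ℤ) = ((0 : ℕ) : ℤ) := rfl
  rw [e0]
  linarith

variable [NeZero n] {a b : Fin n → ℕ}

lemma Resonant.q₁_pow_ne_one (h : Resonant P a b) (k : ℕ) (hk : 0 < k) : P.1 ^ k ≠ 1 := by
  have := h.monomial_ne_one (x := k) (y := 0) (z := 0) (by omega)
  simpa using this

lemma Resonant.q₂_pow_ne_one (h : Resonant P a b) (k : ℕ) (hk : 0 < k) : P.2.1 ^ k ≠ 1 := by
  have := h.monomial_ne_one (x := 0) (y := 0) (z := k) (by omega)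
  simpa using this

lemma Resonant.q₃_pow_ne_one (h : Resonant P a b) (k : ℕ) (hk : 0 < k) : P.2.2.1 ^ k ≠ 1 := by
  have := h.monomial_ne_one (x := 0) (y := k) (z := 0) (by omega)
  simpa using this

/-- Equal eigenvalues give equal multisets of points of boxes. With the shifts
`T_q f (x) = f (q⁻¹ x)`, the equality of the eigenvalues says that the difference of the two box
counts is annihilated by `(1 - T_{q₁}) (1 - T_{q₂}) (1 - T_{q₃})`, up to a shift, and each of these
factors is injective on functions of finite support outside of zero. -/
lemma Resonant.boxCount_eq (h : Resonant P a b) (hl : SuppLE l N) (hm : SuppLE m N)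
    (e : tensorPsiPlus P l = tensorPsiPlus P m) {x : ℂ} (hx : x ≠ 0) :
    boxCount P N l x = boxCount P N m x := by
  have q1 := h.q₁_ne
  have q2 := h.q₂_ne
  have q3 := h.q₃_ne
  set D : ℂ →₀ ℤ := endCount P N l - endCount P N m with hD
  have hcount : ∀ (l : Tuple n) {c : ℂ} (_ : c ≠ 0) (x : ℂ),
      (((endPts P N l).map (c * ·)).count x : ℤ) = endCount P N l (c⁻¹ * x) := by
    intro l c hc x
    rw [← count_endPts, ← Multiset.count_map_eq_count' _ (endPts P N l)
      (mul_right_injective₀ hc) (c⁻¹ * x)]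
    simp only [mul_inv_cancel_left₀ hc]
  have hrel : ∀ x, D (P.2.2.1⁻¹ * x) + D (P.2.1⁻¹ * x) = D x + D (P.1 * x) := by
    intro x
    have := congrArg (fun s : Multiset ℂ => (s.count x : ℤ)) (endPts_add_eq h.mul_eq h.u_ne hl hm e)
    simp only [Multiset.count_add, Nat.cast_add, hcount _ q3, hcount _ q2, hcount _ one_ne_zero,
      hcount _ (inv_ne_zero q1), inv_inv] at this
    rw [inv_one, one_mul] at this
    simp only [hD, Finsupp.sub_apply]
    linarith
  -- the relation for `D` is a product of two difference operators
  have hD0 : ∀ x, x ≠ 0 → D x = 0 := by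
    set f : ℂ →₀ ℤ := D - Finsupp.mapDomain (P.2.1 * ·) D with hf
    have hfx : ∀ x, f x = D x - D (P.2.1⁻¹ * x) := by
      intro x
      have := Finsupp.mapDomain_apply (mul_right_injective₀ q2) D (P.2.1⁻¹ * x)
      simp only [mul_inv_cancel_left₀ q2] at this
      rw [hf, Finsupp.sub_apply, this]
    have hf0 : ∀ x, x ≠ 0 → f x = 0 := fun x hx => by
      refine eq_zero_of_invariant f q3 h.q₃_pow_ne_one (fun x => ?_) hx
      rw [hfx, hfx]
      have e1 : P.2.1⁻¹ * (P.2.2.1⁻¹ * x) = P.1 * x := by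
        field_simp
        linear_combination -x * h.mul_eq
      rw [e1]
      have := hrel x
      linarith
    have hf0' : ∀ x, D (P.2.1⁻¹ * x) = D x := by
      intro x
      by_cases hx : x = 0
      · simp [hx]
      · have := hf0 x hx
        rw [hfx] at this
        linarith
    exact fun x hx => eq_zero_of_invariant D q2 h.q₂_pow_ne_one hf0' hx
  set B : ℂ →₀ ℤ := boxCount P N l - boxCount P N m with hB
  have hBx : ∀ x, B (P.1⁻¹ * x) = B x := by
    intro x
    by_cases hx : x = 0
    · simp [hx]
    · have h0 := hD0 x hx
      have h1 := endCount_eq_boxCount q1 N l x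
      have h2 := endCount_eq_boxCount q1 N m x
      rw [hD, Finsupp.sub_apply] at h0
      rw [hB, Finsupp.sub_apply, Finsupp.sub_apply]
      linarith
  have := eq_zero_of_invariant B q1 h.q₁_pow_ne_one hBx hx
  rw [hB, Finsupp.sub_apply] at this
  linarith

/-- The boxes at a given point form a chain under inclusion of admissible tuples, so their number
determines them. -/
lemma Resonant.le_of_boxCount_eq (h : Resonant P a b) (hl : IsAdmissible a b l)
    (hm : IsAdmissible a b m) (hN : SuppLE l N)
    (e : ∀ x, x ≠ 0 → boxCount P N l x = boxCount P N m x) (r : Row n) : l r.1 r.2 ≤ m r.1 r.2 := by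
  classical
  by_contra hlt
  push Not at hlt
  have hrN : r.2 < N := by
    by_contra hc
    rw [hN _ _ (by omega)] at hlt
    omega
  -- a box of `l` which is not in `m`
  set k := m r.1 r.2 with hk
  have hx : boxPt P r k ≠ 0 := by
    rw [boxPt]
    exact mul_ne_zero (mul_ne_zero (zpow_ne_zero _ h.q₁_ne) (zpow_ne_zero _ h.q₃_ne)) (h.u_ne _)
  have key : boxCount P N m (boxPt P r k) < boxCount P N l (boxPt P r k) := by
    simp only [boxCount, Finsupp.finsetSum_apply]
    have hnn : ∀ (r' : Row n) (k' : ℕ),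
        0 ≤ (Finsupp.single (boxPt P r' k') (1 : ℤ) : ℂ →₀ ℤ) (boxPt P r k) := by
      intro r' k'
      rw [Finsupp.single_apply]; split_ifs <;> norm_num
    -- every box of `m` at this point is a box of `l`
    have hle : ∀ r' : Row n,
        ∑ k' ∈ Finset.range (m r'.1 r'.2),
          (Finsupp.single (boxPt P r' k') (1 : ℤ) : ℂ →₀ ℤ) (boxPt P r k) =
        ∑ k' ∈ Finset.range (m r'.1 r'.2) with k' < l r'.1 r'.2,
          (Finsupp.single (boxPt P r' k') (1 : ℤ) : ℂ →₀ ℤ) (boxPt P r k) := by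
      intro r'
      rw [Finset.sum_filter]
      refine Finset.sum_congr rfl fun k' hk' => ?_
      split_ifs with hc
      · rfl
      · rw [Finsupp.single_apply, if_neg]
        intro e'
        exact hc (h.lt_of_boxPt_eq hl hm hlt le_rfl (Finset.mem_range.1 hk') e')
    refine Finset.sum_lt_sum (fun r' _ => ?_) ⟨r, mem_rows.2 hrN, ?_⟩
    · rw [hle]
      refine Finset.sum_le_sum_of_subset_of_nonneg (fun k' hk' => ?_) fun k' _ _ => hnn _ _
      exact Finset.mem_range.2 (Finset.mem_filter.1 hk').2
    · rw [hle]
      refine Finset.sum_lt_sum_of_subset (i := k) (fun k' hk' => ?_) (Finset.mem_range.2 hlt) ?_ ?_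
        fun k' _ _ => hnn _ _
      · exact Finset.mem_range.2 (Finset.mem_filter.1 hk').2
      · simp [hk]
      · simp
  rw [e _ hx] at key
  exact lt_irrefl _ key

/-- The eigenvalues of `ψ⁺` separate the basis vectors. -/
theorem Resonant.eq_of_tensorPsiPlus_eq (h : Resonant P a b) (hl : IsAdmissible a b l)
    (hm : IsAdmissible a b m)
    (e : ∀ k : ℕ, (tensorPsiPlus P l).coeff (k : ℤ) = (tensorPsiPlus P m).coeff (k : ℤ)) :
    l = m := by
  have e' : tensorPsiPlus P l = tensorPsiPlus P m := by
    ext k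
    rcases lt_or_ge k 0 with hk | hk
    · rw [coeff_tensorPsiPlus_of_neg h.mul_eq l hk, coeff_tensorPsiPlus_of_neg h.mul_eq m hk]
    · lift k to ℕ using hk
      exact e k
  obtain ⟨N₁, h1, -⟩ := exists_suppLE l ∅
  obtain ⟨N₂, h2, -⟩ := exists_suppLE m ∅
  have h1 := h1.mono (le_max_left N₁ N₂)
  have h2 := h2.mono (le_max_right N₁ N₂)
  have hb := fun x hx => h.boxCount_eq (x := x) h1 h2 e' hx
  exact tuple_ext fun r => le_antisymm (h.le_of_boxCount_eq hl hm h1 hb r)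
    (h.le_of_boxCount_eq hm hl h2 (fun x hx => (hb x hx).symm) r)

end Spectrum

/-! ### Tameness -/

section Tame

variable {n : ℕ} [NeZero n] {P : Params n} {a b : Fin n → ℕ}

lemma diagOp_apply (χ : Tuple n → ℂ) (w : MSpace a b) (m : AdmTuple a b) :
    diagOp a b χ w m = χ m.1 * w m := by
  classical
  induction w using Finsupp.induction_linear with
  | zero => simp
  | add v w hv hw => rw [map_add, Finsupp.add_apply, hv, hw, Finsupp.add_apply, mul_add]
  | single l c =>
    rw [← mul_one c, ← smul_eq_mul, ← Finsupp.smul_single, map_smul, Finsupp.smul_apply,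
      diagOp_single_apply, Finsupp.smul_apply, Finsupp.single_apply]
    by_cases h : l = m
    · subst h; simp [mul_comm]
    · rw [if_neg fun hc => h (Subtype.ext hc.symm), if_neg h]; simp

lemma Resonant.single_mem_jointEigenspace (h : Resonant P a b) (l : AdmTuple a b) :
    Finsupp.single l 1 ∈ jointEigenspace (action h)
      (fun k => (tensorPsiPlus P l.1).coeff (k : ℤ))
      (fun k => (tensorPsiMinus P l.1).coeff (k : ℤ)) := by
  rw [jointEigenspace, Submodule.mem_iInf]
  intro k
  rw [Submodule.mem_inf, Module.End.mem_eigenspace_iff, Module.End.mem_eigenspace_iff,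
    action_gen, action_gen, genOp, genOp, ← ket_coe, diagOp_ket, diagOp_ket]
  exact ⟨rfl, rfl⟩

lemma Resonant.coeff_eq_of_mem_jointEigenspace (h : Resonant P a b) {χp χm : ℕ → ℂ}
    {w : MSpace a b} (hw : w ∈ jointEigenspace (action h) χp χm) {l : AdmTuple a b}
    (hl : w l ≠ 0) (k : ℕ) : (tensorPsiPlus P l.1).coeff (k : ℤ) = χp k := by
  rw [jointEigenspace, Submodule.mem_iInf] at hw
  have := ((Submodule.mem_inf.1 (hw k)).1)
  rw [Module.End.mem_eigenspace_iff, action_gen, genOp] at this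
  have := DFunLike.congr_fun this l
  rw [diagOp_apply, Finsupp.smul_apply, smul_eq_mul] at this
  exact mul_right_cancel₀ hl this

lemma span_range_single (a b : Fin n → ℕ) :
    Submodule.span ℂ (Set.range fun l : AdmTuple a b => Finsupp.single l (1 : ℂ)) = ⊤ := by
  simpa [Set.image_univ] using (Finsupp.supported_eq_span_single ℂ Set.univ).symm

theorem Resonant.isTame (h : Resonant P a b) : IsTame (action h) := by
  classical
  constructor
  · rw [eq_top_iff, ← span_range_single a b, Submodule.span_le]
    rintro _ ⟨l, rfl⟩
    exact Submodule.mem_iSup_of_mem (p := fun χ : (ℕ → ℂ) × (ℕ → ℂ) =>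
      jointEigenspace (action h) χ.1 χ.2) (_, _) (h.single_mem_jointEigenspace l)
  · intro χp χm
    have rank_le : ∀ v, jointEigenspace (action h) χp χm ≤ Submodule.span ℂ {v} →
        Module.rank ℂ (jointEigenspace (action h) χp χm) ≤ 1 := fun v hle =>
      (Submodule.rank_mono hle).trans ((rank_span_le _).trans (Cardinal.mk_singleton v).le)
    by_cases hex : ∃ l : AdmTuple a b, ∀ k : ℕ, (tensorPsiPlus P l.1).coeff (k : ℤ) = χp k
    · obtain ⟨l, hl⟩ := hex
      refine rank_le (Finsupp.single l 1) fun w hw => Submodule.mem_span_singleton.2 ⟨w l, ?_⟩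
      ext m
      rw [Finsupp.smul_single, smul_eq_mul, mul_one, Finsupp.single_apply]
      split_ifs with hlm
      · rw [hlm]
      · by_contra hne
        have hm := h.coeff_eq_of_mem_jointEigenspace hw (Ne.symm hne)
        exact hlm (Subtype.ext (h.eq_of_tensorPsiPlus_eq l.2 m.2 fun k =>
          (hl k).trans (hm k).symm))
    · refine rank_le 0 fun w hw => ?_
      rw [Submodule.span_zero_singleton, Submodule.mem_bot]
      ext m
      by_contra hne
      exact hex ⟨m, h.coeff_eq_of_mem_jointEigenspace hw hne⟩

/-- A subspace which is stable under the `ψ⁺_k` is spanned by basis vectors. -/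
lemma Resonant.single_mem_of_apply_ne_zero (h : Resonant P a b) {W : Submodule ℂ (MSpace a b)}
    (hW : ∀ k : ℕ, ∀ w ∈ W, genOp P a b (.psiPlus k) w ∈ W) {l : AdmTuple a b} :
    ∀ (d : ℕ) (w : MSpace a b), w.support.card ≤ d → w ∈ W → w l ≠ 0 → Finsupp.single l 1 ∈ W := by
  classical
  intro d
  induction d with
  | zero =>
    intro w hd _ hl
    rw [Nat.le_zero, Finset.card_eq_zero, Finsupp.support_eq_empty] at hd
    exact absurd (by rw [hd]; rfl) hl
  | succ d ih =>
    intro w hd hw hl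
    by_cases hm : ∃ m, w m ≠ 0 ∧ m ≠ l
    · obtain ⟨m, hm, hne⟩ := hm
      obtain ⟨k, hk⟩ : ∃ k : ℕ, (tensorPsiPlus P l.1).coeff (k : ℤ) ≠
          (tensorPsiPlus P m.1).coeff (k : ℤ) := by
        by_contra hc
        push Not at hc
        exact hne (Subtype.ext (h.eq_of_tensorPsiPlus_eq l.2 m.2 hc).symm)
      -- this combination kills `|m⟩` and does not enlarge the support
      set w' := genOp P a b (.psiPlus k) w - (tensorPsiPlus P m.1).coeff (k : ℤ) • w with hw'
      have hx : ∀ x, w' x = ((tensorPsiPlus P x.1).coeff (k : ℤ) -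
          (tensorPsiPlus P m.1).coeff (k : ℤ)) * w x := by
        intro x
        rw [hw', Finsupp.sub_apply, genOp, diagOp_apply, Finsupp.smul_apply, smul_eq_mul, sub_mul]
      refine ih w' ?_ (W.sub_mem (hW k w hw) (W.smul_mem _ hw)) ?_
      · refine Nat.le_of_lt_succ (lt_of_lt_of_le (Finset.card_lt_card ?_) hd)
        refine Finset.ssubset_iff_of_subset (fun x hxs => ?_) |>.2 ⟨m, ?_, ?_⟩
        · rw [Finsupp.mem_support_iff, hx] at hxs
          exact Finsupp.mem_support_iff.2 (right_ne_zero_of_mul hxs)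
        · exact Finsupp.mem_support_iff.2 hm
        · rw [Finsupp.notMem_support_iff, hx, sub_self, zero_mul]
      · rw [hx]
        exact mul_ne_zero (sub_ne_zero.2 hk) hl
    · push Not at hm
      have : Finsupp.single l 1 = (w l)⁻¹ • w := by
        ext m
        rw [Finsupp.smul_apply, Finsupp.single_apply, smul_eq_mul]
        split_ifs with hlm
        · rw [← hlm, inv_mul_cancel₀ hl]
        · by_contra hc
          exact hlm (hm m (right_ne_zero_of_mul (Ne.symm hc))).symm
      rw [this]
      exact W.smul_mem _ hw

end Tame

/-! ### Irreducibility -/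

section Irreducible

variable {n : ℕ} [NeZero n] {P : Params n} {a b : Fin n → ℕ} {l : Tuple n} {r : Row n} {N : ℕ}

/-- Between admissible tuples no factor of the coefficient vanishes or has a pole: neither the
points of the other rows, nor their multiples by `q₁⁻¹`, `q₂`, `q₃` meet the point of the added
box. -/
lemma Resonant.coefN_ne_zero (h : Resonant P a b) {R : Row n → Row n → Prop}
    (hR : ∀ r, ¬ R r r) (hl : IsAdmissible a b l) (hl' : IsAdmissible a b (addBox l r.1 r.2)) :
    coefN R N P l r ≠ 0 := by
  have hv := pt_ne_zero h.mul_eq h.u_ne l r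
  have ne1 : ∀ r', R r' r → 1 - pt P l r' / pt P l r ≠ 0 := fun r' hr' e => by
    refine h.pt_ne hl (r := r) (r' := r') (fun hc => hR r (hc ▸ hr')) ?_
    rw [sub_eq_zero, eq_div_iff hv] at e
    rw [← e, one_mul]
  have neq1 : ∀ r', 1 - P.1⁻¹ • (pt P l r' / pt P l r) ≠ 0 := fun r' e => by
    refine h.pt_ne_q₁_mul_pt hl (growable_of_isAdmissible hl') r' ?_
    rw [sub_eq_zero, smul_eq_mul, ← mul_div_assoc, eq_div_iff hv, one_mul] at e
    rw [e, mul_inv_cancel_left₀ h.q₁_ne]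
  have neq2 : ∀ r', 1 - P.2.1 • (pt P l r' / pt P l r) ≠ 0 := fun r' e => by
    refine h.pt_ne_q₂_mul_pt hl hl' r' ?_
    rw [sub_eq_zero, smul_eq_mul, ← mul_div_assoc, eq_div_iff hv, one_mul] at e
    exact e
  have neq3 : ∀ r', 1 - P.2.2.1 • (pt P l r' / pt P l r) ≠ 0 := fun r' e => by
    refine h.pt_ne_q₃_mul_pt hl hl' r' ?_
    rw [sub_eq_zero, smul_eq_mul, ← mul_div_assoc, eq_div_iff hv, one_mul] at e
    exact e
  classical
  rw [coefN]
  refine mul_ne_zero (Finset.prod_ne_zero_iff.2 fun j hj => ?_)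
    (Finset.prod_ne_zero_iff.2 fun r' hr' => ?_)
  · exact div_ne_zero (neq2 _) (ne1 _ (Finset.mem_filter.1 hj).2)
  · exact div_ne_zero (mul_ne_zero (neq3 _) (neq2 _))
      (mul_ne_zero (ne1 _ (Finset.mem_filter.1 hr').2) (neq1 _))

lemma Resonant.stepE_ne_zero (h : Resonant P a b) (hl : IsAdmissible a b l)
    (hl' : IsAdmissible a b (addBox l r.1 r.2)) : stepE P a b l r ≠ 0 := by
  obtain ⟨N, hN, hr⟩ := exists_suppLE l {r}
  rw [h.isStepCoef_stepE.eq l r N hl hl' hN (hr r (by simp))]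
  refine mul_ne_zero (one_div_ne_zero (sub_ne_zero.2 h.q₁_ne_one.symm)) (h.coefN_ne_zero ?_ hl hl')
  rintro r (hc | hc)
  · exact lt_irrefl _ hc
  · exact lt_irrefl _ hc.2

lemma Resonant.stepF_ne_zero (h : Resonant P a b) (hl : IsAdmissible a b l)
    (hl' : IsAdmissible a b (addBox l r.1 r.2)) : stepF P a b l r ≠ 0 := by
  obtain ⟨N, hN, hr⟩ := exists_suppLE l {r}
  rw [h.isStepCoef_stepF.eq l r N hl hl' hN (hr r (by simp))]
  refine mul_ne_zero (div_ne_zero h.q₁_ne (sub_ne_zero.2 h.q₁_ne_one.symm))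
    (h.coefN_ne_zero ?_ hl hl')
  rintro r (hc | hc)
  · exact lt_irrefl _ hc
  · exact lt_irrefl _ hc.2

/-- Every admissible tuple is obtained from the empty one by adding boxes one at a time, such that
all the intermediate tuples are admissible. -/
lemma Resonant.admTuple_induction (h : Resonant P a b) {motive : AdmTuple a b → Prop}
    (empty : motive (emptyTuple a b))
    (step : ∀ (m l : AdmTuple a b) (r : Row n), l.1 = addBox m.1 r.1 r.2 → motive m → motive l)
    (l : AdmTuple a b) : motive l := by
  have nonneg : ∀ l : Tuple n, 0 ≤ size l := fun l =>
    Finset.sum_nonneg fun i _ => Finset.sum_nonneg fun j _ => Int.natCast_nonneg _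
  have key : ∀ (d : ℕ) (l : AdmTuple a b), size l.1 = d → motive l := by
    intro d
    induction d with
    | zero =>
      intro l hd
      by_cases h0 : l.1 = 0
      · rwa [show l = emptyTuple a b from Subtype.ext h0]
      · obtain ⟨r, hr, -⟩ := h.exists_removable l.2 h0
        have h1 := size_addBox (subBox l.1 r) r
        rw [addBox_subBox hr] at h1
        have := nonneg (subBox l.1 r)
        omega
    | succ d ih =>
      intro l hd
      by_cases h0 : l.1 = 0
      · rwa [show l = emptyTuple a b from Subtype.ext h0]
      · obtain ⟨r, hr, hadm⟩ := h.exists_removable l.2 h0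
        have h1 := size_addBox (subBox l.1 r) r
        rw [addBox_subBox hr] at h1
        exact step ⟨_, hadm⟩ l r (addBox_subBox hr).symm (ih ⟨_, hadm⟩ (by
          change size (subBox l.1 r) = d; push_cast at hd; omega))
  exact key (size l.1).toNat l (Int.toNat_of_nonneg (nonneg _)).symm

/-- A nonzero submodule contains a basis vector, as the joint spectrum of the `ψ⁺_k` is simple.
Removing boxes by `f_0` it contains the empty tuple, and adding boxes by `e_0` everything. -/
theorem Resonant.isIrreducible (h : Resonant P a b) : IsIrreducible (action h) := by
  refine ⟨⟨⟨Finsupp.single (emptyTuple a b) 1, 0, Finsupp.single_ne_zero.2 one_ne_zero⟩⟩,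
    fun W hW => ?_⟩
  have hW' : ∀ x : Gen, ∀ w ∈ W, genOp P a b x w ∈ W := fun x w hw => by
    rw [← action_gen h]; exact hW _ w hw
  have proj : ∀ (l : AdmTuple a b), ∀ w ∈ W, w l ≠ 0 → Finsupp.single l 1 ∈ W := fun l w hw hl =>
    h.single_mem_of_apply_ne_zero (fun k => hW' (.psiPlus k)) _ w le_rfl hw hl
  have up : ∀ l m : AdmTuple a b, ∀ r : Row n, m.1 = addBox l.1 r.1 r.2 →
      Finsupp.single l 1 ∈ W → Finsupp.single m 1 ∈ W := fun l m r hm hl => by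
    refine proj m _ (hW' (.e 0) _ hl) ?_
    rw [genOp, h.isStepCoef_stepE.eOp_single_apply 0 l m hm, zpow_zero, mul_one]
    exact h.stepE_ne_zero l.2 (hm ▸ m.2)
  have down : ∀ l m : AdmTuple a b, ∀ r : Row n, m.1 = addBox l.1 r.1 r.2 →
      Finsupp.single m 1 ∈ W → Finsupp.single l 1 ∈ W := fun l m r hm hl => by
    refine proj l _ (hW' (.f 0) _ hl) ?_
    rw [genOp, h.isStepCoef_stepF.fOp_single_apply, h.isStepCoef_stepF.eOp_single_apply 0 l m hm,
      zpow_zero, mul_one]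
    exact h.stepF_ne_zero l.2 (hm ▸ m.2)
  refine or_iff_not_imp_left.2 fun hne => ?_
  obtain ⟨w, hw, hw0⟩ := (Submodule.ne_bot_iff W).1 hne
  obtain ⟨l, hl⟩ := Finsupp.ne_iff.1 hw0
  have h0 : Finsupp.single (emptyTuple a b) 1 ∈ W :=
    h.admTuple_induction (motive := fun l => Finsupp.single l 1 ∈ W →
      Finsupp.single (emptyTuple a b) 1 ∈ W) id (fun m l r hml ih hl => ih (down m l r hml hl)) l
      (proj l w hw hl)
  rw [eq_top_iff, ← span_range_single a b, Submodule.span_le]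
  rintro _ ⟨l, rfl⟩
  exact h.admTuple_induction (motive := fun l => Finsupp.single l 1 ∈ W) h0
    (fun m l r hml hm => up m l r hml hm) l

end Irreducible

/-! ### The highest weight -/

section HighestWeight

variable {n : ℕ}

lemma tensorPsiPlus_zero (P : Params n) :
    tensorPsiPlus P 0 = ∏ i, psiEmpty P.2.1 (HahnSeries.single (1 : ℤ) (P.2.2.2 i)) := by
  simp [tensorPsiPlus, fockPsi]

lemma tensorPsiMinus_zero (P : Params n) :
    tensorPsiMinus P 0 = ∏ i, psiEmpty P.2.1 (HahnSeries.single (-1 : ℤ) (P.2.2.2 i)) := by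
  simp [tensorPsiMinus, fockPsi]

variable [NeZero n] {P : Params n} {a b : Fin n → ℕ}

theorem Resonant.isHighestWeight (h : Resonant P a b) :
    IsHighestWeight (action h) (Finsupp.single (emptyTuple a b) 1)
      (∏ i, psiEmpty P.2.1 (HahnSeries.single (1 : ℤ) (P.2.2.2 i)))
      (∏ i, psiEmpty P.2.1 (HahnSeries.single (-1 : ℤ) (P.2.2.2 i))) := by
  set v : MSpace a b := Finsupp.single (emptyTuple a b) 1 with hv
  have hket : v = ket a b 0 := (ket_coe (emptyTuple a b)).symm
  refine ⟨fun w => ?_, fun k => ?_, fun k => ?_, fun k => ?_⟩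
  · have htop := (h.isIrreducible.2
      (LinearMap.range ((LinearMap.applyₗ v).comp (action h).toLinearMap)) ?_).resolve_left ?_
    · exact LinearMap.range_eq_top.1 htop w
    · rintro x _ ⟨y, rfl⟩
      refine ⟨x * y, ?_⟩
      simp only [LinearMap.comp_apply, AlgHom.toLinearMap_apply, LinearMap.applyₗ_apply_apply,
        map_mul, Module.End.mul_apply]
    · refine (Submodule.ne_bot_iff _).2 ⟨v, ⟨1, ?_⟩, Finsupp.single_ne_zero.2 one_ne_zero⟩
      simp only [LinearMap.comp_apply, AlgHom.toLinearMap_apply, LinearMap.applyₗ_apply_apply,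
        map_one, Module.End.one_apply]
  · rw [action_gen, genOp, hket, fOp_ket (l := 0) (N := 0) _ (emptyTuple a b).2 (fun _ _ _ => rfl)]
    simp [rows]
  · rw [action_gen, genOp, hket, diagOp_ket, tensorPsiPlus_zero]
  · rw [action_gen, genOp, hket, diagOp_ket, tensorPsiMinus_zero]

end HighestWeight

end

end QuantumGl

theorem mainTheorem2 (n : ℕ) [NeZero n] (hn : 2 ≤ n)
    (q₁ q₂ q₃ : ℂ) (hq : q₁ * q₂ * q₃ = 1)
    (a b : Fin n → ℕ) (p' p : ℕ)
    (hp' : p' = ∑ i, (a i + 1)) (hp : p = ∑ i, (b i + 1)) (hne : p ≠ p')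
    (hres : ∀ x y : ℤ, q₁ ^ x * q₃ ^ y = 1 ↔ ∃ κ : ℤ, x = p' * κ ∧ y = p * κ)
    (u : Fin n → ℂ) (hu0 : u 0 ≠ 0)
    (hu : ∀ i : Fin n, (i : ℕ) + 1 < n →
      u i = u (i + 1) * q₁ ^ (a i + 1) * q₃ ^ (b i + 1)) :
    ∃ ρ : QuantumGl.QAlg q₁ q₂ q₃ →ₐ[ℂ] Module.End ℂ (QuantumGl.MSpace a b),
      QuantumGl.IsInducedAction u a b ρ ∧
      (∀ ρ' : QuantumGl.QAlg q₁ q₂ q₃ →ₐ[ℂ] Module.End ℂ (QuantumGl.MSpace a b),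
        QuantumGl.IsInducedAction u a b ρ' → ρ' = ρ) ∧
      QuantumGl.IsGradedModule ρ (QuantumGl.gradedPiece a b) ∧
      (n < p →
        QuantumGl.IsIrreducible ρ ∧
        QuantumGl.IsTame ρ ∧
        QuantumGl.IsHighestWeight ρ (Finsupp.single (QuantumGl.emptyTuple a b) 1)
          (∏ i, QuantumGl.psiEmpty q₂ (HahnSeries.single (1 : ℤ) (u i)))
          (∏ i, QuantumGl.psiEmpty q₂ (HahnSeries.single (-1 : ℤ) (u i)))) := by
  subst hp' hp
  have h : QuantumGl.Resonant (q₁, q₂, q₃, u) a b := ⟨hn, hq, hres, hne, hu0, hu⟩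
  exact ⟨QuantumGl.action h, h.isInducedAction,
    fun _ hρ' => h.isInducedAction_unique h.isInducedAction hρ', h.isGradedModule,
    fun _ => ⟨h.isIrreducible, h.isTame, h.isHighestWeight⟩⟩
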